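/- **Theorem (joint asymptotic normality of the constrained MLE).** Let $d\ge 2$ and let $\mathbb H^d=\{x\in\mathbb R^{d+1}:\langle x,x\rangle_L=-1,\ x_0>0\}$, $\langle x,y\rangle_L=-x_0y_0+\sum_{j=1}^d x_jy_j$, be hyperbolic space with distance $\rho(x,y)=\operatorname{arcosh}(-\langle x,y\rangle_L)$, exponential and logarithm maps $\operatorname{Exp}_\mu,\operatorname{Log}_\mu$, origin $o=(1,0,\dots,0)$, and parallel transport $PT_{x\to y}$ along geodesics; identify $T_o\mathbb H^d$ with $\mathbb R^d$ by $(0,v)\leftrightarrow v$. For $\mu\in\mathbb H^d$ and a symmetric positive definite $d\times d$ matrix $\Sigma$, let $\mathrm{HWN}_d(\mu,\Sigma)$ be the law of $\operatorname{Exp}_\mu(PT_{o\to\mu}Z)$ with $Z\sim N_d(0,\Sigma)$. Put $T_\mu(x)=PT_{o\to\mu}^{-1}(\operatorname{Log}_\mu x)\in\mathbb R^d$, $\varphi(v)=\log(\sinh\|v\|/\|v\|)$ for $v\neq0$, $\varphi(0)=0$, and let $$m_{\mu,\Sigma}(x)=-\tfrac12\log\det\Sigma-\tfrac12T_\mu(x)^\top\Sigma^{-1}T_\mu(x)-(d-1)\varphi(T_\mu(x))$$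 be the log-density (up to an additive constant, with respect to hyperbolic volume) and $\ell_n(\mu,\Sigma)=\sum_{i=1}^n m_{\mu,\Sigma}(X_i)$. Fix $0<\lambda_-<\lambda_+$, let $\mathcal K$ be the set of symmetric positive definite $\Sigma$ with $\lambda_-I\preceq\Sigma\preceq\lambda_+I$, and let $\operatorname{int}(\mathcal K)$ be its interior relative to the space of symmetric positive definite matrices. Let $\mu_0\in\mathbb H^d$, $\Sigma_0\in\operatorname{int}(\mathcal K)$, and let $X_1,X_2,\dots$ be i.i.d. from $\mathrm{HWN}_d(\mu_0,\Sigma_0)$. Let $(\hat\mu_n,\hat\Sigma_n)$ be any measurable $\mathbb H^d\times\mathcal K$-valued estimators such that, for each $n\ge1$, almost surely $(\hat\mu_n,\hat\Sigma_n)$ maximizes $\ell_n$ over $\mathbb H^d\times\mathcal K$. Identify $T_{\mu_0}\mathbb H^d$ with $\mathbb R^d$ by any linear isometry and use the global chart $$\vartheta=(\alpha,\beta)=\bigl(\operatorname{Log}_{\mu_0}\mu,\ \operatorname{vech}(\log\Sigma)\bigr)\in\mathbb R^p,\qquad p=d+\tfrac{d(d+1)}2,$$ with inverse $\mu(\alpha)=\operatorname{Exp}_{\mu_0}\alpha$,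 $\Sigma(\beta)=\exp(\operatorname{mat}\beta)$, where $\log,\exp$ are the matrix logarithm and exponential, and $\operatorname{mat}$ is the inverse of $\operatorname{vech}$ on symmetric matrices. Let $\vartheta_0=(0,\operatorname{vech}(\log\Sigma_0))$ and $\hat\vartheta_n$ be the coordinates of $(\mu_0,\Sigma_0)$ and $(\hat\mu_n,\hat\Sigma_n)$, write $m_\vartheta=m_{\mu(\alpha),\Sigma(\beta)}$, and let $s_\vartheta(x)=\partial_\vartheta m_\vartheta(x)$ and $\mathcal I(\vartheta)=\mathbb E_\vartheta[s_\vartheta(X)s_\vartheta(X)^\top]$ be the score and the Fisher information. Assume that $\mathcal I(\vartheta_0)$ is positive definite. Then $$\sqrt n(\hat\vartheta_n-\vartheta_0)=\mathcal I(\vartheta_0)^{-1}\frac1{\sqrt n}\sum_{i=1}^n s_{\vartheta_0}(X_i)+o_p(1),$$ where $o_p(1)$ denotes a term converging to $0$ in probability, and hence $$\sqrt n(\hat\vartheta_n-\vartheta_0)\ \Rightarrow\ N\bigl(0,\mathcal I(\vartheta_0)^{-1}\bigr)\quad\text{in distribution}.$$ -/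

import Mathlib

open MeasureTheory ProbabilityTheory Filter Topology
open scoped Matrix

noncomputable section

namespace HypWN

/-! ### The Lorentz model of hyperbolic space -/

/-- The Lorentz form `-x₀ y₀ + ∑ⱼ xⱼ yⱼ` on `ℝ^(d+1)`. -/
def lorentz {d : ℕ} (x y : Fin (d + 1) → ℝ) : ℝ :=
  -(x 0 * y 0) + ∑ j : Fin d, x j.succ * y j.succ

theorem lorentz_comm {d : ℕ} (x y : Fin (d + 1) → ℝ) : lorentz x y = lorentz y x := by
  simp only [lorentz, mul_comm]

theorem lorentz_add_right {d : ℕ} (x y z : Fin (d + 1) → ℝ) :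
    lorentz x (y + z) = lorentz x y + lorentz x z := by
  simp only [lorentz, Pi.add_apply, mul_add, Finset.sum_add_distrib]
  ring

theorem lorentz_smul_right {d : ℕ} (c : ℝ) (x y : Fin (d + 1) → ℝ) :
    lorentz x (c • y) = c * lorentz x y := by
  simp only [lorentz, Pi.smul_apply, smul_eq_mul, mul_add, Finset.mul_sum]
  congr 1
  · ring
  · exact Finset.sum_congr rfl fun j _ => by ring

theorem lorentz_add_left {d : ℕ} (x y z : Fin (d + 1) → ℝ) :
    lorentz (x + y) z = lorentz x z + lorentz y z := by
  rw [lorentz_comm, lorentz_add_right, lorentz_comm z x, lorentz_comm z y]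

theorem lorentz_smul_left {d : ℕ} (c : ℝ) (x y : Fin (d + 1) → ℝ) :
    lorentz (c • x) y = c * lorentz x y := by
  rw [lorentz_comm, lorentz_smul_right, lorentz_comm y x]

/-- Hyperbolic space `ℍ^d`: the upper sheet of the hyperboloid. -/
abbrev Hyp (d : ℕ) : Type := {x : Fin (d + 1) → ℝ // lorentz x x = -1 ∧ 0 < x 0}

/-- The tangent space `T_μ ℍ^d`, the Lorentz-orthogonal complement of `μ`. -/
def tangentSpace {d : ℕ} (μ : Hyp d) : Submodule ℝ (Fin (d + 1) → ℝ) where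
  carrier := {v | lorentz μ.1 v = 0}
  add_mem' {a b} ha hb := by
    have ha' : lorentz μ.1 a = 0 := ha
    have hb' : lorentz μ.1 b = 0 := hb
    change lorentz μ.1 (a + b) = 0
    rw [lorentz_add_right, ha', hb', add_zero]
  zero_mem' := by simp [lorentz]
  smul_mem' c v hv := by
    have hv' : lorentz μ.1 v = 0 := hv
    change lorentz μ.1 (c • v) = 0
    rw [lorentz_smul_right, hv', mul_zero]

/-- The Riemannian norm of a tangent vector. -/
def tnorm {d : ℕ} {μ : Hyp d} (v : tangentSpace μ) : ℝ := √(lorentz v.1 v.1)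

/-- The hyperbolic distance. -/
def hdist {d : ℕ} (x y : Hyp d) : ℝ := Real.arcosh (-lorentz x.1 y.1)

theorem tangent_bounds {d : ℕ} {μ : Hyp d} (v : tangentSpace μ) :
    0 ≤ lorentz v.1 v.1 ∧ v.1 0 ^ 2 ≤ (μ.1 0 ^ 2 - 1) * lorentz v.1 v.1 := by
  obtain ⟨v, hv⟩ := v
  obtain ⟨μ, hμ, hpos⟩ := μ
  have hv' : lorentz μ v = 0 := hv
  have cs := Finset.sum_mul_sq_le_sq_mul_sq Finset.univ
    (fun j : Fin d => μ j.succ) (fun j : Fin d => v j.succ)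
  have hq : 0 ≤ ∑ j : Fin d, v j.succ ^ 2 := Finset.sum_nonneg fun j _ => sq_nonneg _
  simp only [lorentz, ← sq] at hv' hμ ⊢
  set a := ∑ j : Fin d, μ j.succ ^ 2
  set q := ∑ j : Fin d, v j.succ ^ 2
  have h1 : ∑ j : Fin d, μ j.succ * v j.succ = μ 0 * v 0 := by linarith
  rw [h1] at cs
  have ha : a = μ 0 ^ 2 - 1 := by linarith
  rw [ha] at cs
  have hp : 0 < μ 0 ^ 2 := by positivity
  constructor
  · by_contra! h
    nlinarith [mul_neg_of_pos_of_neg hp h]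
  · nlinarith

theorem lorentz_neg {d : ℕ} (x y : Hyp d) : lorentz x.1 y.1 < 0 := by
  obtain ⟨x, hx, hx0⟩ := x
  obtain ⟨y, hy, hy0⟩ := y
  have cs := Finset.sum_mul_sq_le_sq_mul_sq Finset.univ
    (fun j : Fin d => x j.succ) (fun j : Fin d => y j.succ)
  simp only [lorentz, ← sq] at hx hy ⊢
  have ha : ∑ j : Fin d, x j.succ ^ 2 = x 0 ^ 2 - 1 := by linarith
  have hb : ∑ j : Fin d, y j.succ ^ 2 = y 0 ^ 2 - 1 := by linarith
  have hb' : 0 ≤ ∑ j : Fin d, y j.succ ^ 2 := Finset.sum_nonneg fun j _ => sq_nonneg _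
  rw [ha, hb] at cs
  have hxy : 0 < x 0 * y 0 := mul_pos hx0 hy0
  have : (∑ j : Fin d, x j.succ * y j.succ) < x 0 * y 0 := by
    refine lt_of_pow_lt_pow_left₀ 2 hxy.le ?_
    nlinarith [sq_pos_of_pos hx0, sq_pos_of_pos hy0]
  linarith

theorem expMap_mem {d : ℕ} (μ : Hyp d) (v : tangentSpace μ) :
    lorentz (Real.cosh (tnorm v) • μ.1 + (Real.sinh (tnorm v) / tnorm v) • v.1)
      (Real.cosh (tnorm v) • μ.1 + (Real.sinh (tnorm v) / tnorm v) • v.1) = -1 ∧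
    0 < (Real.cosh (tnorm v) • μ.1 + (Real.sinh (tnorm v) / tnorm v) • v.1) 0 := by
  obtain ⟨h0, h1⟩ := tangent_bounds v
  have hμv : lorentz μ.1 v.1 = 0 := v.2
  have hs : tnorm v ^ 2 = lorentz v.1 v.1 := Real.sq_sqrt h0
  have hs0 : 0 ≤ tnorm v := Real.sqrt_nonneg _
  have hc := Real.cosh_sq (tnorm v)
  constructor
  · simp only [lorentz_add_left, lorentz_add_right, lorentz_smul_left, lorentz_smul_right,
      lorentz_comm v.1 μ.1, hμv, μ.2.1, ← hs]
    rcases eq_or_ne (tnorm v) 0 with h | h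
    · simp [h]
    · field_simp
      linear_combination (-(tnorm v)) * hc
  · have hμ0 := μ.2.2
    have hv0 : |v.1 0| ≤ μ.1 0 * tnorm v := by
      refine abs_le_of_sq_le_sq ?_ (by positivity)
      rw [← hs] at h1
      nlinarith [sq_nonneg (tnorm v)]
    have hsinh : 0 ≤ Real.sinh (tnorm v) := Real.sinh_nonneg_iff.mpr hs0
    have hlt := Real.sinh_lt_cosh (tnorm v)
    have key : |Real.sinh (tnorm v) / tnorm v * v.1 0| ≤ Real.sinh (tnorm v) * μ.1 0 := by
      rcases eq_or_ne (tnorm v) 0 with h | h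
      · simp [h]
      · have hpos : 0 < tnorm v := lt_of_le_of_ne hs0 (Ne.symm h)
        rw [abs_mul, abs_of_nonneg (div_nonneg hsinh hs0), div_mul_eq_mul_div,
          div_le_iff₀ hpos]
        nlinarith [mul_le_mul_of_nonneg_left hv0 hsinh]
    have := neg_le_of_abs_le key
    simp only [Pi.add_apply, Pi.smul_apply, smul_eq_mul]
    nlinarith

/-- `Exp_μ(v) = cosh ‖v‖ μ + sinh ‖v‖ v / ‖v‖`, equal to `μ` at `v = 0`. -/
def expMap {d : ℕ} (μ : Hyp d) (v : tangentSpace μ) : Hyp d :=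
  ⟨Real.cosh (tnorm v) • μ.1 + (Real.sinh (tnorm v) / tnorm v) • v.1, expMap_mem μ v⟩

/-- `Log_μ(x) = ρ(μ,x) / √(⟨μ,x⟩² - 1) (x + ⟨μ,x⟩ μ)`. At `x = μ` the vector `x + ⟨μ,x⟩ μ`
vanishes, so that `Log_μ(μ) = 0`. -/
def logMap {d : ℕ} (μ x : Hyp d) : tangentSpace μ :=
  ⟨(hdist μ x / √((-lorentz μ.1 x.1) ^ 2 - 1)) • (x.1 + lorentz μ.1 x.1 • μ.1), by
    change lorentz μ.1 _ = 0
    rw [lorentz_smul_right, lorentz_add_right, lorentz_smul_right, μ.2.1]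
    ring⟩

/-- Parallel transport `T_x ℍ^d → T_y ℍ^d` along the geodesic from `x` to `y`:
`v ↦ v + ⟨y,v⟩ / (1 - ⟨x,y⟩) (x + y)`. -/
def transportFun {d : ℕ} (x y : Hyp d) (v : tangentSpace x) : tangentSpace y :=
  ⟨v.1 + (lorentz y.1 v.1 / (1 - lorentz x.1 y.1)) • (x.1 + y.1), by
    change lorentz y.1 _ = 0
    have h := lorentz_neg x y
    have h' : 1 - lorentz x.1 y.1 ≠ 0 := by linarith
    rw [lorentz_add_right, lorentz_smul_right, lorentz_add_right, lorentz_comm y.1 x.1, y.2.1]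
    field_simp
    ring⟩

theorem transportFun_transportFun {d : ℕ} (x y : Hyp d) (v : tangentSpace x) :
    transportFun y x (transportFun x y v) = v := by
  have hv : lorentz x.1 v.1 = 0 := v.2
  have h := lorentz_neg x y
  have h' : 1 - lorentz x.1 y.1 ≠ 0 := by linarith
  apply Subtype.ext
  simp only [transportFun]
  rw [lorentz_add_right, lorentz_smul_right, lorentz_add_right, hv, x.2.1, lorentz_comm y.1 x.1,
    add_comm y.1 x.1, add_assoc, ← add_smul]
  have : lorentz y.1 v.1 / (1 - lorentz x.1 y.1) +
      (0 + lorentz y.1 v.1 / (1 - lorentz x.1 y.1) * (-1 + lorentz x.1 y.1)) /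
        (1 - lorentz x.1 y.1) = 0 := by
    field_simp
    ring
  rw [this, zero_smul, add_zero]

/-- Parallel transport `PT_{x → y}` as a linear isomorphism; its inverse is `PT_{y → x}`. -/
def transport {d : ℕ} (x y : Hyp d) : tangentSpace x ≃ₗ[ℝ] tangentSpace y where
  toFun := transportFun x y
  invFun := transportFun y x
  left_inv := transportFun_transportFun x y
  right_inv := transportFun_transportFun y x
  map_add' v w := by
    apply Subtype.ext
    simp only [transportFun, Submodule.coe_add, lorentz_add_right, add_div, add_smul]
    abel
  map_smul' c v := by
    apply Subtype.ext
    simp only [transportFun, Submodule.coe_smul, lorentz_smul_right, RingHom.id_apply, smul_add,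
      smul_smul, mul_div_assoc]

/-- The origin `o = (1, 0, …, 0)`. -/
def origin (d : ℕ) : Hyp d := ⟨Fin.cons 1 0, by simp [lorentz], by simp⟩

/-- The identification `ℝ^d ≅ T_o ℍ^d`, `v ↦ (0, v)`. -/
def originEquiv (d : ℕ) : EuclideanSpace ℝ (Fin d) ≃ₗ[ℝ] tangentSpace (origin d) where
  toFun z := ⟨Fin.cons 0 z.ofLp, by
    change lorentz _ _ = 0
    simp [lorentz, origin]⟩
  invFun v := WithLp.toLp 2 fun j => v.1 j.succ
  left_inv z := by ext j; simp
  right_inv v := by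
    have hv : lorentz (origin d).1 v.1 = 0 := v.2
    have h0 : v.1 0 = 0 := by simpa [lorentz, origin] using hv
    apply Subtype.ext
    funext j
    refine Fin.cases ?_ (fun j => ?_) j
    · simp [h0]
    · simp
  map_add' z w := by
    apply Subtype.ext
    funext j
    refine Fin.cases ?_ (fun j => ?_) j <;> simp
  map_smul' c z := by
    apply Subtype.ext
    funext j
    refine Fin.cases ?_ (fun j => ?_) j <;> simp

/-- The global coordinate `T_μ(x) = PT_{o → μ}⁻¹ (Log_μ x) ∈ ℝ^d`. -/
def coord {d : ℕ} (μ x : Hyp d) : EuclideanSpace ℝ (Fin d) :=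
  (originEquiv d).symm ((transport (origin d) μ).symm (logMap μ x))

/-! ### The anisotropic hyperbolic wrapped normal family -/

/-- Real symmetric positive definite `d × d` matrices, with the topology and Borel σ-algebra
inherited from the space of matrices. -/
abbrev SPD (d : ℕ) : Type := {A : Matrix (Fin d) (Fin d) ℝ // A.PosDef}

instance (d : ℕ) : MeasurableSpace (SPD d) := borel _

instance (d : ℕ) : BorelSpace (SPD d) := ⟨rfl⟩

/-- The map `z ↦ Exp_μ (PT_{o → μ} z)`. -/
def wrap {d : ℕ} (μ : Hyp d) (z : EuclideanSpace ℝ (Fin d)) : Hyp d :=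
  expMap μ (transport (origin d) μ (originEquiv d z))

/-- The law `HWN_d(μ, Σ)` of `Exp_μ (PT_{o → μ} Z)` for `Z ∼ N_d(0, Σ)`. -/
def hwn {d : ℕ} (μ : Hyp d) (S : SPD d) : Measure (Hyp d) :=
  (multivariateGaussian 0 S.1).map (wrap μ)

theorem measurable_wrap {d : ℕ} (μ : Hyp d) : Measurable (wrap μ) := by
  have h1 : Continuous fun z : EuclideanSpace ℝ (Fin d) =>
      transport (origin d) μ (originEquiv d z) :=
    ((transport (origin d) μ).toLinearMap ∘ₗ
      (originEquiv d).toLinearMap).continuous_of_finiteDimensional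
  have h2 : Measurable fun z : EuclideanSpace ℝ (Fin d) =>
      (transport (origin d) μ (originEquiv d z)).1 := (continuous_subtype_val.comp h1).measurable
  have h2' : ∀ i, Measurable fun z : EuclideanSpace ℝ (Fin d) =>
      (transport (origin d) μ (originEquiv d z)).1 i := fun i => (measurable_pi_apply i).comp h2
  have h3 : Measurable fun z : EuclideanSpace ℝ (Fin d) =>
      tnorm (transport (origin d) μ (originEquiv d z)) := by
    unfold tnorm lorentz
    exact (((h2' 0).mul (h2' 0)).neg.add
      (Finset.measurable_fun_sum _ fun j _ => (h2' j.succ).mul (h2' j.succ))).sqrt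
  refine Measurable.subtype_mk (measurable_pi_lambda _ fun i => ?_)
  simp only [Pi.add_apply, Pi.smul_apply, smul_eq_mul]
  exact ((Real.measurable_cosh.comp h3).mul_const _).add
    (((Real.measurable_sinh.comp h3).div h3).mul (h2' i))

instance {d : ℕ} (μ : Hyp d) (S : SPD d) : IsProbabilityMeasure (hwn μ S) :=
  Measure.isProbabilityMeasure_map (measurable_wrap μ).aemeasurable

open Classical in
/-- `φ(v) = log (sinh ‖v‖ / ‖v‖)`, with `φ(0) = 0`. -/
def phi {d : ℕ} (v : EuclideanSpace ℝ (Fin d)) : ℝ :=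
  if v = 0 then 0 else Real.log (Real.sinh ‖v‖ / ‖v‖)

/-- The log-density `m_{μ,Σ}(x)` of `HWN_d(μ, Σ)` with respect to the hyperbolic volume, without
its additive constant `-(d/2) log (2π)`. -/
def logDensity {d : ℕ} (μ : Hyp d) (S : SPD d) (x : Hyp d) : ℝ :=
  -(1 / 2) * Real.log S.1.det
    - (1 / 2) * ((coord μ x).ofLp ⬝ᵥ (S.1⁻¹ *ᵥ (coord μ x).ofLp))
    - ((d : ℝ) - 1) * phi (coord μ x)

/-- The log-likelihood `ℓ_n(μ, Σ)` of the first `n` observations. -/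
def logLik {d : ℕ} (n : ℕ) (x : ℕ → Hyp d) (θ : Hyp d × SPD d) : ℝ :=
  ∑ i ∈ Finset.range n, logDensity θ.1 θ.2 (x i)

/-- The compact shell `𝒦 = {Σ : lo I ⪯ Σ ⪯ hi I}`. -/
def shell (d : ℕ) (lo hi : ℝ) : Set (SPD d) :=
  {S | (S.1 - lo • (1 : Matrix (Fin d) (Fin d) ℝ)).PosSemidef ∧
    (hi • (1 : Matrix (Fin d) (Fin d) ℝ) - S.1).PosSemidef}

/-- `θ = (μ, Σ)` maximizes `ℓ_n` over `ℍ^d × 𝒦`. -/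
def IsShellMLE {d : ℕ} (lo hi : ℝ) (n : ℕ) (x : ℕ → Hyp d) (θ : Hyp d × SPD d) : Prop :=
  θ.2 ∈ shell d lo hi ∧ ∀ θ' : Hyp d × SPD d, θ'.2 ∈ shell d lo hi → logLik n x θ' ≤ logLik n x θ

/-! ### The Euclidean chart, the score and the Fisher information -/

/-- Positions on or below the diagonal, indexing the entries of `vech`. -/
abbrev LowerIdx (d : ℕ) : Type := {p : Fin d × Fin d // p.2 ≤ p.1}

/-- The Euclidean parameter space of `ϑ = (α, β)`, of dimension `d + d (d + 1) / 2`. -/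
abbrev Param (d : ℕ) : Type := EuclideanSpace ℝ (Fin d ⊕ LowerIdx d)

/-- The half-vectorization of a symmetric matrix. -/
def vech {d : ℕ} (A : Matrix (Fin d) (Fin d) ℝ) (p : LowerIdx d) : ℝ := A p.1.1 p.1.2

/-- The symmetric matrix with half-vectorization `β`. -/
def mat {d : ℕ} (β : LowerIdx d → ℝ) : Matrix (Fin d) (Fin d) ℝ :=
  Matrix.of fun i j => β ⟨(max i j, min i j), min_le_max⟩

theorem mat_isHermitian {d : ℕ} (β : LowerIdx d → ℝ) : (mat β).IsHermitian := by
  ext i j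
  simp [mat, Matrix.conjTranspose_apply, max_comm, min_comm]

theorem posDef_exp {d : ℕ} {A : Matrix (Fin d) (Fin d) ℝ} (hA : A.IsHermitian) :
    (NormedSpace.exp A).PosDef := by
  have hB : ((1 / 2 : ℝ) • A).IsHermitian := by
    unfold Matrix.IsHermitian
    rw [Matrix.conjTranspose_smul, hA.eq]
    simp
  have h : NormedSpace.exp A =
      (NormedSpace.exp ((1 / 2 : ℝ) • A))ᴴ * NormedSpace.exp ((1 / 2 : ℝ) • A) := by
    rw [hB.exp.eq, ← Matrix.exp_add_of_commute _ _ (Commute.refl _), ← add_smul]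
    norm_num
  rw [h]
  refine Matrix.PosDef.conjTranspose_mul_self _ ?_
  exact Matrix.mulVec_injective_of_isUnit (Matrix.isUnit_exp _)

/-- The chart `(μ, Σ) ↦ (α, β) = (Log_{μ₀} μ, vech (log Σ))`, where `T_{μ₀} ℍ^d` is identified
with `ℝ^d` through `Φ` and `log` is the matrix logarithm. -/
def chart {d : ℕ} (μ₀ : Hyp d) (Φ : EuclideanSpace ℝ (Fin d) ≃ₗ[ℝ] tangentSpace μ₀)
    (θ : Hyp d × SPD d) : Param d :=
  WithLp.toLp 2 (Sum.elim (Φ.symm (logMap μ₀ θ.1)).ofLp (vech (cfc Real.log θ.2.1)))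

/-- The inverse chart `(α, β) ↦ (Exp_{μ₀} α, exp (mat β))`. -/
def chartInv {d : ℕ} (μ₀ : Hyp d) (Φ : EuclideanSpace ℝ (Fin d) ≃ₗ[ℝ] tangentSpace μ₀)
    (ϑ : Param d) : Hyp d × SPD d :=
  (expMap μ₀ (Φ (WithLp.toLp 2 fun i => ϑ (Sum.inl i))),
    ⟨NormedSpace.exp (mat fun p => ϑ (Sum.inr p)), posDef_exp (mat_isHermitian _)⟩)

/-- The score `s_ϑ(x) = ∂_ϑ m_ϑ(x)` in the chart. -/
def score {d : ℕ} (μ₀ : Hyp d) (Φ : EuclideanSpace ℝ (Fin d) ≃ₗ[ℝ] tangentSpace μ₀)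
    (ϑ : Param d) (x : Hyp d) : Param d :=
  gradient (fun ϑ' => logDensity (chartInv μ₀ Φ ϑ').1 (chartInv μ₀ Φ ϑ').2 x) ϑ

/-- The Fisher information matrix `I(ϑ) = E_ϑ[s_ϑ(X) s_ϑ(X)ᵀ]` in the chart. -/
def fisherInfo {d : ℕ} (μ₀ : Hyp d) (Φ : EuclideanSpace ℝ (Fin d) ≃ₗ[ℝ] tangentSpace μ₀)
    (ϑ : Param d) : Matrix (Fin d ⊕ LowerIdx d) (Fin d ⊕ LowerIdx d) ℝ :=
  Matrix.of fun i j =>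
    ∫ x, score μ₀ Φ ϑ x i * score μ₀ Φ ϑ x j ∂(hwn (chartInv μ₀ Φ ϑ).1 (chartInv μ₀ Φ ϑ).2)

end HypWN

end

open HypWN

noncomputable section

namespace HypWN

open scoped ContDiff

/-! ### Functions of temperate growth built from a chain of derivatives -/

/-! This is the classical M-estimation argument: consistency, then a Taylor expansion of the score
equation, then the central limit theorem. The work lies in the analytic conditions it needs, and one
device supplies them. A point of the hyperboloid is recorded by its spatial part `y`, with time
coordinate `height y = √(1 + ‖y‖²)`. In these terms the log-density is built from polynomials,
`height`, and the function `arcosh t / √(t² - 1)` of `t = -⟨μ, x⟩ ≥ 1`. That function and its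
logarithm extend smoothly across `t = 1` with polynomially bounded derivatives (`ratioFamily`). On
each bounded set of chart coordinates the log-density therefore agrees with a function of temperate
growth in `(ϑ, y)` (`exists_temperate_logDensity`). All its `ϑ`-derivatives are then bounded by `C *
height y ^ N`, and every power of `height` is integrable under a wrapped normal law
(`integrable_height_pow`). Integrability, Lipschitz bounds and Taylor remainders all follow from
this.

The change of variables `hwn_eq_withDensity` makes `exp (logDensity μ S)` a density up to a
constant. Near the true parameter these densities are dominated by an integrable one
(`exists_exp_logDensity_le`). Differentiating their constant total mass twice gives the identities
of `integral_bartlett`: the score is centred, and the mean Hessian is minus the Fisher information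
(`integral_hessian_apply`).

Consistency is Wald's argument (`ae_tendsto_of_identifiable`). The true parameter strictly maximizes
the expected log-density (`integral_logDensity_lt`). The location space is not compact, but
`exists_outer_bound` gives an integrable envelope with arbitrarily small mean for parameters far
away.

Since the true covariance is interior, a consistent maximizer eventually solves the score equation.
Expanding that equation (`tendstoInMeasure_asymptotic_linearity`) gives the linear representation.
The central limit theorem for the score (`tendstoInDistribution_score`) and Slutsky's lemma give the
limit law. -/

theorem iteratedDerivWithin_chain {T : Set ℝ} (hT : IsOpen T) {G : ℕ → ℝ → ℝ} {c : ℕ → ℝ}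
    (hG : ∀ k, ∀ t ∈ T, HasDerivAt (G k) (c k * G (k + 1) t) t) (n : ℕ) :
    ∀ t ∈ T, iteratedDerivWithin n (G 0) T t = (∏ i ∈ Finset.range n, c i) * G n t := by
  induction n with
  | zero => intro t _; simp
  | succ n ih =>
    intro t ht
    rw [iteratedDerivWithin_succ, derivWithin_congr ih (ih t ht),
      derivWithin_of_isOpen hT ht, ((hG n t ht).const_mul _).deriv, Finset.prod_range_succ]
    ring

theorem contDiffOn_chain {T : Set ℝ} (hT : IsOpen T) {G : ℕ → ℝ → ℝ} {c : ℕ → ℝ}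
    (hG : ∀ k, ∀ t ∈ T, HasDerivAt (G k) (c k * G (k + 1) t) t) (n : ℕ) (k : ℕ) :
    ContDiffOn ℝ n (G k) T := by
  induction n generalizing k with
  | zero =>
    exact contDiffOn_zero.2 fun t ht => (hG k t ht).continuousAt.continuousWithinAt
  | succ n ih =>
    push_cast
    rw [contDiffOn_succ_iff_deriv_of_isOpen hT]
    refine ⟨fun t ht => (hG k t ht).differentiableAt.differentiableWithinAt, by simp, ?_⟩
    exact (contDiffOn_const.mul (ih (k + 1))).congr fun t ht => (hG k t ht).deriv

/-- Along the chain every derivative of `G 0` is a constant times some `G n`, so linear bounds on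
the members control all derivatives at once. Working on an open `T` containing the range of `f`
allows outer functions that are singular elsewhere, such as `log`. -/
theorem hasTemperateGrowth_comp_chain {D : Type*} [NormedAddCommGroup D] [NormedSpace ℝ D]
    {T : Set ℝ} (hT : IsOpen T) {G : ℕ → ℝ → ℝ} {c : ℕ → ℝ}
    (hG : ∀ k, ∀ t ∈ T, HasDerivAt (G k) (c k * G (k + 1) t) t)
    {B : ℕ → ℝ} (hB : ∀ k, ∀ t ∈ T, |G k t| ≤ B k * (1 + |t|))
    {f : D → ℝ} (hf : f.HasTemperateGrowth) (hfT : ∀ x, f x ∈ T) :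
    (fun x => G 0 (f x)).HasTemperateGrowth := by
  refine Function.HasTemperateGrowth.comp' (g := G 0) (t := T) ?_ hT.uniqueDiffOn ?_ ?_ hf
  · rintro _ ⟨x, rfl⟩
    exact hfT x
  · exact contDiffOn_infty.2 fun n => contDiffOn_chain hT hG n 0
  · intro N
    -- One constant must serve all orders `n ≤ N`; the sum dominates each of its terms.
    refine ⟨1, ∑ n ∈ Finset.range (N + 1), |∏ i ∈ Finset.range n, c i| * |B n|, by positivity,
      fun n hn x hx => ?_⟩
    rw [norm_iteratedFDerivWithin_eq_norm_iteratedDerivWithin,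
      iteratedDerivWithin_chain hT hG n x hx, norm_mul, pow_one]
    have h1 : |G n x| ≤ |B n| * (1 + |x|) :=
      (hB n x hx).trans (mul_le_mul_of_nonneg_right (le_abs_self _) (by positivity))
    calc ‖∏ i ∈ Finset.range n, c i‖ * ‖G n x‖
        ≤ |∏ i ∈ Finset.range n, c i| * (|B n| * (1 + |x|)) :=
          mul_le_mul_of_nonneg_left h1 (abs_nonneg _)
      _ = (|∏ i ∈ Finset.range n, c i| * |B n|) * (1 + ‖x‖) := by rw [Real.norm_eq_abs]; ring
      _ ≤ _ := by
        refine mul_le_mul_of_nonneg_right ?_ (by positivity)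
        exact Finset.single_le_sum
          (f := fun n => |∏ i ∈ Finset.range n, c i| * |B n|)
          (fun _ _ => by positivity) (Finset.mem_range.2 (by omega))

theorem hasTemperateGrowth_log_comp {D : Type*} [NormedAddCommGroup D] [NormedSpace ℝ D]
    {f : D → ℝ} (hf : f.HasTemperateGrowth) (hf1 : ∀ x, 1 ≤ f x) :
    (fun x => Real.log (f x)).HasTemperateGrowth := by
  -- The half-line starts at `1 / 2` rather than `0` so that `t⁻¹ ≤ 2`. This bounds the negative
  -- powers and keeps `log` of linear growth near the left end.
  have key := hasTemperateGrowth_comp_chain (T := Set.Ioi (1 / 2)) isOpen_Ioi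
    (G := fun k t => if k = 0 then Real.log t else (t ^ k)⁻¹)
    (c := fun k => if k = 0 then 1 else -(k : ℝ))
    (B := fun k => 2 ^ k) ?_ ?_ hf fun x => lt_of_lt_of_le (by norm_num) (hf1 x)
  · simpa using key
  · intro k t ht
    have ht0 : t ≠ 0 := by
      have : (1 / 2 : ℝ) < t := ht
      linarith
    rcases k with _ | k
    · simpa using Real.hasDerivAt_log ht0
    · have h := (hasDerivAt_pow (k + 1) t).inv (pow_ne_zero _ ht0)
      simp only [Nat.add_eq_zero_iff, one_ne_zero, and_false, if_false]
      refine h.congr_deriv ?_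
      rw [Nat.add_sub_cancel]
      push_cast
      field_simp
      ring
  · intro k t ht
    have ht' : (1 / 2 : ℝ) < t := ht
    have ht0 : 0 < t := by linarith
    rw [abs_of_pos ht0]
    rcases k with _ | k
    · simp only [if_true, pow_zero, one_mul]
      rw [abs_le]
      have h1 := Real.log_le_sub_one_of_pos ht0
      have h2 := Real.one_sub_inv_le_log_of_pos ht0
      have h3 : t⁻¹ ≤ 2 := by
        rw [inv_le_comm₀ ht0 two_pos]
        linarith
      constructor <;> linarith
    · simp only [Nat.add_eq_zero_iff, one_ne_zero, and_false, if_false]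
      rw [abs_of_pos (by positivity), ← inv_pow]
      have h3 : t⁻¹ ≤ 2 := by
        rw [inv_le_comm₀ ht0 two_pos]
        linarith
      calc t⁻¹ ^ (k + 1) ≤ 2 ^ (k + 1) := pow_le_pow_left₀ (by positivity) h3 _
        _ ≤ _ := le_mul_of_one_le_right (by positivity) (by linarith)

/-! ### The ratio `arcosh t / √(t² - 1)` -/

/-- The smooth extension of `arcosh t / √(t² - 1)` together with its successive derivatives, up to
constant factors. -/
def ratioFamily (k : ℕ) (t : ℝ) : ℝ :=
  ∫ z in (0 : ℝ)..1, 2 * z ^ k / (1 + 2 * t * z + z ^ 2) ^ (k + 1)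

/-- The function equal to `arcosh t / √(t² - 1)` for `t > 1` and to `1` at `t = 1`. -/
def ratio (t : ℝ) : ℝ := ratioFamily 0 t

theorem ratio_denom_ge_one {t z : ℝ} (ht : 0 ≤ t) (hz : 0 ≤ z) : 1 ≤ 1 + 2 * t * z + z ^ 2 := by
  have := mul_nonneg ht hz
  nlinarith [sq_nonneg z]

theorem continuousOn_ratioIntegrand (k : ℕ) {t : ℝ} (ht : 0 ≤ t) :
    ContinuousOn (fun z : ℝ => 2 * z ^ k / (1 + 2 * t * z + z ^ 2) ^ (k + 1)) (Set.uIcc 0 1) := by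
  refine ContinuousOn.div (by fun_prop) (by fun_prop) fun z hz => ?_
  rw [Set.uIcc_of_le zero_le_one] at hz
  have := ratio_denom_ge_one ht hz.1
  positivity

/-- Differentiation under the integral: each `t`-derivative of the power of the denominator brings
out a factor `-2 (k + 1) z`, which raises the index by one. The denominator is at least `1`, so the
derivative of the integrand is bounded by `4 (k + 1)`. -/
theorem hasDerivAt_ratioFamily (k : ℕ) {t : ℝ} (ht : 0 < t) :
    HasDerivAt (ratioFamily k) (-(2 * (k + 1)) * ratioFamily (k + 1) t) t := by
  have h := (intervalIntegral.hasDerivAt_integral_of_dominated_loc_of_deriv_le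
    (μ := volume) (a := 0) (b := 1) (x₀ := t) (s := Set.Ioi 0)
    (F := fun t z => 2 * z ^ k / (1 + 2 * t * z + z ^ 2) ^ (k + 1))
    (F' := fun t z => -(2 * (k + 1)) * (2 * z ^ (k + 1) / (1 + 2 * t * z + z ^ 2) ^ (k + 1 + 1)))
    (bound := fun _ => 4 * (k + 1)) (Ioi_mem_nhds ht) ?_ ?_ ?_ ?_ ?_ ?_).2
  · refine h.congr_deriv ?_
    rw [intervalIntegral.integral_const_mul, ratioFamily]
  · filter_upwards [Ioi_mem_nhds ht] with s hs
    exact ((continuousOn_ratioIntegrand k (le_of_lt hs)).mono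
      Set.uIoc_subset_uIcc).aestronglyMeasurable measurableSet_uIoc
  · exact (continuousOn_ratioIntegrand k ht.le).intervalIntegrable
  · exact ((continuousOn_const.mul (continuousOn_ratioIntegrand (k + 1) ht.le)).mono
      Set.uIoc_subset_uIcc).aestronglyMeasurable measurableSet_uIoc
  · refine ae_of_all _ fun z hz s hs => ?_
    rw [Set.uIoc_of_le zero_le_one] at hz
    have hd := ratio_denom_ge_one (le_of_lt hs) hz.1.le
    have hz1 : z ^ (k + 1) ≤ 1 := pow_le_one₀ hz.1.le hz.2
    have hz0 : 0 ≤ z ^ (k + 1) := pow_nonneg hz.1.le _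
    have hd1 : 1 ≤ (1 + 2 * s * z + z ^ 2) ^ (k + 1 + 1) := one_le_pow₀ hd
    rw [norm_mul, Real.norm_eq_abs, Real.norm_eq_abs, abs_neg, abs_of_pos (by positivity),
      abs_of_nonneg (by positivity)]
    have : 2 * z ^ (k + 1) / (1 + 2 * s * z + z ^ 2) ^ (k + 1 + 1) ≤ 2 := by
      rw [div_le_iff₀ (by linarith)]
      nlinarith
    calc 2 * ((k : ℝ) + 1) * (2 * z ^ (k + 1) / (1 + 2 * s * z + z ^ 2) ^ (k + 1 + 1))
        ≤ 2 * ((k : ℝ) + 1) * 2 := mul_le_mul_of_nonneg_left this (by positivity)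
      _ = _ := by ring
  · exact intervalIntegrable_const
  · refine ae_of_all _ fun z hz s hs => ?_
    rw [Set.uIoc_of_le zero_le_one] at hz
    have hd := ratio_denom_ge_one (le_of_lt hs) hz.1.le
    have hd0 : 1 + 2 * s * z + z ^ 2 ≠ 0 := by linarith
    have h1 : HasDerivAt (fun s : ℝ => 1 + 2 * s * z + z ^ 2) (2 * z) s := by
      have := (((hasDerivAt_id s).const_mul 2).mul_const z).const_add 1 |>.add_const (z ^ 2)
      simpa using this
    have h2 := ((h1.pow (k + 1)).inv (pow_ne_zero _ hd0)).const_mul (2 * z ^ k)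
    simp only [div_eq_mul_inv]
    refine h2.congr_deriv ?_
    rw [Nat.add_sub_cancel, Pi.pow_apply]
    push_cast
    set D := 1 + 2 * s * z + z ^ 2
    field_simp
    ring

theorem ratioFamily_nonneg (k : ℕ) {t : ℝ} (ht : 0 ≤ t) : 0 ≤ ratioFamily k t := by
  refine intervalIntegral.integral_nonneg zero_le_one fun z hz => ?_
  have hd := ratio_denom_ge_one ht hz.1
  have := pow_nonneg hz.1 k
  positivity

theorem ratioFamily_le (k : ℕ) {t : ℝ} (ht : 0 ≤ t) : ratioFamily k t ≤ 2 := by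
  have h : ratioFamily k t ≤ ∫ _ in (0 : ℝ)..1, (2 : ℝ) := by
    refine intervalIntegral.integral_mono_on zero_le_one
      (continuousOn_ratioIntegrand k ht).intervalIntegrable intervalIntegrable_const
      fun z hz => ?_
    have hd := ratio_denom_ge_one ht hz.1
    have hz1 : z ^ k ≤ 1 := pow_le_one₀ hz.1 hz.2
    have hd1 : 1 ≤ (1 + 2 * t * z + z ^ 2) ^ (k + 1) := one_le_pow₀ hd
    rw [div_le_iff₀ (by linarith)]
    nlinarith
  simpa using h

/-- On `[0, 1]` the denominator is at most `2 (1 + t)`. This polynomial lower bound keeps `log ∘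
ratio` under control as `t` grows. -/
theorem one_le_mul_ratio {t : ℝ} (ht : 0 ≤ t) : 1 ≤ (1 + t) * ratio t := by
  have h : ∫ _ in (0 : ℝ)..1, (1 + t)⁻¹ ≤ ratio t := by
    refine intervalIntegral.integral_mono_on zero_le_one intervalIntegrable_const
      (continuousOn_ratioIntegrand 0 ht).intervalIntegrable fun z hz => ?_
    have hd := ratio_denom_ge_one ht hz.1
    simp only [pow_zero, mul_one, zero_add, pow_one]
    rw [inv_eq_one_div, div_le_div_iff₀ (by linarith) (by linarith)]
    nlinarith [mul_le_mul_of_nonneg_left hz.2 ht, hz.1, hz.2]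
  rw [intervalIntegral.integral_const, smul_eq_mul, sub_zero, one_mul] at h
  have h1 : 0 < 1 + t := by linarith
  calc 1 = (1 + t) * (1 + t)⁻¹ := by field_simp
    _ ≤ _ := mul_le_mul_of_nonneg_left h h1.le

theorem ratio_pos {t : ℝ} (ht : 0 ≤ t) : 0 < ratio t := by
  have h := one_le_mul_ratio ht
  have h1 : 0 < 1 + t := by linarith
  by_contra! h2
  nlinarith

theorem hasTemperateGrowth_ratio_comp {D : Type*} [NormedAddCommGroup D] [NormedSpace ℝ D]
    {f : D → ℝ} (hf : f.HasTemperateGrowth) (hf1 : ∀ x, 1 ≤ f x) :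
    (fun x => ratio (f x)).HasTemperateGrowth := by
  refine hasTemperateGrowth_comp_chain (T := Set.Ioi 0) isOpen_Ioi (G := ratioFamily)
    (B := fun _ => 2) (fun k t ht => hasDerivAt_ratioFamily k ht) ?_ hf
    fun x => lt_of_lt_of_le one_pos (hf1 x)
  intro k t ht
  have ht0 : 0 ≤ t := le_of_lt ht
  rw [abs_of_nonneg (ratioFamily_nonneg k ht0), abs_of_nonneg ht0]
  linarith [ratioFamily_le k ht0]

/-- `ratio` itself is not bounded below by `1`, but `(1 + t) * ratio t` is. Hence the logarithm is a
difference of two logarithms covered by `hasTemperateGrowth_log_comp`. -/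
theorem hasTemperateGrowth_log_ratio_comp {D : Type*} [NormedAddCommGroup D] [NormedSpace ℝ D]
    {f : D → ℝ} (hf : f.HasTemperateGrowth) (hf1 : ∀ x, 1 ≤ f x) :
    (fun x => Real.log (ratio (f x))).HasTemperateGrowth := by
  have h1 : (fun x => 1 + f x).HasTemperateGrowth := by fun_prop
  have h2 := h1.mul (hasTemperateGrowth_ratio_comp hf hf1)
  have h3 := (hasTemperateGrowth_log_comp h2
    fun x => one_le_mul_ratio (zero_le_one.trans (hf1 x))).sub
    (hasTemperateGrowth_log_comp h1 fun x => by linarith [hf1 x])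
  convert h3 using 2 with x
  have h0 := zero_le_one.trans (hf1 x)
  simp only [Pi.sub_apply, Pi.mul_apply]
  rw [Real.log_mul (by linarith) (ratio_pos h0).ne']
  ring

theorem ratio_one : ratio 1 = 1 := by
  have h : ∀ z ∈ Set.uIcc (0 : ℝ) 1, HasDerivAt (fun z : ℝ => -2 * (1 + z)⁻¹)
      (2 * z ^ 0 / (1 + 2 * 1 * z + z ^ 2) ^ (0 + 1)) z := by
    intro z hz
    rw [Set.uIcc_of_le zero_le_one] at hz
    have hz1 : 1 + z ≠ 0 := by linarith [hz.1]
    have hz2 : 1 + 2 * 1 * z + z ^ 2 ≠ 0 := by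
      have : 1 + 2 * 1 * z + z ^ 2 = (1 + z) ^ 2 := by ring
      rw [this]; positivity
    have h2 := (((hasDerivAt_id z).const_add 1).inv hz1).const_mul (-2)
    refine h2.congr_deriv ?_
    have hp : 1 + 2 * 1 * z + z ^ 2 = (1 + z) ^ 2 := by ring
    rw [hp]
    simp only [id]
    field_simp
    ring
  rw [ratio, ratioFamily, intervalIntegral.integral_eq_sub_of_hasDerivAt h
    (continuousOn_ratioIntegrand 0 zero_le_one).intervalIntegrable]
  norm_num

/-- With `w = √(t² - 1)` the denominator factors as `(z + t - w) (z + t + w)`, and partial fractions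
give an antiderivative in logarithms. The relation `(t + w) (t - w) = 1` collapses the boundary
terms to `log (t + w)`. -/
theorem ratio_mul_sqrt {t : ℝ} (ht : 1 ≤ t) : ratio t * √(t ^ 2 - 1) = Real.arcosh t := by
  rcases ht.eq_or_lt with rfl | ht
  · simp
  set w := √(t ^ 2 - 1) with hw
  have hw0 : 0 < w := Real.sqrt_pos.2 (by nlinarith)
  have hw2 : w ^ 2 = t ^ 2 - 1 := Real.sq_sqrt (by nlinarith)
  have hwt : w < t := by nlinarith
  have h : ∀ z ∈ Set.uIcc (0 : ℝ) 1,
      HasDerivAt (fun z : ℝ => w⁻¹ * (Real.log (z + t - w) - Real.log (z + t + w)))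
      (2 * z ^ 0 / (1 + 2 * t * z + z ^ 2) ^ (0 + 1)) z := by
    intro z hz
    rw [Set.uIcc_of_le zero_le_one] at hz
    have hz1 : z + t - w ≠ 0 := by linarith [hz.1]
    have hz2 : z + t + w ≠ 0 := by linarith [hz.1]
    have hp : 1 + 2 * t * z + z ^ 2 = (z + t - w) * (z + t + w) := by linear_combination hw2
    have h1 := (((hasDerivAt_id z).add_const t).sub_const w).log hz1
    have h2 := (((hasDerivAt_id z).add_const t).add_const w).log hz2
    refine ((h1.sub h2).const_mul w⁻¹).congr_deriv ?_
    rw [hp]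
    simp only [id]
    field_simp
    ring
  rw [ratio, ratioFamily, intervalIntegral.integral_eq_sub_of_hasDerivAt h
    (continuousOn_ratioIntegrand 0 (by linarith)).intervalIntegrable, Real.arcosh, ← hw]
  have e1 : 0 < 1 + t - w := by linarith
  have e2 : 0 < 1 + t + w := by linarith
  have e3 : 0 < t - w := by linarith
  have e4 : 0 < t + w := by linarith
  have k1 : Real.log (t + w) = -Real.log (t - w) := by
    rw [← Real.log_inv]
    congr 1
    refine eq_inv_of_mul_eq_one_left ?_
    linear_combination -hw2
  have k2 : Real.log (1 + t + w) = Real.log (t + w) + Real.log (1 + t - w) := by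
    rw [← Real.log_mul e4.ne' e1.ne']
    congr 1
    linear_combination hw2
  simp only [zero_add]
  field_simp
  rw [k2, k1]
  ring

end HypWN

namespace HypWN

open scoped ContDiff

/-! ### Hyperbolic space in spatial coordinates -/

section Spatial

variable {d : ℕ}

/-- `√(1 + ‖y‖²)`, the time coordinate of the point of `ℍ^d` with spatial part `y`. -/
def height (y : EuclideanSpace ℝ (Fin d)) : ℝ := √(1 + ‖y‖ ^ 2)

theorem height_sq (y : EuclideanSpace ℝ (Fin d)) : height y ^ 2 = 1 + ‖y‖ ^ 2 :=
  Real.sq_sqrt (by positivity)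

theorem one_le_height (y : EuclideanSpace ℝ (Fin d)) : 1 ≤ height y := by
  rw [height, Real.one_le_sqrt]
  nlinarith [sq_nonneg ‖y‖]

theorem height_pos (y : EuclideanSpace ℝ (Fin d)) : 0 < height y :=
  lt_of_lt_of_le one_pos (one_le_height y)

theorem norm_le_height (y : EuclideanSpace ℝ (Fin d)) : ‖y‖ ≤ height y := by
  have := height_sq y
  nlinarith [height_pos y, norm_nonneg y]

theorem sum_mul_eq_inner (u y : EuclideanSpace ℝ (Fin d)) :
    ∑ j, u j * y j = inner ℝ u y := by
  simp [PiLp.inner_apply, mul_comm]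

/-- The point of `ℍ^d` with spatial part `y`. -/
def ofSpatial (y : EuclideanSpace ℝ (Fin d)) : Hyp d :=
  ⟨Fin.cons (height y) y.ofLp, by
    simp only [lorentz, Fin.cons_zero, Fin.cons_succ, sum_mul_eq_inner, real_inner_self_eq_norm_sq]
    nlinarith [height_sq y], by simpa using height_pos y⟩

/-- The spatial part of a vector of `ℝ^(d+1)`. -/
def spatialPart (x : Fin (d + 1) → ℝ) : EuclideanSpace ℝ (Fin d) := WithLp.toLp 2 fun j => x j.succ

/-- The spatial part of a point of `ℍ^d`. -/
def spatial (x : Hyp d) : EuclideanSpace ℝ (Fin d) := spatialPart x.1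

theorem lorentz_eq (x y : Fin (d + 1) → ℝ) :
    lorentz x y = -(x 0 * y 0) + inner ℝ (spatialPart x) (spatialPart y) := by
  rw [← sum_mul_eq_inner]; rfl

theorem spatialPart_add (x y : Fin (d + 1) → ℝ) :
    spatialPart (x + y) = spatialPart x + spatialPart y := by
  ext; simp [spatialPart]

theorem spatialPart_smul (c : ℝ) (x : Fin (d + 1) → ℝ) :
    spatialPart (c • x) = c • spatialPart x := by
  ext; simp [spatialPart]

@[simp] theorem spatial_ofSpatial (y : EuclideanSpace ℝ (Fin d)) : spatial (ofSpatial y) = y := by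
  ext; simp [spatial, spatialPart, ofSpatial]

theorem coe_zero_eq_height (x : Hyp d) : x.1 0 = height (spatial x) := by
  have h := x.2.1
  rw [lorentz_eq, real_inner_self_eq_norm_sq] at h
  refine (pow_left_inj₀ x.2.2.le (height_pos _).le two_ne_zero).1 ?_
  rw [height_sq, spatial]
  linarith

theorem ext_time_spatial {x y : Fin (d + 1) → ℝ} (h0 : x 0 = y 0)
    (h : spatialPart x = spatialPart y) : x = y := by
  funext j
  refine Fin.cases h0 (fun j => ?_) j
  exact congrArg (fun v : EuclideanSpace ℝ (Fin d) => v j) h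

theorem spatial_injective : Function.Injective (spatial (d := d)) := by
  intro x y h
  refine Subtype.ext (ext_time_spatial ?_ h)
  rw [coe_zero_eq_height, coe_zero_eq_height, h]

@[simp] theorem ofSpatial_spatial (x : Hyp d) : ofSpatial (spatial x) = x :=
  spatial_injective (spatial_ofSpatial _)

theorem continuous_spatial : Continuous (spatial (d := d)) := by
  refine (PiLp.continuous_toLp 2 _).comp (continuous_pi fun j => ?_)
  exact (continuous_apply j.succ).comp continuous_subtype_val

theorem continuous_height : Continuous (height (d := d)) := by
  unfold height
  fun_prop

theorem continuous_ofSpatial : Continuous (ofSpatial (d := d)) := by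
  refine Continuous.subtype_mk (continuous_pi fun j => ?_) _
  refine Fin.cases ?_ (fun j => ?_) j
  · simpa using continuous_height
  · simp only [Fin.cons_succ]
    fun_prop

/-- Minus the Lorentz product of two points of `ℍ^d`, in spatial coordinates. -/
def coshDist (u y : EuclideanSpace ℝ (Fin d)) : ℝ := height u * height y - inner ℝ u y

theorem neg_lorentz (μ x : Hyp d) : -lorentz μ.1 x.1 = coshDist (spatial μ) (spatial x) := by
  rw [lorentz_eq, coshDist, coe_zero_eq_height, coe_zero_eq_height]
  simp only [spatial]
  ring

theorem one_le_coshDist (u y : EuclideanSpace ℝ (Fin d)) : 1 ≤ coshDist u y := by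
  have h1 := real_inner_le_norm u y
  have h2 : 1 + ‖u‖ * ‖y‖ ≤ height u * height y := by
    refine le_of_sq_le_sq ?_ (mul_pos (height_pos u) (height_pos y)).le
    rw [mul_pow, height_sq, height_sq]
    nlinarith [sq_nonneg (‖u‖ - ‖y‖)]
  rw [coshDist]
  linarith

/-- The spatial part of the Lorentz boost that maps the point with spatial part `u` to the origin,
applied to the point with spatial part `y`. -/
def unboost (u y : EuclideanSpace ℝ (Fin d)) : EuclideanSpace ℝ (Fin d) :=
  y - ((coshDist u y + height y) / (1 + height u)) • u

/-- Boosts preserve the Lorentz form: after moving `u` to the origin, the other point has time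
coordinate `coshDist u y`, which fixes the norm of its spatial part. -/
theorem norm_unboost_sq (u y : EuclideanSpace ℝ (Fin d)) :
    ‖unboost u y‖ ^ 2 = coshDist u y ^ 2 - 1 := by
  have hu := height_sq u
  have hy := height_sq y
  have hu1 : 1 + height u ≠ 0 := by linarith [height_pos u]
  rw [unboost, norm_sub_sq_real, inner_smul_right, norm_smul, mul_pow, Real.norm_eq_abs, sq_abs,
    real_inner_comm]
  have hi : inner ℝ u y = height u * height y - coshDist u y := by rw [coshDist]; ring
  have h1 : ‖u‖ ^ 2 = height u ^ 2 - 1 := by linarith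
  have h2 : ‖y‖ ^ 2 = height y ^ 2 - 1 := by linarith
  rw [hi, h1, h2]
  field_simp
  ring

end Spatial

/-! ### Exponential map, logarithm and transport in spatial coordinates. -/

section Geometry

variable {d : ℕ}

/-- The Lorentz form is indefinite on the ambient space but definite on tangent spaces:
`tangent_bounds` forces the time component to vanish with the form, and what remains is Euclidean.
-/
theorem eq_zero_of_tnorm_eq_zero {μ : Hyp d} {v : tangentSpace μ} (hv : tnorm v = 0) : v = 0 := by
  obtain ⟨h0, h1⟩ := tangent_bounds v
  have h2 : lorentz v.1 v.1 = 0 := (Real.sqrt_eq_zero h0).1 hv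
  rw [h2, mul_zero] at h1
  have h3 : v.1 0 = 0 := by nlinarith [sq_nonneg (v.1 0)]
  have h4 : spatialPart v.1 = 0 := by
    rw [lorentz_eq, h3, real_inner_self_eq_norm_sq] at h2
    have h5 : ‖spatialPart v.1‖ ^ 2 = 0 := by linarith
    simpa using h5
  refine Subtype.ext (ext_time_spatial (by simpa using h3) ?_)
  rw [h4]
  ext
  simp [spatialPart]

theorem tnorm_smul {μ : Hyp d} (c : ℝ) (v : tangentSpace μ) : tnorm (c • v) = |c| * tnorm v := by
  rw [tnorm, Submodule.coe_smul, lorentz_smul_left, lorentz_smul_right, ← mul_assoc,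
    Real.sqrt_mul (mul_self_nonneg c), Real.sqrt_mul_self_eq_abs, tnorm]

theorem tnorm_nonneg {μ : Hyp d} (v : tangentSpace μ) : 0 ≤ tnorm v := Real.sqrt_nonneg _

theorem neg_lorentz_expMap (μ : Hyp d) (v : tangentSpace μ) :
    -lorentz μ.1 (expMap μ v).1 = Real.cosh (tnorm v) := by
  have hv : lorentz μ.1 v.1 = 0 := v.2
  simp only [expMap, lorentz_add_right, lorentz_smul_right, hv, μ.2.1]
  ring

theorem logMap_expMap (μ : Hyp d) (v : tangentSpace μ) : logMap μ (expMap μ v) = v := by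
  have h := neg_lorentz_expMap μ v
  have h' : lorentz μ.1 (expMap μ v).1 = -Real.cosh (tnorm v) := by linarith
  have hd : hdist μ (expMap μ v) = tnorm v := by
    rw [hdist, h, Real.arcosh_cosh (tnorm_nonneg v)]
  have hs : √(Real.cosh (tnorm v) ^ 2 - 1) = Real.sinh (tnorm v) := by
    rw [Real.cosh_sq, add_sub_cancel_right,
      Real.sqrt_sq (Real.sinh_nonneg_iff.2 (tnorm_nonneg v))]
  refine Subtype.ext ?_
  rcases eq_or_ne (tnorm v) 0 with h0 | h0
  · rw [eq_zero_of_tnorm_eq_zero h0] at hd ⊢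
    have : tnorm (0 : tangentSpace μ) = 0 := by simpa using tnorm_smul 0 (0 : tangentSpace μ)
    simp [logMap, hd, this]
  · have h1 : Real.sinh (tnorm v) ≠ 0 := by simpa using h0
    simp only [logMap]
    rw [hd, h, hs, h']
    simp only [expMap]
    rw [neg_smul, add_comm (Real.cosh (tnorm v) • μ.1), add_neg_cancel_right, smul_smul]
    field_simp
    rw [one_smul]

theorem one_le_neg_lorentz (μ x : Hyp d) : 1 ≤ -lorentz μ.1 x.1 := by
  rw [neg_lorentz]; exact one_le_coshDist _ _

/-- The component of `x` orthogonal to `μ`. -/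
def normalPart (μ x : Hyp d) : tangentSpace μ :=
  ⟨x.1 + lorentz μ.1 x.1 • μ.1, by
    change lorentz μ.1 _ = 0
    rw [lorentz_add_right, lorentz_smul_right, μ.2.1]
    ring⟩

theorem tnorm_normalPart (μ x : Hyp d) :
    tnorm (normalPart μ x) = √((-lorentz μ.1 x.1) ^ 2 - 1) := by
  rw [tnorm]
  congr 1
  simp only [normalPart, lorentz_add_left, lorentz_add_right, lorentz_smul_left,
    lorentz_smul_right, x.2.1, μ.2.1, lorentz_comm x.1 μ.1]
  ring

/-- This removes the apparent singularity of `logMap` at `x = μ`: the quotient becomes the smooth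
function `ratio`, and at `x = μ` the orthogonal component vanishes, so the scalar factor is
immaterial there. -/
theorem logMap_eq (μ x : Hyp d) :
    logMap μ x = ratio (-lorentz μ.1 x.1) • normalPart μ x := by
  have ht := one_le_neg_lorentz μ x
  have hr := ratio_mul_sqrt ht
  have hn := tnorm_normalPart μ x
  refine Subtype.ext ?_
  change (hdist μ x / √((-lorentz μ.1 x.1) ^ 2 - 1)) • (normalPart μ x).1 =
    ratio (-lorentz μ.1 x.1) • (normalPart μ x).1
  rcases eq_or_ne (√((-lorentz μ.1 x.1) ^ 2 - 1)) 0 with h0 | h0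
  · rw [h0] at hn
    rw [eq_zero_of_tnorm_eq_zero hn]
    simp
  · rw [hdist, ← hr, mul_div_cancel_right₀ _ h0]

theorem tnorm_logMap (μ x : Hyp d) : tnorm (logMap μ x) = hdist μ x := by
  have ht := one_le_neg_lorentz μ x
  rw [logMap_eq, tnorm_smul, tnorm_normalPart, abs_of_pos (ratio_pos (by linarith)),
    ratio_mul_sqrt ht, hdist]

theorem expMap_logMap (μ x : Hyp d) : expMap μ (logMap μ x) = x := by
  have ht := one_le_neg_lorentz μ x
  refine Subtype.ext ?_
  simp only [expMap]
  rw [tnorm_logMap, hdist, Real.cosh_arcosh ht, Real.sinh_arcosh ht, ← tnorm_normalPart,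
    ← ratio_mul_sqrt ht, ← tnorm_normalPart, logMap_eq]
  rcases eq_or_ne (tnorm (normalPart μ x)) 0 with h0 | h0
  · have hz := congrArg Subtype.val (eq_zero_of_tnorm_eq_zero h0)
    rw [h0]
    simp only [normalPart, Submodule.coe_zero] at hz
    simp only [zero_div, zero_smul, add_zero]
    rw [neg_smul]
    exact (eq_neg_of_add_eq_zero_left hz).symm
  · have hr := (ratio_pos (t := -lorentz μ.1 x.1) (by linarith)).ne'
    rw [Submodule.coe_smul, smul_smul]
    have : tnorm (normalPart μ x) / (ratio (-lorentz μ.1 x.1) * tnorm (normalPart μ x)) *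
        ratio (-lorentz μ.1 x.1) = 1 := by field_simp
    rw [this, one_smul, normalPart]
    simp only
    module

theorem coord_wrap (μ : Hyp d) (z : EuclideanSpace ℝ (Fin d)) : coord μ (wrap μ z) = z := by
  simp [coord, wrap, logMap_expMap]

theorem wrap_coord (μ x : Hyp d) : wrap μ (coord μ x) = x := by
  simp [coord, wrap, expMap_logMap]

/-- Transporting the orthogonal component back to the origin leaves a purely spatial vector, the one
produced by the inverse boost. All dependence on `μ` and `x` is now through smooth functions of
their spatial parts. -/
theorem coord_eq (μ x : Hyp d) : coord μ x =
    ratio (coshDist (spatial μ) (spatial x)) • unboost (spatial μ) (spatial x) := by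
  rw [coord, logMap_eq, map_smul, map_smul, neg_lorentz]
  congr 1
  have h1 := neg_lorentz μ x
  have hh : (1 : ℝ) + height (spatial μ) ≠ 0 := by linarith [height_pos (spatial μ)]
  have hl : lorentz μ.1 (origin d).1 = -height (spatial μ) := by
    rw [← coe_zero_eq_height]
    simp [lorentz, origin]
  have hl2 : lorentz (origin d).1 (normalPart μ x).1 = -((normalPart μ x).1 0) := by
    simp [lorentz, origin]
  have ho : spatialPart (origin d).1 = 0 := by ext; simp [spatialPart, origin]
  -- The inverse of `transport (origin d) μ` is by construction transport from `μ` to the origin,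
  -- and the inverse of `originEquiv` forgets the time coordinate.
  change spatialPart (transportFun μ (origin d) (normalPart μ x)).1 = _
  simp only [transportFun, hl, hl2]
  have hn : (normalPart μ x).1 0 = height (spatial x) -
      coshDist (spatial μ) (spatial x) * height (spatial μ) := by
    rw [← h1, ← coe_zero_eq_height, ← coe_zero_eq_height]
    simp [normalPart]
  have hn2 : spatialPart (normalPart μ x).1 = spatial x -
      coshDist (spatial μ) (spatial x) • spatial μ := by
    rw [← h1]
    simp only [normalPart, spatialPart_add, spatialPart_smul, spatial]
    module
  rw [spatialPart_add, spatialPart_smul, spatialPart_add, ho, hn, hn2, unboost, add_zero,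
    sub_neg_eq_add, show spatialPart μ.1 = spatial μ from rfl]
  match_scalars
  · ring
  · field_simp
    ring

theorem norm_coord (μ x : Hyp d) : ‖coord μ x‖ = hdist μ x := by
  have ht := one_le_neg_lorentz μ x
  have hs : ‖unboost (spatial μ) (spatial x)‖ = √((-lorentz μ.1 x.1) ^ 2 - 1) := by
    rw [neg_lorentz, ← norm_unboost_sq, Real.sqrt_sq (norm_nonneg _)]
  rw [coord_eq, norm_smul, hs, ← neg_lorentz, Real.norm_eq_abs,
    abs_of_pos (ratio_pos (by linarith)), ratio_mul_sqrt ht, hdist]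

/-- The norm of the coordinate is `arcosh t`, and `sinh (arcosh t) = √(t² - 1)`; so `sinh r / r` is
the reciprocal of `ratio t`. -/
theorem phi_coord (μ x : Hyp d) :
    phi (coord μ x) = -Real.log (ratio (coshDist (spatial μ) (spatial x))) := by
  have ht := one_le_neg_lorentz μ x
  rw [← neg_lorentz]
  rw [phi]
  split_ifs with h
  · have h1 := norm_coord μ x
    rw [h, norm_zero, hdist, eq_comm, Real.arcosh_eq_zero_iff ht] at h1
    simp [h1, ratio_one]
  · have h1 : ‖coord μ x‖ ≠ 0 := by simpa using h
    rw [norm_coord, hdist] at h1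
    rw [norm_coord, hdist, Real.sinh_arcosh ht, ← Real.log_inv]
    congr 1
    rw [← ratio_mul_sqrt ht] at h1 ⊢
    rw [inv_eq_one_div, div_mul_cancel_right₀ (right_ne_zero_of_mul h1), one_div]

/-- The Lorentz boost that maps the origin to the point with spatial part `u`, in spatial
coordinates. -/
def boost (u y : EuclideanSpace ℝ (Fin d)) : EuclideanSpace ℝ (Fin d) :=
  y + (height y + inner ℝ u y / (1 + height u)) • u

/-- The spatial part of `Exp_o(z)`. -/
def sinhMap (z : EuclideanSpace ℝ (Fin d)) : EuclideanSpace ℝ (Fin d) :=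
  (Real.sinh ‖z‖ / ‖z‖) • z

theorem norm_sinhMap (z : EuclideanSpace ℝ (Fin d)) : ‖sinhMap z‖ = Real.sinh ‖z‖ := by
  have h := Real.sinh_nonneg_iff.2 (norm_nonneg z)
  rw [sinhMap, norm_smul, Real.norm_eq_abs, abs_of_nonneg (by positivity)]
  rcases eq_or_ne ‖z‖ 0 with h0 | h0
  · simp [h0]
  · field_simp

theorem height_sinhMap (z : EuclideanSpace ℝ (Fin d)) : height (sinhMap z) = Real.cosh ‖z‖ := by
  rw [height, norm_sinhMap, add_comm, ← Real.cosh_sq, Real.sqrt_sq (Real.cosh_pos _).le]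

theorem height_boost (u y : EuclideanSpace ℝ (Fin d)) :
    height (boost u y) = height u * height y + inner ℝ u y := by
  have hi : |inner ℝ u y| ≤ ‖u‖ * ‖y‖ := abs_real_inner_le_norm u y
  have hu := norm_le_height u
  have hy := norm_le_height y
  have hpos : 0 ≤ height u * height y + inner ℝ u y := by
    have := (abs_le.1 hi).1
    nlinarith [mul_le_mul hu hy (norm_nonneg y) (height_pos u).le]
  refine (pow_left_inj₀ (height_pos _).le hpos two_ne_zero).1 ?_
  have h1 : ‖u‖ ^ 2 = height u ^ 2 - 1 := by linarith [height_sq u]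
  have h2 : ‖y‖ ^ 2 = height y ^ 2 - 1 := by linarith [height_sq y]
  have hh : (1 : ℝ) + height u ≠ 0 := by linarith [height_pos u]
  rw [height_sq, boost, norm_add_sq_real, inner_smul_right, norm_smul, mul_pow, Real.norm_eq_abs,
    sq_abs, real_inner_comm, h1, h2]
  field_simp
  ring

/-- On the tangent space at the origin, parallel transport to `μ` coincides with the Lorentz boost.
The wrapping map is therefore the exponential map at the origin followed by a boost, and its
Jacobian splits accordingly. -/
theorem spatial_wrap (μ : Hyp d) (z : EuclideanSpace ℝ (Fin d)) :
    spatial (wrap μ z) = boost (spatial μ) (sinhMap z) := by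
  have hh : (1 : ℝ) + height (spatial μ) ≠ 0 := by linarith [height_pos (spatial μ)]
  have hl : lorentz (origin d).1 μ.1 = -height (spatial μ) := by
    rw [← coe_zero_eq_height]
    simp [lorentz, origin]
  have ho : spatialPart (origin d).1 = 0 := by ext; simp [spatialPart, origin]
  have hz : spatialPart (originEquiv d z).1 = z := by ext; simp [spatialPart, originEquiv]
  have hz0 : (originEquiv d z).1 0 = 0 := by simp [originEquiv]
  have hlz : lorentz μ.1 (originEquiv d z).1 = inner ℝ (spatial μ) z := by
    rw [lorentz_eq, hz, hz0, spatial]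
    ring
  set v := transport (origin d) μ (originEquiv d z) with hv
  have hv1 : v.1 = (originEquiv d z).1 +
      (inner ℝ (spatial μ) z / (1 + height (spatial μ))) • ((origin d).1 + μ.1) := by
    rw [hv, ← hlz, ← sub_neg_eq_add 1 (height _), ← hl]
    rfl
  have hvs : spatialPart v.1 =
      z + (inner ℝ (spatial μ) z / (1 + height (spatial μ))) • spatial μ := by
    rw [hv1, spatialPart_add, hz, spatialPart_smul, spatialPart_add, ho, zero_add, spatial]
  have hv0 : v.1 0 = inner ℝ (spatial μ) z := by
    rw [hv1]
    simp only [Pi.add_apply, hz0, Pi.smul_apply, smul_eq_mul, coe_zero_eq_height μ]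
    simp only [origin, Fin.cons_zero]
    field_simp
    ring
  have hn : tnorm v = ‖z‖ := by
    have h1 : ‖spatial μ‖ ^ 2 = height (spatial μ) ^ 2 - 1 := by linarith [height_sq (spatial μ)]
    rw [tnorm, lorentz_eq, hvs, hv0, real_inner_self_eq_norm_sq, norm_add_sq_real,
      inner_smul_right, norm_smul, mul_pow, Real.norm_eq_abs, sq_abs, h1,
      real_inner_comm z (spatial μ)]
    rw [← Real.sqrt_sq (norm_nonneg z)]
    congr 1
    rw [Real.sqrt_sq (norm_nonneg z), real_inner_comm]
    field_simp
    ring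
  change spatialPart (Real.cosh (tnorm v) • μ.1 + (Real.sinh (tnorm v) / tnorm v) • v.1) = _
  rw [spatialPart_add, spatialPart_smul, spatialPart_smul, hvs, hn, boost, height_sinhMap, sinhMap,
    inner_smul_right, show spatialPart μ.1 = spatial μ from rfl]
  module

theorem logDensity_eq (μ : Hyp d) (S : SPD d) (x : Hyp d) :
    logDensity μ S x = -(1 / 2) * Real.log S.1.det
      - (1 / 2) * ((coord μ x).ofLp ⬝ᵥ (S.1⁻¹ *ᵥ (coord μ x).ofLp))
      + ((d : ℝ) - 1) * Real.log (ratio (coshDist (spatial μ) (spatial x))) := by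
  rw [logDensity, phi_coord]
  ring

end Geometry

end HypWN

namespace HypWN

open scoped ContDiff Nat

/-! ### Smoothness of the exponential map -/

/-- The power series of `sinh √u / √u`. -/
def sinhcSq (u : ℝ) : ℝ := (FormalMultilinearSeries.ofScalars ℝ fun n => ((2 * n + 1)! : ℝ)⁻¹).sum u

/-- The ratio test gives infinite radius of convergence. Taking the squared norm as argument makes
`sinh ‖z‖ / ‖z‖` smooth at `z = 0`, where the norm itself is not. -/
theorem contDiff_sinhcSq {n : ℕ∞} : ContDiff ℝ n sinhcSq := by
  have hr : (FormalMultilinearSeries.ofScalars ℝ fun n => ((2 * n + 1)! : ℝ)⁻¹).radius = ⊤ := by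
    refine FormalMultilinearSeries.ofScalars_radius_eq_top_of_tendsto ℝ _
      (Eventually.of_forall fun n => by positivity) ?_
    have hle : ∀ n : ℕ,
        ‖((2 * n.succ + 1)! : ℝ)⁻¹‖ / ‖((2 * n + 1)! : ℝ)⁻¹‖ ≤ 1 / ((n : ℝ) + 1) := by
      intro n
      rw [show 2 * n.succ + 1 = 2 * n + 1 + 1 + 1 by omega, Nat.factorial_succ (2 * n + 1 + 1),
        Nat.factorial_succ (2 * n + 1), norm_inv, norm_inv, RCLike.norm_natCast,
        RCLike.norm_natCast]
      have : (0 : ℝ) < (2 * n + 1)! := by positivity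
      push_cast
      rw [div_inv_eq_mul, ← div_eq_inv_mul, div_le_div_iff₀ (by positivity) (by positivity)]
      nlinarith [mul_nonneg (Nat.cast_nonneg (α := ℝ) n) this.le,
        mul_nonneg (mul_nonneg (Nat.cast_nonneg (α := ℝ) n) (Nat.cast_nonneg (α := ℝ) n)) this.le]
    exact squeeze_zero (fun n => by positivity) hle tendsto_one_div_add_atTop_nhds_zero_nat
  have h := FormalMultilinearSeries.hasFPowerSeriesOnBall
    (FormalMultilinearSeries.ofScalars ℝ fun n => ((2 * n + 1)! : ℝ)⁻¹) (by rw [hr]; simp)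
  have ha := h.analyticOnNhd
  rw [hr, Metric.eball_top] at ha
  exact (contDiffOn_univ.1 (ha.contDiffOn uniqueDiffOn_univ))

theorem mul_sinhcSq (r : ℝ) : r * sinhcSq (r ^ 2) = Real.sinh r := by
  have h : sinhcSq (r ^ 2) = ∑' n : ℕ, ((2 * n + 1)! : ℝ)⁻¹ * (r ^ 2) ^ n := by
    simp only [sinhcSq, FormalMultilinearSeries.sum,
      FormalMultilinearSeries.ofScalars_apply_eq, smul_eq_mul]
  rw [h, ← tsum_mul_left, ← (Real.hasSum_sinh r).tsum_eq]
  refine tsum_congr fun n => ?_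
  rw [← pow_mul, pow_succ]
  field_simp

/-- Obtained by differentiating `r * sinhcSq (r ^ 2) = sinh r`; it identifies the radial eigenvalue
of the derivative of `sinhMap`. -/
theorem sinhcSq_add_deriv {r : ℝ} :
    sinhcSq (r ^ 2) + r * (deriv sinhcSq (r ^ 2) * (2 * r)) = Real.cosh r := by
  have hd : HasDerivAt sinhcSq (deriv sinhcSq (r ^ 2)) (r ^ 2) :=
    ((contDiff_sinhcSq (n := 1)).differentiable (by simp) _).hasDerivAt
  have h2 : HasDerivAt (fun r : ℝ => r ^ 2) (2 * r) r := by simpa using hasDerivAt_pow 2 r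
  have h := (hasDerivAt_id r).mul (HasDerivAt.comp (h := fun r : ℝ => r ^ 2) r hd h2)
  have h' : HasDerivAt Real.sinh
      (1 * sinhcSq (r ^ 2) + r * (deriv sinhcSq (r ^ 2) * (2 * r))) r := by
    refine h.congr_of_eventuallyEq (Eventually.of_forall fun s => ?_)
    exact (mul_sinhcSq s).symm
  have := h'.unique (Real.hasDerivAt_sinh r)
  linarith

variable {d : ℕ}

theorem sinhMap_eq (z : EuclideanSpace ℝ (Fin d)) : sinhMap z = sinhcSq (‖z‖ ^ 2) • z := by
  rcases eq_or_ne z 0 with rfl | hz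
  · simp [sinhMap]
  · have : ‖z‖ ≠ 0 := by simpa using hz
    rw [sinhMap, ← mul_sinhcSq, mul_div_cancel_left₀ _ this]

theorem contDiff_sinhMap {n : ℕ∞} : ContDiff ℝ n (sinhMap (d := d)) := by
  have : sinhMap (d := d) = fun z => sinhcSq (‖z‖ ^ 2) • z := funext sinhMap_eq
  rw [this]
  exact (contDiff_sinhcSq.comp (contDiff_norm_sq ℝ)).smul contDiff_id

theorem contDiff_height {n : ℕ∞} : ContDiff ℝ n (height (d := d)) := by
  unfold height
  exact (contDiff_const.add (contDiff_norm_sq ℝ)).sqrt fun y => by positivity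

/-- The matrix determinant lemma for rank-one updates, read in a basis. The derivatives of `sinhMap`
(after extracting a scalar) and of boosts have this form. -/
theorem det_id_add_smulRight {V : Type*} [NormedAddCommGroup V] [NormedSpace ℝ V]
    [FiniteDimensional ℝ V] (f : V →L[ℝ] ℝ) (v : V) :
    (ContinuousLinearMap.id ℝ V + f.smulRight v).det = 1 + f v := by
  let b := Module.finBasis ℝ V
  have h : LinearMap.toMatrix b b (ContinuousLinearMap.id ℝ V + f.smulRight v : V →L[ℝ] V) =
      1 + Matrix.replicateCol Unit (b.repr v) * Matrix.replicateRow Unit fun j => f (b j) := by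
    ext i j
    simp [LinearMap.toMatrix_apply, Matrix.one_apply, Matrix.mul_apply, Finsupp.single_apply,
      mul_comm, eq_comm]
  have hf : f v = ∑ j, f (b j) * b.repr v j := by
    conv_lhs => rw [← b.sum_repr v, map_sum]
    refine Finset.sum_congr rfl fun j _ => ?_
    rw [map_smul, smul_eq_mul, mul_comm]
  rw [ContinuousLinearMap.det, ← LinearMap.det_toMatrix b, h,
    Matrix.det_one_add_replicateCol_mul_replicateRow, hf]
  rfl

/-! ### Jacobians and the change of variables to geodesic coordinates. -/

/-- The derivative of `sinhMap`. -/
def sinhMapDeriv (z : EuclideanSpace ℝ (Fin d)) :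
    EuclideanSpace ℝ (Fin d) →L[ℝ] EuclideanSpace ℝ (Fin d) :=
  sinhcSq (‖z‖ ^ 2) • ContinuousLinearMap.id ℝ _ +
    (deriv sinhcSq (‖z‖ ^ 2) • (2 • innerSL ℝ z)).smulRight z

theorem hasFDerivAt_sinhMap (z : EuclideanSpace ℝ (Fin d)) :
    HasFDerivAt sinhMap (sinhMapDeriv z) z := by
  have : sinhMap (d := d) = fun z => sinhcSq (‖z‖ ^ 2) • z := funext sinhMap_eq
  rw [this]
  have hd : HasDerivAt sinhcSq (deriv sinhcSq (‖z‖ ^ 2)) (‖z‖ ^ 2) :=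
    ((contDiff_sinhcSq (n := 1)).differentiable (by simp) _).hasDerivAt
  have h1 : HasFDerivAt (fun z : EuclideanSpace ℝ (Fin d) => ‖z‖ ^ 2) (2 • innerSL ℝ z) z :=
    (hasStrictFDerivAt_norm_sq z).hasFDerivAt
  exact (hd.comp_hasFDerivAt z h1).smul (hasFDerivAt_id z)

/-- The derivative is a scalar plus a rank-one map in the radial direction: `d - 1` tangential
eigenvalues `sinh r / r` and one radial eigenvalue `cosh r`. -/
theorem det_sinhMapDeriv (hd : 1 ≤ d) {z : EuclideanSpace ℝ (Fin d)} (hz : z ≠ 0) :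
    (sinhMapDeriv z).det = (Real.sinh ‖z‖ / ‖z‖) ^ (d - 1) * Real.cosh ‖z‖ := by
  have hz0 : 0 < ‖z‖ := norm_pos_iff.2 hz
  have hk : sinhcSq (‖z‖ ^ 2) = Real.sinh ‖z‖ / ‖z‖ := by
    rw [← mul_sinhcSq, mul_div_cancel_left₀ _ hz0.ne']
  have hk0 : sinhcSq (‖z‖ ^ 2) ≠ 0 := by
    rw [hk]
    have := Real.sinh_pos_iff.2 hz0
    positivity
  have h : sinhMapDeriv z = sinhcSq (‖z‖ ^ 2) • (ContinuousLinearMap.id ℝ _ +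
      ((sinhcSq (‖z‖ ^ 2))⁻¹ • deriv sinhcSq (‖z‖ ^ 2) • (2 • innerSL ℝ z)).smulRight z) := by
    ext1 w
    simp only [sinhMapDeriv, _root_.add_apply, _root_.smul_apply,
      ContinuousLinearMap.smulRight_apply, smul_add, smul_smul, smul_eq_mul]
    congr 2
    field_simp
  have hdet : ∀ (c : ℝ) (f : EuclideanSpace ℝ (Fin d) →L[ℝ] EuclideanSpace ℝ (Fin d)),
      (c • f).det = c ^ d * f.det := by
    intro c f
    rw [ContinuousLinearMap.det, ContinuousLinearMap.toLinearMap_smul, LinearMap.det_smul]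
    simp
  rw [h, hdet, det_id_add_smulRight, ← sinhcSq_add_deriv, ← hk]
  obtain ⟨k, rfl⟩ : ∃ k, d = k + 1 := ⟨d - 1, by omega⟩
  simp only [Nat.add_sub_cancel, _root_.smul_apply, smul_eq_mul, nsmul_eq_mul,
    innerSL_apply_apply, real_inner_self_eq_norm_sq]
  push_cast
  field_simp
  ring

/-- The derivative of a boost. -/
def boostDeriv (u y : EuclideanSpace ℝ (Fin d)) :
    EuclideanSpace ℝ (Fin d) →L[ℝ] EuclideanSpace ℝ (Fin d) :=
  ContinuousLinearMap.id ℝ _ +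
    ((height y)⁻¹ • innerSL ℝ y + (1 + height u)⁻¹ • innerSL ℝ u).smulRight u

theorem hasFDerivAt_height (y : EuclideanSpace ℝ (Fin d)) :
    HasFDerivAt height ((height y)⁻¹ • innerSL ℝ y) y := by
  have h1 : HasFDerivAt (fun z : EuclideanSpace ℝ (Fin d) => 1 + ‖z‖ ^ 2) (2 • innerSL ℝ y) y :=
    (hasStrictFDerivAt_norm_sq y).hasFDerivAt.const_add 1
  refine (h1.sqrt (by positivity)).congr_fderiv ?_
  ext1 w
  have := height_pos y
  simp only [_root_.smul_apply, smul_eq_mul, nsmul_eq_mul, height]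
  push_cast
  field_simp

theorem hasFDerivAt_boost (u y : EuclideanSpace ℝ (Fin d)) :
    HasFDerivAt (boost u) (boostDeriv u y) y := by
  have h2 : HasFDerivAt (fun y => inner ℝ u y / (1 + height u))
      ((1 + height u)⁻¹ • innerSL ℝ u) y := by
    simp only [div_eq_inv_mul]
    exact (innerSL ℝ u).hasFDerivAt.const_mul _
  exact (hasFDerivAt_id y).add (((hasFDerivAt_height y).add h2).smul_const u)

/-- Equivalently, boosts preserve the measure `dy / height y`, the hyperbolic volume in spatial
coordinates. -/
theorem det_boostDeriv (u y : EuclideanSpace ℝ (Fin d)) :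
    (boostDeriv u y).det = height (boost u y) / height y := by
  have hy := (height_pos y).ne'
  have hu : 1 + height u ≠ 0 := by linarith [height_pos u]
  have hu2 : ‖u‖ ^ 2 = height u ^ 2 - 1 := by linarith [height_sq u]
  rw [boostDeriv, det_id_add_smulRight, height_boost]
  simp only [_root_.add_apply, _root_.smul_apply, smul_eq_mul,
    innerSL_apply_apply, real_inner_self_eq_norm_sq, hu2, real_inner_comm u y]
  field_simp
  ring

/-- The factor `cosh ‖z‖` from the exponential map cancels the denominator of the boost Jacobian,
since `height (sinhMap z) = cosh ‖z‖`. -/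
theorem lintegral_spatial_wrap (hd : 1 ≤ d) (μ : Hyp d) (h : EuclideanSpace ℝ (Fin d) → ENNReal) :
    ∫⁻ y, h y = ∫⁻ z,
      ENNReal.ofReal (height (spatial (wrap μ z)) * (Real.sinh ‖z‖ / ‖z‖) ^ (d - 1)) *
      h (spatial (wrap μ z)) := by
  have hinj : Function.Injective fun z => spatial (wrap μ z) :=
    spatial_injective.comp (Function.LeftInverse.injective (coord_wrap μ))
  have hsurj : Set.range (fun z => spatial (wrap μ z)) = Set.univ := by
    refine Set.range_eq_univ.2 fun y => ⟨coord μ (ofSpatial y), ?_⟩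
    simp [wrap_coord]
  have hderiv : ∀ z, HasFDerivAt (fun z => spatial (wrap μ z))
      ((boostDeriv (spatial μ) (sinhMap z)).comp (sinhMapDeriv z)) z := by
    intro z
    simp only [spatial_wrap]
    exact (hasFDerivAt_boost _ _).comp z (hasFDerivAt_sinhMap z)
  have key := lintegral_image_eq_lintegral_abs_det_fderiv_mul volume MeasurableSet.univ
    (fun z _ => (hderiv z).hasFDerivWithinAt) hinj.injOn h
  rw [Set.image_univ, hsurj, Measure.restrict_univ] at key
  rw [key]
  refine lintegral_congr_ae ?_
  -- At `z = 0` the quotient `sinh ‖z‖ / ‖z‖` takes the default value `0`; in positive dimension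
  -- that point is null.
  have : Nonempty (Fin d) := ⟨⟨0, hd⟩⟩
  filter_upwards [Measure.ae_ne volume (0 : EuclideanSpace ℝ (Fin d))] with z hz
  congr 2
  have hdet : ((boostDeriv (spatial μ) (sinhMap z)).comp (sinhMapDeriv z)).det =
      (boostDeriv (spatial μ) (sinhMap z)).det * (sinhMapDeriv z).det :=
    LinearMap.det_comp _ _
  rw [hdet, det_boostDeriv, det_sinhMapDeriv hd hz, height_sinhMap, spatial_wrap]
  have hc := Real.cosh_pos ‖z‖
  have hs := Real.sinh_nonneg_iff.2 (norm_nonneg z)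
  have hh := height_pos (boost (spatial μ) (sinhMap z))
  rw [abs_of_nonneg (by positivity)]
  field_simp

end HypWN

namespace HypWN

open scoped ContDiff Nat

/-! ### Gaussian densities -/

section Gaussian

variable {d : ℕ}

/-- The normalizing constant of the standard Gaussian density on `ℝ^d`. -/
def gaussConst (d : ℕ) : ℝ := ((2 * Real.pi) ^ ((d : ℝ) / 2))⁻¹

theorem gaussConst_pos (d : ℕ) : 0 < gaussConst d := by
  have := Real.pi_pos
  unfold gaussConst
  positivity

theorem integral_exp_neg_norm_sq_half :
    ∫ z : EuclideanSpace ℝ (Fin d), Real.exp (-(1 / 2) * ‖z‖ ^ 2) = (gaussConst d)⁻¹ := by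
  rw [GaussianFourier.integral_rexp_neg_mul_sq_norm (by norm_num), gaussConst, inv_inv]
  simp [mul_comm]

theorem stdGaussian_eq_withDensity :
    stdGaussian (EuclideanSpace ℝ (Fin d)) = volume.withDensity fun z =>
      ENNReal.ofReal (gaussConst d * Real.exp (-(1 / 2) * ‖z‖ ^ 2)) := by
  have hc := gaussConst_pos d
  have hint : Integrable fun z : EuclideanSpace ℝ (Fin d) => Real.exp (-(1 / 2) * ‖z‖ ^ 2) := by
    -- The integral of a non-integrable function is `0` by convention, whereas the closed form is
    -- positive.
    refine not_not.1 fun h => ?_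
    have h1 := integral_exp_neg_norm_sq_half (d := d)
    rw [integral_undef h] at h1
    exact (inv_pos.2 hc).ne h1
  have : IsFiniteMeasure ((volume : Measure (EuclideanSpace ℝ (Fin d))).withDensity fun z =>
      ENNReal.ofReal (gaussConst d * Real.exp (-(1 / 2) * ‖z‖ ^ 2))) :=
    isFiniteMeasure_withDensity_ofReal (hint.const_mul _).2
  refine Measure.ext_of_charFun (funext fun t => ?_)
  rw [charFun_stdGaussian, charFun_apply, integral_withDensity_eq_integral_toReal_smul
    (by fun_prop) (by simp)]
  have h1 : ∀ z : EuclideanSpace ℝ (Fin d),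
      (ENNReal.ofReal (gaussConst d * Real.exp (-(1 / 2) * ‖z‖ ^ 2))).toReal •
        Complex.exp ((inner ℝ z t : ℝ) * Complex.I) =
      (gaussConst d : ℂ) *
        Complex.exp (-(1 / 2 : ℂ) * (‖z‖ : ℂ) ^ 2 + Complex.I * (inner ℝ t z : ℝ)) := by
    intro z
    rw [ENNReal.toReal_ofReal (by positivity), Complex.real_smul, Complex.exp_add,
      real_inner_comm z t]
    push_cast
    ring_nf
  simp_rw [h1]
  rw [integral_const_mul, GaussianFourier.integral_cexp_neg_mul_sq_norm_add (by norm_num)]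
  have h2 : (gaussConst d : ℂ) * ((Real.pi : ℂ) / (1 / 2)) ^
      ((Module.finrank ℝ (EuclideanSpace ℝ (Fin d)) : ℂ) / 2) = 1 := by
    have h3 : ((Real.pi : ℂ) / (1 / 2)) ^
        ((Module.finrank ℝ (EuclideanSpace ℝ (Fin d)) : ℂ) / 2) =
        (((2 * Real.pi) ^ ((d : ℝ) / 2) : ℝ) : ℂ) := by
      rw [Complex.ofReal_cpow (by positivity)]
      simp [mul_comm]
    rw [h3, ← Complex.ofReal_mul, gaussConst, inv_mul_cancel₀ (by positivity)]
    simp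
  rw [← mul_assoc, h2, one_mul]
  congr 1
  rw [Complex.I_sq]
  ring

open scoped MatrixOrder in
-- The law is the image of the standard Gaussian under the square root `L` of the covariance, so
-- this is a linear change of variables. The determinant of `L⁻¹` is written as an exponential to
-- match the shape of `logDensity`.
theorem lintegral_multivariateGaussian (S : SPD d) (h : EuclideanSpace ℝ (Fin d) → ENNReal)
    (hh : Measurable h) :
    ∫⁻ z, h z ∂(multivariateGaussian 0 S.1) = ∫⁻ z, ENNReal.ofReal (gaussConst d *
      Real.exp (-(1 / 2) * Real.log S.1.det - (1 / 2) * (z.ofLp ⬝ᵥ (S.1⁻¹ *ᵥ z.ofLp)))) * h z := by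
  have hS := S.2
  set L : Matrix (Fin d) (Fin d) ℝ := CFC.sqrt S.1 with hL
  have hLL : L * L = S.1 := CFC.sqrt_mul_sqrt_self _ hS.posSemidef.nonneg
  have hLp : L.PosSemidef := Matrix.nonneg_iff_posSemidef.1 (CFC.sqrt_nonneg S.1)
  have hdet : L.det * L.det = S.1.det := by rw [← Matrix.det_mul, hLL]
  have hd0 : 0 < L.det := by
    refine lt_of_le_of_ne hLp.det_nonneg fun h0 => ?_
    rw [← h0, mul_zero] at hdet
    exact hS.det_pos.ne hdet
  have hLT : Lᵀ = L := by simpa [Matrix.IsHermitian] using hLp.isHermitian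
  have hLu : IsUnit L.det := hd0.ne'.isUnit
  have hinv : L * (S.1⁻¹ * L) = 1 := by
    rw [← hLL, Matrix.mul_inv_rev, mul_assoc, Matrix.nonsing_inv_mul _ hLu, mul_one,
      Matrix.mul_nonsing_inv _ hLu]
  have hquad : ∀ w : EuclideanSpace ℝ (Fin d),
      (Matrix.toEuclideanCLM (𝕜 := ℝ) L w).ofLp ⬝ᵥ
        (S.1⁻¹ *ᵥ (Matrix.toEuclideanCLM (𝕜 := ℝ) L w).ofLp) = ‖w‖ ^ 2 := by
    intro w
    rw [Matrix.ofLp_toEuclideanCLM, Matrix.mulVec_mulVec, Matrix.dotProduct_mulVec,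
      Matrix.vecMul_mulVec, hLT, hinv, Matrix.vecMul_one, EuclideanSpace.real_norm_sq_eq]
    simp [dotProduct, sq]
  have hdetL : LinearMap.det (Matrix.toEuclideanCLM (𝕜 := ℝ) L).toLinearMap = L.det := by
    have : (Matrix.toEuclideanCLM (𝕜 := ℝ) L).toLinearMap =
        Matrix.toLin (EuclideanSpace.basisFun (Fin d) ℝ).toBasis
          (EuclideanSpace.basisFun (Fin d) ℝ).toBasis L := by
      rw [← Matrix.toEuclideanLin_eq_toLin_orthonormal]
      rfl
    rw [this, LinearMap.det_toLin]
  have hmap := Measure.map_linearMap_addHaar_eq_smul_addHaar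
    (volume : Measure (EuclideanSpace ℝ (Fin d)))
    (f := (Matrix.toEuclideanCLM (𝕜 := ℝ) L).toLinearMap) (by rw [hdetL]; exact hd0.ne')
  have hmeas : Measurable (Matrix.toEuclideanCLM (𝕜 := ℝ) L).toLinearMap :=
    (Matrix.toEuclideanCLM (𝕜 := ℝ) L).continuous.measurable
  have hcq : Continuous fun z : EuclideanSpace ℝ (Fin d) => z.ofLp ⬝ᵥ (S.1⁻¹ *ᵥ z.ofLp) := by
    simp only [dotProduct, Matrix.mulVec]
    fun_prop
  have hk : Measurable fun z : EuclideanSpace ℝ (Fin d) => ENNReal.ofReal (gaussConst d *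
      Real.exp (-(1 / 2) * (z.ofLp ⬝ᵥ (S.1⁻¹ *ᵥ z.ofLp)))) * h z := by
    have : Continuous fun z : EuclideanSpace ℝ (Fin d) => gaussConst d *
      Real.exp (-(1 / 2) * (z.ofLp ⬝ᵥ (S.1⁻¹ *ᵥ z.ofLp))) := by fun_prop
    exact this.measurable.ennreal_ofReal.mul hh
  have h1 : ∫⁻ z, h z ∂(multivariateGaussian 0 S.1) =
      ∫⁻ w, ENNReal.ofReal (gaussConst d * Real.exp (-(1 / 2) * ‖w‖ ^ 2)) *
        h (Matrix.toEuclideanCLM (𝕜 := ℝ) L w) := by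
    rw [multivariateGaussian, lintegral_map hh (by fun_prop), stdGaussian_eq_withDensity,
      lintegral_withDensity_eq_lintegral_mul _ (by fun_prop) (by fun_prop)]
    simp [hL]
  have h2 : ∀ w, ENNReal.ofReal (gaussConst d * Real.exp (-(1 / 2) * ‖w‖ ^ 2)) *
        h (Matrix.toEuclideanCLM (𝕜 := ℝ) L w) =
      (fun z : EuclideanSpace ℝ (Fin d) => ENNReal.ofReal (gaussConst d *
      Real.exp (-(1 / 2) * (z.ofLp ⬝ᵥ (S.1⁻¹ *ᵥ z.ofLp)))) * h z)
        ((Matrix.toEuclideanCLM (𝕜 := ℝ) L).toLinearMap w) := by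
    intro w
    simp only [ContinuousLinearMap.coe_coe, hquad]
  rw [h1, lintegral_congr h2, ← lintegral_map hk hmeas, hmap, lintegral_smul_measure, hdetL,
    smul_eq_mul, ← lintegral_const_mul _ hk]
  refine lintegral_congr fun z => ?_
  rw [← mul_assoc, ← ENNReal.ofReal_mul (by positivity)]
  congr 2
  have hlog : Real.exp (-(1 / 2) * Real.log S.1.det) = (L.det)⁻¹ := by
    rw [← hdet, Real.log_mul hd0.ne' hd0.ne',
      show -(1 / 2) * (Real.log L.det + Real.log L.det) = -Real.log L.det by ring, Real.exp_neg,
      Real.exp_log hd0]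
  rw [sub_eq_add_neg, Real.exp_add, hlog, abs_of_pos (inv_pos.2 hd0), neg_mul]
  ring

end Gaussian

/-! ### The density of the hyperbolic wrapped normal law -/

section Density

variable {d : ℕ}

/-- The hyperbolic volume. -/
def hypVolume (d : ℕ) : Measure (Hyp d) :=
  (volume.withDensity fun y => ENNReal.ofReal (height y)⁻¹).map ofSpatial

theorem continuous_coshDist (u : EuclideanSpace ℝ (Fin d)) : Continuous (coshDist u) := by
  have := continuous_height (d := d)
  unfold coshDist
  fun_prop

theorem continuous_height_inv : Continuous fun y : EuclideanSpace ℝ (Fin d) => (height y)⁻¹ :=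
  continuous_height.inv₀ fun y => (height_pos y).ne'

theorem continuousOn_ratio : ContinuousOn ratio (Set.Ioi 0) := fun _ ht =>
  (hasDerivAt_ratioFamily 0 ht).continuousAt.continuousWithinAt

theorem continuous_ratio_coshDist (u : EuclideanSpace ℝ (Fin d)) :
    Continuous fun y => ratio (coshDist u y) :=
  continuousOn_ratio.comp_continuous (continuous_coshDist u)
    fun y => lt_of_lt_of_le one_pos (one_le_coshDist u y)

theorem continuous_coord (μ : Hyp d) : Continuous (coord μ) := by
  have h1 := (continuous_ratio_coshDist (spatial μ)).comp continuous_spatial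
  have h2 := (continuous_coshDist (spatial μ)).comp (continuous_spatial (d := d))
  have h3 := (continuous_height (d := d)).comp continuous_spatial
  have h : coord μ = fun x => ratio (coshDist (spatial μ) (spatial x)) •
      unboost (spatial μ) (spatial x) := funext (coord_eq μ)
  rw [h]
  refine h1.smul ?_
  unfold unboost
  exact continuous_spatial.sub (((h2.add h3).div_const _).smul continuous_const)

theorem continuous_logDensity (μ : Hyp d) (S : SPD d) : Continuous (logDensity μ S) := by
  have h : logDensity μ S = _ := funext (logDensity_eq μ S)
  rw [h]
  have h1 := (continuous_ratio_coshDist (spatial μ)).comp continuous_spatial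
  have h2 := continuous_coord μ
  have h3 : Continuous fun x => (coord μ x).ofLp ⬝ᵥ (S.1⁻¹ *ᵥ (coord μ x).ofLp) := by
    simp only [dotProduct, Matrix.mulVec]
    fun_prop
  have h4 : Continuous fun x : Hyp d => Real.log (ratio (coshDist (spatial μ) (spatial x))) :=
    h1.log fun x => (ratio_pos (zero_le_one.trans (one_le_coshDist _ _))).ne'
  fun_prop

/-- In the coordinates `z` the hyperbolic volume is `(sinh ‖z‖ / ‖z‖) ^ (d - 1) dz`; the term `(d -
1) φ` of the log-density cancels exactly this factor and leaves the Gaussian density. -/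
theorem hwn_eq_withDensity (hd : 1 ≤ d) (μ : Hyp d) (S : SPD d) :
    hwn μ S = (hypVolume d).withDensity fun x =>
      ENNReal.ofReal (gaussConst d * Real.exp (logDensity μ S x)) := by
  have hc := gaussConst_pos d
  have hm := continuous_logDensity μ S
  refine Measure.ext_of_lintegral _ fun f hf => ?_
  have hd1 : Measurable fun x => ENNReal.ofReal (gaussConst d * Real.exp (logDensity μ S x)) := by
    have : Continuous fun x => gaussConst d * Real.exp (logDensity μ S x) := by fun_prop
    exact this.measurable.ennreal_ofReal
  have hd2 : Measurable fun y : EuclideanSpace ℝ (Fin d) => ENNReal.ofReal (height y)⁻¹ :=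
    continuous_height_inv.measurable.ennreal_ofReal
  have hos := (continuous_ofSpatial (d := d)).measurable
  rw [hwn, lintegral_map hf (measurable_wrap μ), lintegral_multivariateGaussian S
    (fun z => f (wrap μ z)) (hf.comp (measurable_wrap μ)),
    lintegral_withDensity_eq_lintegral_mul _ hd1 hf, hypVolume,
    lintegral_map (hd1.mul hf) hos, lintegral_withDensity_eq_lintegral_mul _ hd2
      (g := fun y => ((fun x => ENNReal.ofReal (gaussConst d * Real.exp (logDensity μ S x))) * f)
        (ofSpatial y)) ((hd1.mul hf).comp hos)]
  conv_rhs => rw [lintegral_spatial_wrap hd μ]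
  refine lintegral_congr_ae ?_
  have : Nonempty (Fin d) := ⟨⟨0, hd⟩⟩
  filter_upwards [Measure.ae_ne volume (0 : EuclideanSpace ℝ (Fin d))] with z hz
  simp only [Pi.mul_apply, ofSpatial_spatial]
  have hh := height_pos (spatial (wrap μ z))
  have hz0 : 0 < ‖z‖ := norm_pos_iff.2 hz
  have hs : 0 < Real.sinh ‖z‖ / ‖z‖ := div_pos (Real.sinh_pos_iff.2 hz0) hz0
  rw [← mul_assoc, ← mul_assoc, ← ENNReal.ofReal_mul (by positivity),
    ← ENNReal.ofReal_mul (by positivity)]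
  congr 2
  have hdc : ((d : ℝ) - 1) = ((d - 1 : ℕ) : ℝ) := by
    rw [Nat.cast_sub hd, Nat.cast_one]
  rw [logDensity, coord_wrap, phi, if_neg hz, Real.exp_sub _ (((d : ℝ) - 1) * _), hdc,
    Real.exp_nat_mul, Real.exp_log hs]
  field_simp

end Density

end HypWN

namespace HypWN

open scoped ContDiff Nat

variable {d : ℕ}

/-! ### Moments -/

theorem continuous_wrap (μ : Hyp d) : Continuous (wrap μ) := by
  have h : wrap μ = fun z => ofSpatial (boost (spatial μ) (sinhMap z)) := by
    funext z
    rw [← spatial_wrap, ofSpatial_spatial]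
  have hs : Continuous (sinhMap (d := d)) := (contDiff_sinhMap (n := 0)).continuous
  rw [h]
  have hc : Continuous fun z : EuclideanSpace ℝ (Fin d) =>
      height (sinhMap z) + inner ℝ (spatial μ) (sinhMap z) / (1 + height (spatial μ)) :=
    (continuous_height.comp hs).add ((Continuous.inner continuous_const hs).div_const _)
  exact continuous_ofSpatial.comp (hs.add (hc.smul continuous_const))

theorem height_wrap_le (μ : Hyp d) (z : EuclideanSpace ℝ (Fin d)) :
    height (spatial (wrap μ z)) ≤ 2 * height (spatial μ) * Real.exp ‖z‖ := by
  have h1 : Real.cosh ‖z‖ ≤ Real.exp ‖z‖ := by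
    rw [Real.cosh_eq]
    have := Real.exp_le_exp.2 (neg_le_self (norm_nonneg z))
    linarith
  have h2 : Real.sinh ‖z‖ ≤ Real.exp ‖z‖ := (Real.sinh_lt_cosh _).le.trans h1
  have h3 : inner ℝ (spatial μ) (sinhMap z) ≤ height (spatial μ) * Real.exp ‖z‖ := by
    refine (real_inner_le_norm _ _).trans ?_
    rw [norm_sinhMap]
    exact mul_le_mul (norm_le_height _) h2 (Real.sinh_nonneg_iff.2 (norm_nonneg z))
      (height_pos _).le
  rw [spatial_wrap, height_boost, height_sinhMap]
  nlinarith [mul_le_mul_of_nonneg_left h1 (height_pos (spatial μ)).le]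

/-- The height grows at most like `exp ‖z‖` in the Gaussian variable, and Fernique's theorem makes
some `exp (C ‖z‖²)` integrable. Thus polynomial growth in the spatial part always implies
integrability. -/
theorem integrable_height_pow (μ : Hyp d) (S : SPD d) (N : ℕ) :
    Integrable (fun x => height (spatial x) ^ N) (hwn μ S) := by
  have hc : Continuous fun x : Hyp d => height (spatial x) ^ N :=
    (continuous_height.comp continuous_spatial).pow N
  rw [hwn, integrable_map_measure hc.aestronglyMeasurable (measurable_wrap μ).aemeasurable]
  obtain ⟨C, hC, hint⟩ := IsGaussian.exists_integrable_exp_sq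
    (multivariateGaussian (0 : EuclideanSpace ℝ (Fin d)) S.1)
  refine (hint.const_mul ((2 * height (spatial μ)) ^ N * Real.exp (N ^ 2 / C))).mono'
    (hc.comp (continuous_wrap μ)).aestronglyMeasurable (ae_of_all _ fun z => ?_)
  have hh := height_pos (spatial (wrap μ z))
  have hu := height_pos (spatial μ)
  rw [Function.comp_apply, Real.norm_of_nonneg (by positivity)]
  calc height (spatial (wrap μ z)) ^ N ≤ (2 * height (spatial μ) * Real.exp ‖z‖) ^ N :=
        pow_le_pow_left₀ hh.le (height_wrap_le μ z) N
    _ = (2 * height (spatial μ)) ^ N * Real.exp (N * ‖z‖) := by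
        rw [mul_pow, ← Real.exp_nat_mul]
    _ ≤ (2 * height (spatial μ)) ^ N * Real.exp (N ^ 2 / C + C * ‖z‖ ^ 2) := by
        refine mul_le_mul_of_nonneg_left (Real.exp_le_exp.2 ?_) (by positivity)
        -- Completing the square to get `N ‖z‖ ≤ N² / C + C ‖z‖²`.
        have : 0 ≤ (2 * C * ‖z‖ - N) ^ 2 / (4 * C) + 3 * N ^ 2 / (4 * C) := by positivity
        have h2 : (2 * C * ‖z‖ - N) ^ 2 / (4 * C) + 3 * N ^ 2 / (4 * C) =
            N ^ 2 / C + C * ‖z‖ ^ 2 - N * ‖z‖ := by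
          field_simp
          ring
        linarith
    _ = _ := by rw [Real.exp_add, mul_assoc]

theorem integrable_of_le_height_pow {V : Type*} [NormedAddCommGroup V] (μ : Hyp d) (S : SPD d)
    {f : Hyp d → V} (hf : AEStronglyMeasurable f (hwn μ S)) {C : ℝ} {N : ℕ}
    (h : ∀ x, ‖f x‖ ≤ C * height (spatial x) ^ N) : Integrable f (hwn μ S) :=
  ((integrable_height_pow μ S N).const_mul C).mono' hf (ae_of_all _ h)

/-! ### Integration against the density -/

theorem measurable_density (μ : Hyp d) (S : SPD d) :
    Measurable fun x => ENNReal.ofReal (gaussConst d * Real.exp (logDensity μ S x)) := by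
  have := continuous_logDensity μ S
  have h : Continuous fun x => gaussConst d * Real.exp (logDensity μ S x) := by fun_prop
  exact h.measurable.ennreal_ofReal

theorem toReal_density (μ : Hyp d) (S : SPD d) (x : Hyp d) :
    (ENNReal.ofReal (gaussConst d * Real.exp (logDensity μ S x))).toReal =
      gaussConst d * Real.exp (logDensity μ S x) :=
  ENNReal.toReal_ofReal (mul_nonneg (gaussConst_pos d).le (Real.exp_pos _).le)

theorem integrable_hwn_iff {V : Type*} [NormedAddCommGroup V] [NormedSpace ℝ V] (hd : 1 ≤ d)
    (μ : Hyp d) (S : SPD d) (f : Hyp d → V) : Integrable f (hwn μ S) ↔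
      Integrable (fun x => Real.exp (logDensity μ S x) • f x) (hypVolume d) := by
  rw [hwn_eq_withDensity hd, integrable_withDensity_iff_integrable_smul' (measurable_density μ S)
    (ae_of_all _ fun x => ENNReal.ofReal_lt_top)]
  simp_rw [toReal_density, mul_smul]
  exact integrable_fun_smul_iff (gaussConst_pos d).ne' _

theorem integral_hwn {V : Type*} [NormedAddCommGroup V] [NormedSpace ℝ V] (hd : 1 ≤ d)
    (μ : Hyp d) (S : SPD d) (f : Hyp d → V) : ∫ x, f x ∂(hwn μ S) =
      gaussConst d • ∫ x, Real.exp (logDensity μ S x) • f x ∂(hypVolume d) := by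
  rw [hwn_eq_withDensity hd, integral_withDensity_eq_integral_toReal_smul (measurable_density μ S)
    (ae_of_all _ fun x => ENNReal.ofReal_lt_top)]
  simp_rw [toReal_density, mul_smul]
  exact integral_smul _ _

theorem integral_exp_logDensity (hd : 1 ≤ d) (μ : Hyp d) (S : SPD d) :
    ∫ x, Real.exp (logDensity μ S x) ∂(hypVolume d) = (gaussConst d)⁻¹ := by
  have h := integral_hwn hd μ S fun _ => (1 : ℝ)
  simp only [integral_const, probReal_univ, smul_eq_mul, mul_one] at h
  exact eq_inv_of_mul_eq_one_right h.symm

/-! ### Bounds on the log-density -/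

/-- By Cauchy–Schwarz the left factor `height u` can be taken out, and `height y - ‖y‖ = 1 / (height
y + ‖y‖) ≥ 1 / (2 height y)`. -/
theorem height_div_le_coshDist (u y : EuclideanSpace ℝ (Fin d)) :
    height u / (2 * height y) ≤ coshDist u y := by
  have hu := height_pos u
  have hy := height_pos y
  have h1 : inner ℝ u y ≤ height u * ‖y‖ := (real_inner_le_norm u y).trans
    (mul_le_mul_of_nonneg_right (norm_le_height u) (norm_nonneg y))
  have h2 : (height y - ‖y‖) * (2 * height y) ≥ 1 := by
    nlinarith [height_sq y, sq_nonneg (height y - ‖y‖)]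
  rw [div_le_iff₀ (by positivity), coshDist]
  nlinarith [mul_le_mul_of_nonneg_left h2 hu.le, mul_le_mul_of_nonneg_right h1 hy.le]

theorem log_coshDist_le_hdist (μ x : Hyp d) :
    Real.log (coshDist (spatial μ) (spatial x)) ≤ hdist μ x := by
  have h := one_le_coshDist (spatial μ) (spatial x)
  rw [hdist, neg_lorentz, Real.arcosh]
  refine Real.log_le_log (by linarith) ?_
  linarith [Real.sqrt_nonneg (coshDist (spatial μ) (spatial x) ^ 2 - 1)]

theorem hdist_nonneg (μ x : Hyp d) : 0 ≤ hdist μ x := Real.arcosh_nonneg (one_le_neg_lorentz μ x)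

theorem hdist_comm (μ x : Hyp d) : hdist μ x = hdist x μ := by
  rw [hdist, hdist, lorentz_comm]

/-- A lower bound on the squared distance in terms of the heights of both points. -/
theorem sq_le_hdist_sq (μ x : Hyp d) :
    Real.log (height (spatial μ)) ^ 2 / 2 - Real.log (2 * height (spatial x)) ^ 2 ≤
      hdist μ x ^ 2 := by
  have hu := height_pos (spatial μ)
  have hy := height_pos (spatial x)
  have h1 : Real.log (height (spatial μ)) - Real.log (2 * height (spatial x)) ≤ hdist μ x := by
    rw [← Real.log_div hu.ne' (by positivity)]
    exact (Real.log_le_log (by positivity) (height_div_le_coshDist _ _)).trans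
      (log_coshDist_le_hdist μ x)
  have h2 := hdist_nonneg μ x
  have ha : 0 ≤ Real.log (height (spatial μ)) := Real.log_nonneg (one_le_height _)
  have hb : 0 ≤ Real.log (2 * height (spatial x)) :=
    Real.log_nonneg (by linarith [one_le_height (spatial x)])
  set a := Real.log (height (spatial μ))
  set b := Real.log (2 * height (spatial x))
  -- The bound `a - b ≤ hdist μ x` may be squared only when `b ≤ a`, and then `(a - b)² - a² / 2 +
  -- b² = (a - 2b)² / 2`. Otherwise the left side is nonpositive.
  rcases le_total b a with h | h
  · have : (a - b) ^ 2 ≤ hdist μ x ^ 2 := pow_le_pow_left₀ (by linarith) h1 2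
    nlinarith [sq_nonneg (a - 2 * b)]
  · nlinarith [sq_nonneg (hdist μ x)]

theorem phi_nonneg (v : EuclideanSpace ℝ (Fin d)) : 0 ≤ phi v := by
  rw [phi]
  split_ifs with h
  · exact le_rfl
  · have hv : 0 < ‖v‖ := norm_pos_iff.2 h
    refine Real.log_nonneg ?_
    rw [le_div_iff₀ hv, one_mul]
    exact Real.self_le_sinh_iff.2 hv.le

open scoped MatrixOrder in
theorem exists_sqrt (S : SPD d) : ∃ L : Matrix (Fin d) (Fin d) ℝ,
    Lᵀ = L ∧ L * L = S.1 ∧ IsUnit L.det := by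
  have hLp : (CFC.sqrt S.1).PosSemidef := Matrix.nonneg_iff_posSemidef.1 (CFC.sqrt_nonneg S.1)
  have hLL : CFC.sqrt S.1 * CFC.sqrt S.1 = S.1 :=
    CFC.sqrt_mul_sqrt_self _ S.2.posSemidef.nonneg
  refine ⟨CFC.sqrt S.1, by simpa [Matrix.IsHermitian] using hLp.isHermitian, hLL, ?_⟩
  have hdet : (CFC.sqrt S.1).det * (CFC.sqrt S.1).det = S.1.det := by rw [← Matrix.det_mul, hLL]
  refine (left_ne_zero_of_mul (b := (CFC.sqrt S.1).det) ?_).isUnit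
  rw [hdet]
  exact S.2.det_pos.ne'

theorem dotProduct_self_eq_norm_sq (z : EuclideanSpace ℝ (Fin d)) :
    z.ofLp ⬝ᵥ z.ofLp = ‖z‖ ^ 2 := by
  rw [EuclideanSpace.real_norm_sq_eq]
  simp [dotProduct, sq]

/-- Substituting `z = L v` with `L² = S` turns the inverse form into `‖v‖²` and `‖z‖²` into `vᵀ S
v`, so only the upper bound of the shell is needed. -/
theorem norm_sq_le_quadratic {lo hi : ℝ} (hhi : 0 < hi) {S : SPD d} (hS : S ∈ shell d lo hi)
    (z : EuclideanSpace ℝ (Fin d)) : ‖z‖ ^ 2 / hi ≤ z.ofLp ⬝ᵥ (S.1⁻¹ *ᵥ z.ofLp) := by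
  obtain ⟨L, hLT, hLL, hLu⟩ := exists_sqrt S
  obtain ⟨v, hz⟩ : ∃ v, z.ofLp = L *ᵥ v := by
    refine ⟨L⁻¹ *ᵥ z.ofLp, ?_⟩
    rw [Matrix.mulVec_mulVec, Matrix.mul_nonsing_inv _ hLu, Matrix.one_mulVec]
  have hinv : L * (S.1⁻¹ * L) = 1 := by
    rw [← hLL, Matrix.mul_inv_rev, mul_assoc, Matrix.nonsing_inv_mul _ hLu, mul_one,
      Matrix.mul_nonsing_inv _ hLu]
  have h1 : z.ofLp ⬝ᵥ (S.1⁻¹ *ᵥ z.ofLp) = v ⬝ᵥ v := by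
    rw [hz, Matrix.mulVec_mulVec, Matrix.dotProduct_mulVec, Matrix.vecMul_mulVec, hLT, hinv,
      Matrix.vecMul_one]
  have h2 : ‖z‖ ^ 2 = v ⬝ᵥ (S.1 *ᵥ v) := by
    rw [← dotProduct_self_eq_norm_sq, hz, Matrix.dotProduct_mulVec, Matrix.vecMul_mulVec, hLT, hLL,
      ← Matrix.dotProduct_mulVec]
  have h3 := hS.2.dotProduct_mulVec_nonneg v
  rw [Matrix.sub_mulVec, dotProduct_sub, Matrix.smul_mulVec, Matrix.one_mulVec, dotProduct_smul,
    smul_eq_mul] at h3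
  simp only [star_trivial] at h3
  rw [div_le_iff₀ hhi, h1, h2]
  linarith

theorem pow_le_det {lo hi : ℝ} (hlo : 0 < lo) {S : SPD d} (hS : S ∈ shell d lo hi) :
    lo ^ d ≤ S.1.det := by
  have hH := S.2.isHermitian
  rw [hH.det_eq_prod_eigenvalues]
  have h : ∀ i, lo ≤ hH.eigenvalues i := by
    intro i
    have h3 := hS.1.dotProduct_mulVec_nonneg (hH.eigenvectorBasis i).ofLp
    rw [Matrix.sub_mulVec, dotProduct_sub, Matrix.smul_mulVec, Matrix.one_mulVec, dotProduct_smul,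
      smul_eq_mul] at h3
    simp only [star_trivial] at h3
    have h4 := hH.eigenvalues_eq i
    simp only [star_trivial, RCLike.re_to_real] at h4
    rw [dotProduct_self_eq_norm_sq, hH.eigenvectorBasis.orthonormal.1 i, ← h4] at h3
    linarith
  calc lo ^ d = ∏ _i : Fin d, lo := by simp
    _ ≤ ∏ i, hH.eigenvalues i := Finset.prod_le_prod (fun _ _ => hlo.le) fun i _ => h i

theorem logDensity_le {lo hi : ℝ} (hd : 1 ≤ d) (hlo : 0 < lo) (hhi : 0 < hi) {S : SPD d}
    (hS : S ∈ shell d lo hi) (μ x : Hyp d) :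
    logDensity μ S x ≤ -(1 / 2) * Real.log (lo ^ d) - hdist μ x ^ 2 / (2 * hi) := by
  have h1 := Real.log_le_log (by positivity) (pow_le_det hlo hS)
  have h2 := norm_sq_le_quadratic hhi hS (coord μ x)
  have h3 := phi_nonneg (coord μ x)
  have h4 : (0 : ℝ) ≤ (d : ℝ) - 1 := by
    have : (1 : ℝ) ≤ d := by exact_mod_cast hd
    linarith
  rw [norm_coord] at h2
  rw [logDensity]
  have h5 : hdist μ x ^ 2 / (2 * hi) = (1 / 2) * (hdist μ x ^ 2 / hi) := by field_simp
  rw [h5]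
  have := mul_nonneg h4 h3
  linarith

theorem arcosh_le_log_two_mul {t : ℝ} (ht : 1 ≤ t) : Real.arcosh t ≤ Real.log (2 * t) := by
  rw [Real.arcosh]
  have : √(t ^ 2 - 1) ≤ t := by
    rw [Real.sqrt_le_left (by linarith)]
    linarith
  exact Real.log_le_log (by linarith [Real.sqrt_nonneg (t ^ 2 - 1)]) (by linarith)

/-- The scalar covariance matrix. -/
def scalarSPD (d : ℕ) {c : ℝ} (hc : 0 < c) : SPD d :=
  ⟨c • (1 : Matrix (Fin d) (Fin d) ℝ), Matrix.PosDef.one.smul hc⟩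

theorem spatial_origin : spatial (origin d) = 0 := by
  ext; simp [spatial, spatialPart, origin]

/-- A lower bound for a comparison density. Its logarithm falls off no faster than `(log height)² /
c`, up to lower-order terms, and `c` is later taken large enough to dominate a whole neighbourhood
of parameters. -/
theorem le_logDensity_origin (hd : 1 ≤ d) {c : ℝ} (hc : 0 < c) (x : Hyp d) :
    -(1 / 2) * Real.log (c ^ d) - (Real.log (height (spatial x)) ^ 2 + Real.log 2 ^ 2) / c
      - ((d : ℝ) - 1) * Real.log (2 * height (spatial x)) ≤
      logDensity (origin d) (scalarSPD d hc) x := by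
  have hJ := one_le_height (spatial x)
  have hcd : coshDist (spatial (origin d)) (spatial x) = height (spatial x) := by
    simp [spatial_origin, coshDist, height]
  have hdet : (scalarSPD d hc).1.det = c ^ d := by simp [scalarSPD]
  have hinv : (scalarSPD d hc).1⁻¹ = c⁻¹ • (1 : Matrix (Fin d) (Fin d) ℝ) := by
    refine Matrix.inv_eq_left_inv ?_
    simp [scalarSPD, hc.ne']
  have hq : (coord (origin d) x).ofLp ⬝ᵥ ((scalarSPD d hc).1⁻¹ *ᵥ (coord (origin d) x).ofLp) =
      hdist (origin d) x ^ 2 / c := by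
    rw [hinv, Matrix.smul_mulVec, Matrix.one_mulVec, dotProduct_smul, dotProduct_self_eq_norm_sq,
      norm_coord, smul_eq_mul, inv_mul_eq_div]
  have hr : hdist (origin d) x ≤ Real.log (height (spatial x)) + Real.log 2 := by
    rw [hdist, neg_lorentz, hcd, add_comm, ← Real.log_mul two_ne_zero (by linarith)]
    exact arcosh_le_log_two_mul hJ
  have hr2 : hdist (origin d) x ^ 2 ≤
      2 * (Real.log (height (spatial x)) ^ 2 + Real.log 2 ^ 2) := by
    have := pow_le_pow_left₀ (hdist_nonneg (origin d) x) hr 2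
    nlinarith [sq_nonneg (Real.log (height (spatial x)) - Real.log 2)]
  have hratio : -Real.log (2 * height (spatial x)) ≤ Real.log (ratio (height (spatial x))) := by
    rw [← Real.log_inv]
    refine Real.log_le_log (by positivity) ?_
    have h1 := one_le_mul_ratio (t := height (spatial x)) (by linarith)
    have h2 := ratio_pos (t := height (spatial x)) (by linarith)
    rw [inv_le_iff_one_le_mul₀ (by linarith)]
    nlinarith
  have h4 : (0 : ℝ) ≤ (d : ℝ) - 1 := by
    have : (1 : ℝ) ≤ d := by exact_mod_cast hd
    linarith
  rw [logDensity_eq, hdet, hq, hcd]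
  have h5 : (1 / 2) * (hdist (origin d) x ^ 2 / c) ≤
      (Real.log (height (spatial x)) ^ 2 + Real.log 2 ^ 2) / c := by
    rw [← mul_div_assoc]
    exact div_le_div_of_nonneg_right (by linarith) hc.le
  have h6 := mul_le_mul_of_nonneg_left hratio h4
  linarith

/-- Locally uniform domination of the densities by a multiple of a centred one. -/
theorem exists_exp_logDensity_le {lo hi : ℝ} (hd : 1 ≤ d) (hlo : 0 < lo) (hhi : 0 < hi) (B : ℝ) :
    ∃ C, ∀ (μ : Hyp d) (S : SPD d) (x : Hyp d), S ∈ shell d lo hi → height (spatial μ) ≤ B →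
      Real.exp (logDensity μ S x) ≤ C * (height (spatial x) ^ (d - 1) *
        Real.exp (logDensity (origin d) (scalarSPD d (c := 4 * hi) (by positivity)) x)) := by
  set K := -(1 / 2) * Real.log (lo ^ d) + Real.log (2 * B) ^ 2 / (2 * hi)
    + (1 / 2) * Real.log ((4 * hi) ^ d) + Real.log 2 ^ 2 / (4 * hi) with hK
  refine ⟨Real.exp K * 2 ^ (d - 1), fun μ S x hS hB => ?_⟩
  have hJ := one_le_height (spatial x)
  have h1 := logDensity_le hd hlo hhi hS μ x
  -- The roles are exchanged here: the observation may be far away, while the location stays in a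
  -- bounded region.
  have h2 := sq_le_hdist_sq x μ
  rw [hdist_comm x μ] at h2
  have h3 : Real.log (2 * height (spatial μ)) ^ 2 ≤ Real.log (2 * B) ^ 2 := by
    have h0 := one_le_height (spatial μ)
    exact pow_le_pow_left₀ (Real.log_nonneg (by linarith))
      (Real.log_le_log (by linarith) (by linarith)) 2
  -- The variance `4 * hi` is chosen so that the terms `(log height)² / (4 hi)` of the upper and
  -- lower bounds cancel.
  have h4 := le_logDensity_origin hd (c := 4 * hi) (by positivity) x
  set ℓ := Real.log (height (spatial x))
  set M := logDensity (origin d) (scalarSPD d (c := 4 * hi) (by positivity)) x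
  have h5 : (ℓ ^ 2 / 2 - Real.log (2 * B) ^ 2) / (2 * hi) ≤ hdist μ x ^ 2 / (2 * hi) :=
    div_le_div_of_nonneg_right (by linarith) (by positivity)
  have h6 : (ℓ ^ 2 / 2 - Real.log (2 * B) ^ 2) / (2 * hi) =
      ℓ ^ 2 / (4 * hi) - Real.log (2 * B) ^ 2 / (2 * hi) := by
    field_simp
    ring
  have h7 : logDensity μ S x ≤ K + ((d : ℝ) - 1) * Real.log (2 * height (spatial x)) + M := by
    rw [add_div] at h4
    linarith
  have hdc : ((d : ℝ) - 1) = ((d - 1 : ℕ) : ℝ) := by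
    rw [Nat.cast_sub hd, Nat.cast_one]
  calc Real.exp (logDensity μ S x)
      ≤ Real.exp (K + ((d : ℝ) - 1) * Real.log (2 * height (spatial x)) + M) :=
        Real.exp_le_exp.2 h7
    _ = _ := by
        rw [Real.exp_add, Real.exp_add, hdc, Real.exp_nat_mul, Real.exp_log (by linarith), mul_pow]
        ring

/-! ### Identifiability -/

theorem eq_zero_of_quadratic_eq_zero {A : Matrix (Fin d) (Fin d) ℝ} (hA : Aᵀ = A)
    (h : ∀ z : Fin d → ℝ, z ⬝ᵥ (A *ᵥ z) = 0) : A = 0 := by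
  ext i j
  have hs : ∀ v w : Fin d → ℝ, v ⬝ᵥ (A *ᵥ w) = w ⬝ᵥ (A *ᵥ v) := by
    intro v w
    rw [Matrix.dotProduct_mulVec, dotProduct_comm, ← Matrix.mulVec_transpose, hA]
  have h1 := h (Pi.single i 1 + Pi.single j 1)
  rw [Matrix.mulVec_add, add_dotProduct, dotProduct_add, dotProduct_add, h, h,
    hs (Pi.single j 1) (Pi.single i 1)] at h1
  have h2 : (Pi.single i 1 : Fin d → ℝ) ⬝ᵥ (A *ᵥ Pi.single j 1) = A i j := by simp
  rw [h2] at h1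
  simp only [Matrix.zero_apply]
  linarith

theorem coord_self (μ : Hyp d) : coord μ μ = 0 := by
  have h := norm_coord μ μ
  rw [hdist, μ.2.1, neg_neg, Real.arcosh_zero] at h
  simpa using h

theorem logDensity_self (μ : Hyp d) (S : SPD d) :
    logDensity μ S μ = -(1 / 2) * Real.log S.1.det := by
  simp [logDensity, coord_self, phi]

theorem logDensity_lt_self (hd : 1 ≤ d) {μ x : Hyp d} (S : SPD d) (hx : x ≠ μ) :
    logDensity μ S x < logDensity μ S μ := by
  have h0 : coord μ x ≠ 0 := by
    intro h
    refine hx ?_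
    rw [← wrap_coord μ x, h, ← coord_self μ, wrap_coord]
  have h1 : 0 < (coord μ x).ofLp ⬝ᵥ (S.1⁻¹ *ᵥ (coord μ x).ofLp) := by
    have := S.2.inv.dotProduct_mulVec_pos (x := (coord μ x).ofLp) (by simpa using h0)
    simpa using this
  have h3 := phi_nonneg (coord μ x)
  have h4 : (0 : ℝ) ≤ (d : ℝ) - 1 := by
    have : (1 : ℝ) ≤ d := by exact_mod_cast hd
    linarith
  rw [logDensity_self, logDensity]
  have := mul_nonneg h4 h3
  linarith

/-- The log-density has a strict maximum at its location (`logDensity_lt_self`), which determines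
`μ`. The values there determine the determinant term, and what is left is the quadratic form of the
inverse covariance. -/
theorem eq_of_logDensity_eq (hd : 1 ≤ d) {μ μ' : Hyp d} {S S' : SPD d}
    (h : ∀ x, logDensity μ S x = logDensity μ' S' x) : μ = μ' ∧ S = S' := by
  have hμ : μ = μ' := by
    by_contra hne
    have h1 := logDensity_lt_self hd S (Ne.symm hne)
    have h2 := logDensity_lt_self hd S' hne
    rw [h, h] at h1
    exact lt_asymm h1 h2
  subst hμ
  refine ⟨rfl, ?_⟩
  have h0 := h μ
  rw [logDensity_self, logDensity_self] at h0
  have hq : S.1⁻¹ - S'.1⁻¹ = 0 := by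
    refine eq_zero_of_quadratic_eq_zero ?_ fun z => ?_
    · have h1 := S.2.inv.isHermitian
      have h2 := S'.2.inv.isHermitian
      simp only [Matrix.IsHermitian, Matrix.conjTranspose_eq_transpose_of_trivial] at h1 h2
      rw [Matrix.transpose_sub, h1, h2]
    · have h1 := h (wrap μ (WithLp.toLp 2 z))
      rw [logDensity, logDensity, coord_wrap, h0] at h1
      rw [Matrix.sub_mulVec, dotProduct_sub]
      simp only at h1
      linarith
  have hi : S.1⁻¹ = S'.1⁻¹ := sub_eq_zero.1 hq
  refine Subtype.ext ?_
  rw [← Matrix.nonsing_inv_nonsing_inv S.1 S.2.det_pos.ne'.isUnit, hi,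
    Matrix.nonsing_inv_nonsing_inv S'.1 S'.2.det_pos.ne'.isUnit]

/-- The law has full support: the Gaussian density is positive, so the pulled-back function vanishes
Lebesgue-almost everywhere, hence everywhere by continuity, and `wrap μ` is onto. -/
theorem eq_zero_of_ae_hwn {μ : Hyp d} {S : SPD d} {f : Hyp d → ℝ} (hf : Continuous f)
    (h : ∀ᵐ x ∂(hwn μ S), f x = 0) (x : Hyp d) : f x = 0 := by
  have hc : Continuous fun z => f (wrap μ z) := hf.comp (continuous_wrap μ)
  have h1 : ∀ᵐ z ∂(multivariateGaussian 0 S.1), f (wrap μ z) = 0 :=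
    ae_of_ae_map (measurable_wrap μ).aemeasurable h
  have hcq : Continuous fun z : EuclideanSpace ℝ (Fin d) => z.ofLp ⬝ᵥ (S.1⁻¹ *ᵥ z.ofLp) := by
    simp only [dotProduct, Matrix.mulVec]
    fun_prop
  have h2 : ∀ᵐ z : EuclideanSpace ℝ (Fin d), f (wrap μ z) = 0 := by
    have h3 : ∫⁻ z, ENNReal.ofReal |f (wrap μ z)| ∂(multivariateGaussian 0 S.1) = 0 := by
      rw [lintegral_eq_zero_iff hc.abs.measurable.ennreal_ofReal]
      filter_upwards [h1] with z hz
      simp [hz]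
    rw [lintegral_multivariateGaussian S _ hc.abs.measurable.ennreal_ofReal,
      lintegral_eq_zero_iff] at h3
    · filter_upwards [h3] with z hz
      have hpos : 0 < gaussConst d * Real.exp (-(1 / 2) * Real.log S.1.det -
        (1 / 2) * (z.ofLp ⬝ᵥ (S.1⁻¹ *ᵥ z.ofLp))) := mul_pos (gaussConst_pos d) (Real.exp_pos _)
      simp only [Pi.zero_apply, mul_eq_zero, ENNReal.ofReal_eq_zero] at hz
      rcases hz with hz | hz
      · exact absurd hz (not_le.2 hpos)
      · exact abs_nonpos_iff.1 hz
    · refine Measurable.mul ?_ hc.abs.measurable.ennreal_ofReal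
      have : Continuous fun z : EuclideanSpace ℝ (Fin d) => gaussConst d *
        Real.exp (-(1 / 2) * Real.log S.1.det - (1 / 2) * (z.ofLp ⬝ᵥ (S.1⁻¹ *ᵥ z.ofLp))) := by
        fun_prop
      exact this.measurable.ennreal_ofReal
  have h4 : (fun z => f (wrap μ z)) = fun _ => (0 : ℝ) :=
    (Continuous.ae_eq_iff_eq volume hc continuous_const).1 h2
  have h5 := congrFun h4 (coord μ x)
  simpa [wrap_coord] using h5

/-- The true parameter is the unique maximizer of the expected log-density. -/
theorem integral_logDensity_lt (hd : 1 ≤ d) {μ μ₀ : Hyp d} {S S₀ : SPD d}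
    (hne : (μ, S) ≠ (μ₀, S₀)) (h : Integrable (logDensity μ S) (hwn μ₀ S₀))
    (h₀ : Integrable (logDensity μ₀ S₀) (hwn μ₀ S₀)) :
    ∫ x, logDensity μ S x ∂(hwn μ₀ S₀) < ∫ x, logDensity μ₀ S₀ x ∂(hwn μ₀ S₀) := by
  set p : Hyp d → ℝ := fun x => logDensity μ S x - logDensity μ₀ S₀ x with hp
  have hpc : Continuous p := (continuous_logDensity μ S).sub (continuous_logDensity μ₀ S₀)
  have hpi : Integrable p (hwn μ₀ S₀) := h.sub h₀
  have hexp : ∀ x, Real.exp (logDensity μ₀ S₀ x) • Real.exp (p x) =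
      Real.exp (logDensity μ S x) := by
    intro x
    rw [smul_eq_mul, ← Real.exp_add, hp]
    congr 1
    ring
  have hei : Integrable (fun x => Real.exp (p x)) (hwn μ₀ S₀) := by
    rw [integrable_hwn_iff hd]
    simp_rw [hexp]
    have := (integrable_hwn_iff hd μ S fun _ => (1 : ℝ)).1 (integrable_const _)
    simpa using this
  have he1 : ∫ x, Real.exp (p x) ∂(hwn μ₀ S₀) = 1 := by
    rw [integral_hwn hd]
    simp_rw [hexp]
    rw [integral_exp_logDensity hd, smul_eq_mul, mul_inv_cancel₀ (gaussConst_pos d).ne']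
  -- Gibbs' inequality from `exp p ≥ 1 + p`. The mean of `exp p` is `1`, so the mean of this
  -- nonnegative function is minus the mean of `p`; if it is zero, the log-likelihood ratio `p`
  -- vanishes.
  have hgi : Integrable (fun x => Real.exp (p x) - 1 - p x) (hwn μ₀ S₀) :=
    (hei.sub (integrable_const 1)).sub hpi
  have hg0 : ∀ x, 0 ≤ Real.exp (p x) - 1 - p x := fun x => by
    linarith [Real.add_one_le_exp (p x)]
  have hg : ∫ x, (Real.exp (p x) - 1 - p x) ∂(hwn μ₀ S₀) = -∫ x, p x ∂(hwn μ₀ S₀) := by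
    rw [integral_sub (f := fun x => Real.exp (p x) - 1) (hei.sub (integrable_const 1)) hpi,
      integral_sub hei (integrable_const 1), he1]
    simp
  have hps : ∫ x, p x ∂(hwn μ₀ S₀) = ∫ x, logDensity μ S x ∂(hwn μ₀ S₀) -
      ∫ x, logDensity μ₀ S₀ x ∂(hwn μ₀ S₀) := integral_sub h h₀
  have hnn : 0 ≤ ∫ x, (Real.exp (p x) - 1 - p x) ∂(hwn μ₀ S₀) := integral_nonneg hg0
  refine lt_of_le_of_ne (by linarith) fun heq => hne ?_
  have hz : ∫ x, (Real.exp (p x) - 1 - p x) ∂(hwn μ₀ S₀) = 0 := by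
    rw [hg, hps, heq]
    simp
  have hae := (integral_eq_zero_iff_of_nonneg hg0 hgi).1 hz
  have hpz : ∀ x, p x = 0 := by
    refine eq_zero_of_ae_hwn (μ := μ₀) (S := S₀) hpc ?_
    filter_upwards [hae] with x hx
    by_contra hne0
    have := Real.add_one_lt_exp hne0
    simp only [Pi.zero_apply] at hx
    linarith
  obtain ⟨h1, h2⟩ := eq_of_logDensity_eq hd fun x => sub_eq_zero.1 (hpz x)
  rw [h1, h2]

end HypWN

namespace HypWN

open scoped ContDiff Nat

variable {d : ℕ}

/-! ### Logarithms and exponentials of symmetric matrices -/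

section MatrixLog

open scoped Matrix.Norms.L2Operator

theorem cfc_log_exp {A : Matrix (Fin d) (Fin d) ℝ} (hA : A.IsHermitian) :
    cfc Real.log (NormedSpace.exp A) = A := CFC.log_exp A hA

open scoped MatrixOrder in
theorem exp_cfc_log (S : SPD d) : NormedSpace.exp (cfc Real.log S.1) = S.1 :=
  CFC.exp_log S.1 (Matrix.isStrictlyPositive_iff_posDef.2 S.2)

theorem cfc_log_isHermitian (A : Matrix (Fin d) (Fin d) ℝ) : (cfc Real.log A).IsHermitian :=
  cfc_predicate Real.log A

theorem abs_entry_le_norm (A : Matrix (Fin d) (Fin d) ℝ) (i j : Fin d) : |A i j| ≤ ‖A‖ := by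
  have h : A i j = inner ℝ (EuclideanSpace.single i (1 : ℝ))
      (Matrix.toEuclideanCLM (𝕜 := ℝ) A (EuclideanSpace.single j (1 : ℝ))) := by
    rw [EuclideanSpace.inner_single_left]
    simp
  rw [h, Matrix.cstar_norm_def]
  refine (abs_real_inner_le_norm _ _).trans ?_
  have h2 := (Matrix.toEuclideanCLM (𝕜 := ℝ) A).le_opNorm (EuclideanSpace.single j (1 : ℝ))
  simpa using h2

theorem spectrum_subset_of_mem_shell {lo hi : ℝ} {S : SPD d} (hS : S ∈ shell d lo hi) :
    spectrum ℝ S.1 ⊆ Set.Icc lo hi := by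
  have hH := S.2.isHermitian
  rw [hH.spectrum_real_eq_range_eigenvalues]
  rintro _ ⟨i, rfl⟩
  have h4 := hH.eigenvalues_eq i
  have hv := dotProduct_self_eq_norm_sq (hH.eigenvectorBasis i)
  rw [hH.eigenvectorBasis.orthonormal.1 i] at hv
  have h1 := hS.1.dotProduct_mulVec_nonneg (hH.eigenvectorBasis i).ofLp
  have h2 := hS.2.dotProduct_mulVec_nonneg (hH.eigenvectorBasis i).ofLp
  simp only [Matrix.sub_mulVec, dotProduct_sub, Matrix.smul_mulVec, Matrix.one_mulVec,
    dotProduct_smul, smul_eq_mul, star_trivial, hv, RCLike.re_to_real] at h1 h2 h4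
  rw [← h4] at h1 h2
  constructor <;> linarith

/-- The spectrum lies in `[lo, hi]`, so the logarithm has bounded operator norm. In the chart, only
the location coordinates of the search region are unbounded. -/
theorem exists_vech_log_le {lo hi : ℝ} (hlo : 0 < lo) : ∃ C, ∀ S ∈ shell d lo hi, ∀ p : LowerIdx d,
    |vech (cfc Real.log S.1) p| ≤ C := by
  refine ⟨max |Real.log lo| |Real.log hi|, fun S hS p => (abs_entry_le_norm _ _ _).trans ?_⟩
  refine norm_cfc_le (le_max_of_le_left (abs_nonneg _)) fun x hx => ?_
  obtain ⟨h1, h2⟩ := spectrum_subset_of_mem_shell hS hx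
  have hx0 : 0 < x := hlo.trans_le h1
  have h3 := Real.log_le_log hlo h1
  have h4 := Real.log_le_log hx0 h2
  rw [Real.norm_eq_abs, abs_le]
  constructor
  · linarith [neg_abs_le (Real.log lo), le_max_left |Real.log lo| |Real.log hi|]
  · linarith [le_abs_self (Real.log hi), le_max_right |Real.log lo| |Real.log hi|]

/-- `mat` as a linear map. -/
def matₗ (d : ℕ) : (LowerIdx d → ℝ) →ₗ[ℝ] Matrix (Fin d) (Fin d) ℝ where
  toFun := mat
  map_add' _ _ := by ext; simp [mat]
  map_smul' _ _ := by ext; simp [mat]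

/-- The scalar `c` covers the covariance (`c = 1`) and its inverse (`c = -1`) together. -/
theorem contDiff_exp_mat_entry (c : ℝ) (i j : Fin d) {n : ℕ∞} :
    ContDiff ℝ n fun ϑ : Param d => NormedSpace.exp (c • mat fun p => ϑ (Sum.inr p)) i j := by
  have h1 : ContDiff ℝ n (NormedSpace.exp : Matrix (Fin d) (Fin d) ℝ → Matrix (Fin d) (Fin d) ℝ) :=
    contDiff_iff_contDiffAt.2 fun x => (NormedSpace.exp_analytic (𝕂 := ℝ) x).contDiffAt
  have h2 : ContDiff ℝ n fun ϑ : Param d => fun p : LowerIdx d => ϑ (Sum.inr p) := by fun_prop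
  have h3 : ContDiff ℝ n (matₗ d) :=
    (LinearMap.toContinuousLinearMap (matₗ d)).contDiff
  have h4 : ContDiff ℝ n fun A : Matrix (Fin d) (Fin d) ℝ => A i j :=
    (LinearMap.toContinuousLinearMap
      (Matrix.entryLinearMap ℝ ℝ i j : Matrix (Fin d) (Fin d) ℝ →ₗ[ℝ] ℝ)).contDiff
  have h5 : ContDiff ℝ n fun ϑ : Param d => c • mat fun p : LowerIdx d => ϑ (Sum.inr p) :=
    (h3.comp h2).const_smul c
  exact h4.comp (h1.comp h5)

theorem exp_inv (A : Matrix (Fin d) (Fin d) ℝ) :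
    (NormedSpace.exp A)⁻¹ = NormedSpace.exp ((-1 : ℝ) • A) := by
  rw [neg_one_smul, Matrix.exp_neg]

end MatrixLog

/-! ### The chart -/

section Chart

variable {μ₀ : Hyp d} {Φ : EuclideanSpace ℝ (Fin d) ≃ₗ[ℝ] tangentSpace μ₀}

theorem mat_vech {A : Matrix (Fin d) (Fin d) ℝ} (hA : A.IsHermitian) : mat (vech A) = A := by
  ext i j
  have h : A j i = A i j := by simpa using congrFun (congrFun hA i) j
  rcases le_total i j with hij | hij
  · simp [mat, vech, max_eq_right hij, min_eq_left hij, h]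
  · simp [mat, vech, max_eq_left hij, min_eq_right hij]

theorem vech_mat (β : LowerIdx d → ℝ) : vech (mat β) = β := by
  funext p
  have := p.2
  simp [mat, vech, max_eq_left this, min_eq_right this]

theorem chartInv_chart (θ : Hyp d × SPD d) : chartInv μ₀ Φ (chart μ₀ Φ θ) = θ := by
  refine Prod.ext ?_ (Subtype.ext ?_)
  · simp [chartInv, chart, expMap_logMap]
  · simp [chartInv, chart, mat_vech (cfc_log_isHermitian θ.2.1), exp_cfc_log]

theorem chart_chartInv (ϑ : Param d) : chart μ₀ Φ (chartInv μ₀ Φ ϑ) = ϑ := by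
  ext i
  rcases i with i | p
  · simp [chartInv, chart, logMap_expMap]
  · simp [chartInv, chart, cfc_log_exp (mat_isHermitian _), vech_mat]

/-- The location coordinate of a parameter. -/
def locPart (d : ℕ) : Param d →L[ℝ] EuclideanSpace ℝ (Fin d) :=
  (EuclideanSpace.equiv (Fin d) ℝ).symm.toContinuousLinearMap.comp
    (ContinuousLinearMap.pi fun i => EuclideanSpace.proj (Sum.inl i))

theorem locPart_apply (ϑ : Param d) : locPart d ϑ = WithLp.toLp 2 fun i => ϑ (Sum.inl i) := rfl

/-- The spatial part of a tangent vector given in the chart. -/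
def tangentSpatial (Φ : EuclideanSpace ℝ (Fin d) ≃ₗ[ℝ] tangentSpace μ₀) :
    EuclideanSpace ℝ (Fin d) →L[ℝ] EuclideanSpace ℝ (Fin d) :=
  LinearMap.toContinuousLinearMap
    { toFun := fun v => spatialPart (Φ v).1
      map_add' := fun v w => by simp [spatialPart_add]
      map_smul' := fun c v => by simp [spatialPart_smul] }

/-- The spatial part of the location parameter. -/
def locSpatial (Φ : EuclideanSpace ℝ (Fin d) ≃ₗ[ℝ] tangentSpace μ₀) (ϑ : Param d) :
    EuclideanSpace ℝ (Fin d) :=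
  height (sinhMap (locPart d ϑ)) • spatial μ₀ +
    sinhcSq (‖locPart d ϑ‖ ^ 2) • tangentSpatial Φ (locPart d ϑ)

theorem spatial_chartInv (hΦ : ∀ v, tnorm (Φ v) = ‖v‖) (ϑ : Param d) :
    spatial (chartInv μ₀ Φ ϑ).1 = locSpatial Φ ϑ := by
  simp only [chartInv, expMap, spatial, ← locPart_apply]
  rw [spatialPart_add, spatialPart_smul, spatialPart_smul, hΦ, locSpatial, height_sinhMap]
  congr 1
  change _ = _ • spatialPart (Φ (locPart d ϑ)).1
  rcases eq_or_ne (locPart d ϑ) 0 with h | h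
  · rw [h]
    simp [spatialPart, ← Pi.zero_def]
  · have h0 : ‖locPart d ϑ‖ ≠ 0 := by simpa using h
    rw [← mul_sinhcSq, mul_div_cancel_left₀ _ h0]

theorem contDiff_locSpatial {n : ℕ∞} : ContDiff ℝ n (locSpatial Φ) := by
  have h1 : ContDiff ℝ n (locPart d) := (locPart d).contDiff
  refine ((contDiff_height.comp (contDiff_sinhMap.comp h1)).smul contDiff_const).add ?_
  exact (contDiff_sinhcSq.comp ((contDiff_norm_sq ℝ).comp h1)).smul
    ((tangentSpatial Φ).contDiff.comp h1)

theorem coe_chartInv_snd (ϑ : Param d) :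
    (chartInv μ₀ Φ ϑ).2.1 = NormedSpace.exp ((1 : ℝ) • mat fun p => ϑ (Sum.inr p)) := by
  simp [chartInv]

theorem continuous_chartInv (hΦ : ∀ v, tnorm (Φ v) = ‖v‖) : Continuous (chartInv μ₀ Φ) := by
  refine Continuous.prodMk ?_ (Continuous.subtype_mk (continuous_matrix fun i j => ?_) _)
  · have h : (fun ϑ => (chartInv μ₀ Φ ϑ).1) = fun ϑ => ofSpatial (locSpatial Φ ϑ) := by
      funext ϑ
      rw [← spatial_chartInv hΦ, ofSpatial_spatial]
    exact h ▸ continuous_ofSpatial.comp (contDiff_locSpatial (n := 0)).continuous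
  · simpa using (contDiff_exp_mat_entry (1 : ℝ) i j (n := 0)).continuous

/-- Only the inverse chart is known to be continuous. Being injective and continuous between
suitable spaces, it is a measurable embedding (Lusin–Souslin), and preimages under the chart are
images under its inverse. -/
theorem measurable_chart (hΦ : ∀ v, tnorm (Φ v) = ‖v‖) : Measurable (chart μ₀ Φ) := by
  have hemb := (continuous_chartInv (μ₀ := μ₀) hΦ).measurableEmbedding
    (Function.LeftInverse.injective (chart_chartInv (μ₀ := μ₀) (Φ := Φ)))
  intro s hs
  have h : chart μ₀ Φ ⁻¹' s = chartInv μ₀ Φ '' s := by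
    ext θ
    constructor
    · intro h
      exact ⟨chart μ₀ Φ θ, h, chartInv_chart θ⟩
    · rintro ⟨ϑ, hϑ, rfl⟩
      rwa [Set.mem_preimage, chart_chartInv]
  rw [h]
  exact hemb.measurableSet_image.2 hs

theorem norm_locPart_chart (hΦ : ∀ v, tnorm (Φ v) = ‖v‖) (θ : Hyp d × SPD d) :
    ‖locPart d (chart μ₀ Φ θ)‖ = hdist μ₀ θ.1 := by
  rw [← hΦ, ← tnorm_logMap]
  congr 1
  simp [locPart_apply, chart]

end Chart

/-! ### A representation of the log-density of temperate growth -/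

theorem hasTemperateGrowth_height :
    (height : EuclideanSpace ℝ (Fin d) → ℝ).HasTemperateGrowth := by
  have h := Function.hasTemperateGrowth_one_add_norm_sq_rpow (EuclideanSpace ℝ (Fin d)) (1 / 2)
  have h2 : (height : EuclideanSpace ℝ (Fin d) → ℝ) = fun y => (1 + ‖y‖ ^ 2) ^ (1 / 2 : ℝ) := by
    funext y
    simp only [height, Real.sqrt_eq_rpow]
  rwa [h2]

variable {μ₀ : Hyp d} {Φ : EuclideanSpace ℝ (Fin d) ≃ₗ[ℝ] tangentSpace μ₀}

/-- Temperate growth in `ϑ` is not available from the hyperbolic and matrix exponentials, so each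
smooth `ϑ`-dependent ingredient is multiplied by a bump function equal to `1` on the given ball. The
explicit formula is then reassembled from temperate pieces. -/
theorem exists_temperate_logDensity (hΦ : ∀ v, tnorm (Φ v) = ‖v‖) (R : ℝ) :
    ∃ F : Param d × EuclideanSpace ℝ (Fin d) → ℝ, F.HasTemperateGrowth ∧
      ∀ ϑ : Param d, ‖ϑ‖ ≤ R → ∀ x : Hyp d,
        logDensity (chartInv μ₀ Φ ϑ).1 (chartInv μ₀ Φ ϑ).2 x = F (ϑ, spatial x) := by
  let χ : ContDiffBump (0 : Param d) := ⟨max R 1, max R 1 + 1, by positivity, by linarith⟩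
  have hfst : (fun p : Param d × EuclideanSpace ℝ (Fin d) => p.1).HasTemperateGrowth :=
    (ContinuousLinearMap.fst ℝ (Param d) (EuclideanSpace ℝ (Fin d))).hasTemperateGrowth
  have hcut : ∀ {V : Type} [NormedAddCommGroup V] [NormedSpace ℝ V] {g : Param d → V},
      ContDiff ℝ ∞ g → (fun p : Param d × EuclideanSpace ℝ (Fin d) =>
        χ p.1 • g p.1).HasTemperateGrowth := by
    intro V _ _ g hg
    have h1 : (fun ϑ => χ ϑ • g ϑ).HasTemperateGrowth :=
      HasCompactSupport.hasTemperateGrowth (χ.hasCompactSupport.smul_right) (χ.contDiff.smul hg)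
    exact h1.comp hfst
  have hsnd : (fun p : Param d × EuclideanSpace ℝ (Fin d) => p.2).HasTemperateGrowth :=
    (ContinuousLinearMap.snd ℝ (Param d) (EuclideanSpace ℝ (Fin d))).hasTemperateGrowth
  have hU := hcut (contDiff_locSpatial (Φ := Φ) (n := ⊤))
  set U : Param d × EuclideanSpace ℝ (Fin d) → EuclideanSpace ℝ (Fin d) :=
    fun p => χ p.1 • locSpatial Φ p.1
  have hhU : (fun p => height (U p)).HasTemperateGrowth := hasTemperateGrowth_height.comp hU
  have hhy : (fun p : Param d × EuclideanSpace ℝ (Fin d) => height p.2).HasTemperateGrowth :=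
    hasTemperateGrowth_height.comp hsnd
  have ht : (fun p : Param d × EuclideanSpace ℝ (Fin d) => coshDist (U p) p.2).HasTemperateGrowth :=
    (hhU.mul hhy).sub ((innerSL ℝ).bilinear_hasTemperateGrowth (𝕜 := ℝ) hU hsnd)
  -- Cutting off the spatial part before forming the Lorentz product matters: the result is still
  -- the product of two points of the hyperboloid, so it stays in the domain where `ratio` and `log`
  -- are controlled.
  have ht1 : ∀ p : Param d × EuclideanSpace ℝ (Fin d), 1 ≤ coshDist (U p) p.2 :=
    fun p => one_le_coshDist _ _
  have hr := hasTemperateGrowth_ratio_comp ht ht1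
  have hlr := hasTemperateGrowth_log_ratio_comp ht ht1
  have hdetc : ContDiff ℝ ∞ fun ϑ : Param d => Real.log (chartInv μ₀ Φ ϑ).2.1.det := by
    refine ContDiff.log ?_ fun ϑ => (chartInv μ₀ Φ ϑ).2.2.det_pos.ne'
    simp only [coe_chartInv_snd, Matrix.det_apply']
    refine ContDiff.sum fun σ _ => contDiff_const.mul (contDiff_prod fun i _ => ?_)
    exact contDiff_exp_mat_entry 1 _ _
  have hld := hcut hdetc
  have hq : ContDiff ℝ ∞ fun ϑ : Param d => (1 + height (locSpatial Φ ϑ))⁻¹ := by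
    refine ContDiff.inv (contDiff_const.add (contDiff_height.comp contDiff_locSpatial)) fun ϑ => ?_
    linarith [height_pos (locSpatial Φ ϑ)]
  have hq' := hcut hq
  have hP : ∀ i j : Fin d, ContDiff ℝ ∞ fun ϑ : Param d => (chartInv μ₀ Φ ϑ).2.1⁻¹ i j := by
    intro i j
    simp only [coe_chartInv_snd, one_smul, exp_inv]
    exact contDiff_exp_mat_entry (-1) i j
  have hA : (fun p : Param d × EuclideanSpace ℝ (Fin d) =>
      p.2 - ((coshDist (U p) p.2 + height p.2) *
      (χ p.1 • (1 + height (locSpatial Φ p.1))⁻¹)) • U p).HasTemperateGrowth :=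
    hsnd.sub (((ht.add hhy).mul hq').smul hU)
  set A : Param d × EuclideanSpace ℝ (Fin d) → EuclideanSpace ℝ (Fin d) :=
    fun p => p.2 - ((coshDist (U p) p.2 + height p.2) *
      (χ p.1 • (1 + height (locSpatial Φ p.1))⁻¹)) • U p
  have hAi : ∀ i, (fun p => A p i).HasTemperateGrowth := fun i =>
    (EuclideanSpace.proj i : EuclideanSpace ℝ (Fin d) →L[ℝ] ℝ).hasTemperateGrowth.comp hA
  have hquad : (fun p => ∑ i, ∑ j, A p i * ((χ p.1 • (chartInv μ₀ Φ p.1).2.1⁻¹ i j) * A p j)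
      ).HasTemperateGrowth :=
    .sum fun i _ => .sum fun j _ => (hAi i).mul ((hcut (hP i j)).mul (hAi j))
  refine ⟨_, ((((Function.HasTemperateGrowth.const (-(1 / 2) : ℝ)).mul hld).sub
    ((Function.HasTemperateGrowth.const (1 / 2 : ℝ)).mul ((hr.pow 2).mul hquad))).add
    ((Function.HasTemperateGrowth.const ((d : ℝ) - 1)).mul hlr)), fun ϑ hϑ x => ?_⟩
  have hχ : χ ϑ = 1 := χ.one_of_mem_closedBall (by
    rw [mem_closedBall_zero_iff]
    exact hϑ.trans (le_max_left R 1))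
  have hU1 : U (ϑ, spatial x) = locSpatial Φ ϑ := by simp [U, hχ]
  have hA1 : A (ϑ, spatial x) = unboost (locSpatial Φ ϑ) (spatial x) := by
    simp only [A, hU1, hχ, one_smul, unboost, div_eq_mul_inv]
  rw [logDensity_eq, coord_eq, spatial_chartInv hΦ]
  simp only [Pi.add_apply, Pi.sub_apply, Pi.mul_apply, Pi.pow_apply, hχ, hU1, hA1,
    smul_eq_mul, one_mul]
  congr 3
  simp only [WithLp.ofLp_smul, dotProduct, Matrix.mulVec, Finset.mul_sum, Pi.smul_apply,
    smul_eq_mul]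
  refine Finset.sum_congr rfl fun i _ => Finset.sum_congr rfl fun j _ => ?_
  ring

end HypWN

namespace HypWN


/-! ### Partial derivatives of functions of temperate growth -/

section Temperate

variable {E F V : Type*} [NormedAddCommGroup E] [NormedSpace ℝ E] [NormedAddCommGroup F]
  [NormedSpace ℝ F] [NormedAddCommGroup V] [NormedSpace ℝ V]

theorem hasTemperateGrowth_fderiv {f : E → V} (hf : f.HasTemperateGrowth) :
    (fderiv ℝ f).HasTemperateGrowth := by
  refine ⟨hf.1.fderiv_right (by simp), fun n => ?_⟩
  obtain ⟨k, C, h⟩ := hf.2 (n + 1)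
  exact ⟨k, C, fun x => by rw [norm_iteratedFDeriv_fderiv]; exact h x⟩

/-- The partial derivative in the first variable. -/
def partialFst (f : E × F → V) (p : E × F) : E →L[ℝ] V :=
  (fderiv ℝ f p).comp (ContinuousLinearMap.inl ℝ E F)

theorem hasTemperateGrowth_partialFst {f : E × F → V} (hf : f.HasTemperateGrowth) :
    (partialFst f).HasTemperateGrowth :=
  (((ContinuousLinearMap.compL ℝ E (E × F) V).flip
    (ContinuousLinearMap.inl ℝ E F)).hasTemperateGrowth).comp (hasTemperateGrowth_fderiv hf)

theorem hasFDerivAt_partialFst {f : E × F → V} (hf : f.HasTemperateGrowth) (x : E) (y : F) :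
    HasFDerivAt (fun x => f (x, y)) (partialFst f (x, y)) x :=
  ((hf.1.differentiable (by simp)) (x, y)).hasFDerivAt.comp x (hasFDerivAt_prodMk_left x y)

/-- Passage from temperate growth to the form used with `integrable_height_pow`, uniformly over a
bounded set of the first variable. -/
theorem exists_norm_le_height_pow {d : ℕ} {f : E × EuclideanSpace ℝ (Fin d) → V}
    (hf : f.HasTemperateGrowth) (R : ℝ) :
    ∃ (C : ℝ) (N : ℕ), 0 ≤ C ∧ ∀ x, ‖x‖ ≤ R → ∀ y, ‖f (x, y)‖ ≤ C * height y ^ N := by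
  obtain ⟨N, C, hC, h⟩ := hf.norm_iteratedFDeriv_le_uniform 0
  refine ⟨C * (2 * (1 + |R|)) ^ N, N, by positivity, fun x hx y => ?_⟩
  have h1 := h 0 le_rfl (x, y)
  rw [norm_iteratedFDeriv_zero] at h1
  refine h1.trans ?_
  rw [mul_assoc, ← mul_pow]
  have h2 : ‖(x, y)‖ ≤ |R| + ‖y‖ := by
    rw [Prod.norm_def]
    exact max_le (by linarith [le_abs_self R, norm_nonneg y]) (by linarith [abs_nonneg R])
  have h3 := norm_le_height y
  have h4 := one_le_height y
  gcongr
  nlinarith [abs_nonneg R]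

end Temperate

/-! ### The multivariate central limit theorem -/

section CentralLimit

variable {Ω : Type*} [MeasurableSpace Ω] {P : Measure Ω}

theorem charFun_map_inner {E : Type*} [NormedAddCommGroup E] [InnerProductSpace ℝ E]
    [MeasurableSpace E] [BorelSpace E] [SecondCountableTopology E] {V : Ω → E}
    (hV : AEMeasurable V P) (t : E) :
    charFun (P.map V) t = charFun (P.map fun ω => inner ℝ t (V ω)) 1 := by
  have h2 : AEMeasurable (fun ω => inner ℝ t (V ω)) P :=
    (continuous_const.inner continuous_id).measurable.comp_aemeasurable hV
  rw [charFun_apply, charFun_apply, integral_map hV (by fun_prop), integral_map h2 (by fun_prop)]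
  refine integral_congr_ae (.of_forall fun ω => ?_)
  simp [real_inner_comm]

/-- The Cramér–Wold device through characteristic functions: the value at `t` is that of the scalar
projection along `t` at `1`, where the one-dimensional theorem applies. -/
theorem tendstoInDistribution_inv_sqrt_smul_sum [IsProbabilityMeasure P]
    {ι : Type*} [Fintype ι] [DecidableEq ι]
    {Z : ℕ → Ω → EuclideanSpace ℝ ι} {S : Matrix ι ι ℝ} (hS : S.PosSemidef)
    (hZ : MemLp (Z 0) 2 P) (hindep : iIndepFun Z P)
    (hident : ∀ i, IdentDistrib (Z i) (Z 0) P P)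
    (hmean : ∀ t, ∫ ω, inner ℝ t (Z 0 ω) ∂P = 0)
    (hcov : ∀ t, ∫ ω, inner ℝ t (Z 0 ω) ^ 2 ∂P = t.ofLp ⬝ᵥ S *ᵥ t.ofLp) :
    TendstoInDistribution (fun (n : ℕ) ω => (√(n : ℝ))⁻¹ • ∑ i ∈ Finset.range n, Z i ω) atTop id
      (fun _ => P) (multivariateGaussian 0 S) := by
  have hm : ∀ n : ℕ, AEMeasurable (fun ω => (√(n : ℝ))⁻¹ • ∑ i ∈ Finset.range n, Z i ω) P :=
    fun n => AEMeasurable.fun_const_smul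
      (Finset.aemeasurable_fun_sum _ fun i _ => (hident i).aemeasurable_fst) _
  refine ⟨hm, aemeasurable_id, ?_⟩
  refine ProbabilityMeasure.tendsto_iff_tendsto_charFun.2 fun t => ?_
  have hmt : Measurable fun z : EuclideanSpace ℝ ι => inner ℝ t z :=
    (continuous_const.inner continuous_id).measurable
  have hLp : MemLp (fun ω => inner ℝ t (Z 0 ω)) 2 P := hZ.const_inner t
  have hvar : Var[fun ω => inner ℝ t (Z 0 ω); P] = t.ofLp ⬝ᵥ S *ᵥ t.ofLp := by
    rw [variance_of_integral_eq_zero hLp.aestronglyMeasurable.aemeasurable (hmean t), ← hcov t]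
  have hclt := tendstoInDistribution_inv_sqrt_mul_sum_sub (P := P)
    (X := fun i ω => inner ℝ t (Z i ω)) (Y := id)
    (P' := gaussianReal 0 Var[fun ω => inner ℝ t (Z 0 ω); P].toNNReal) ⟨aemeasurable_id, by simp⟩
    hLp (hindep.comp (fun _ z => inner ℝ t z) fun _ => hmt) fun i => (hident i).comp hmt
  have h := ProbabilityMeasure.tendsto_iff_tendsto_charFun.1 hclt.tendsto 1
  have h0 : 0 ≤ t.ofLp ⬝ᵥ S *ᵥ t.ofLp := by
    rw [← hcov t]
    exact integral_nonneg fun ω => sq_nonneg _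
  simp only [ProbabilityMeasure.coe_mk, Measure.map_id] at h ⊢
  rw [charFun_multivariateGaussian hS]
  rw [charFun_gaussianReal, hvar, hmean, Real.coe_toNNReal _ h0] at h
  convert h using 2 with n
  · rw [charFun_map_inner (hm n)]
    congr 2
    funext ω
    simp [inner_smul_right, inner_sum]
  · simp

end CentralLimit

/-! ### Consistency and asymptotic linearity of M-estimators -/

section MEstimators

variable {Ω : Type*} [MeasurableSpace Ω] {P : Measure Ω} {𝓧 : Type*} [MeasurableSpace 𝓧]
  {ν : Measure 𝓧} {X : ℕ → Ω → 𝓧}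

theorem strong_law_comp {F : Type*} [NormedAddCommGroup F] [NormedSpace ℝ F] [CompleteSpace F]
    [MeasurableSpace F] [BorelSpace F] (hX : ∀ i, HasLaw (X i) ν P) (hindep : iIndepFun X P)
    {f : 𝓧 → F} (hf : Integrable f ν) :
    ∀ᵐ ω ∂P, Tendsto (fun n : ℕ => (n : ℝ)⁻¹ • ∑ i ∈ Finset.range n, f (X i ω)) atTop
      (𝓝 (∫ x, f x ∂ν)) := by
  have hfm : ∀ i, AEMeasurable f (P.map (X i)) := fun i => by
    rw [(hX i).map_eq]
    exact hf.aestronglyMeasurable.aemeasurable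
  have hid : ∀ i, IdentDistrib (X i) (X 0) P P := fun i =>
    ⟨(hX i).aemeasurable, (hX 0).aemeasurable, by rw [(hX i).map_eq, (hX 0).map_eq]⟩
  have h := strong_law_ae (μ := P) (fun i => f ∘ X i)
    (Integrable.comp_aemeasurable (by rwa [(hX 0).map_eq]) (hX 0).aemeasurable)
    (fun i j hij => (hindep.comp₀ (fun _ => f) (fun i => (hX i).aemeasurable) hfm).indepFun hij)
    (fun i => (hid i).comp_of_aemeasurable (hfm i))
  rwa [show P[f ∘ X 0] = ∫ x, f x ∂ν from (hX 0).integral_comp hf.aestronglyMeasurable] at h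

theorem eventually_sum_lt_sum (hX : ∀ i, HasLaw (X i) ν P) (hindep : iIndepFun X P)
    {u v : 𝓧 → ℝ} (hu : Integrable u ν) (hv : Integrable v ν) (huv : ∫ x, u x ∂ν < ∫ x, v x ∂ν) :
    ∀ᵐ ω ∂P, ∀ᶠ n : ℕ in atTop,
      ∑ i ∈ Finset.range n, u (X i ω) < ∑ i ∈ Finset.range n, v (X i ω) := by
  filter_upwards [strong_law_comp hX hindep hu, strong_law_comp hX hindep hv] with ω h1 h2
  filter_upwards [h1.eventually_lt h2 huv, eventually_gt_atTop 0] with n h hn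
  have : (0 : ℝ) < (n : ℝ)⁻¹ := by positivity
  exact lt_of_mul_lt_mul_left h this.le

/-- Wald's argument. Around each wrong parameter a small ball has an envelope `m ϑ + r |L|` whose
mean is still below that of `m ϑ₀`. Finitely many such balls cover the compact region `‖ϑ‖ ≤ R` away
from `ϑ₀`, and `b` is the envelope beyond it. The strong law then excludes all these regions for
large `n`. -/
theorem ae_tendsto_of_identifiable {E : Type*} [NormedAddCommGroup E] [ProperSpace E]
    (hX : ∀ i, HasLaw (X i) ν P) (hindep : iIndepFun X P) {m : E → 𝓧 → ℝ} {ϑ₀ : E}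
    (hint : ∀ ϑ, Integrable (m ϑ) ν)
    (hlip : ∀ R, ∃ L : 𝓧 → ℝ, Integrable L ν ∧ ∀ ϑ ϑ', ‖ϑ‖ ≤ R → ‖ϑ'‖ ≤ R → ∀ x,
      |m ϑ x - m ϑ' x| ≤ L x * ‖ϑ - ϑ'‖)
    (hid : ∀ ϑ, ϑ ≠ ϑ₀ → ∫ x, m ϑ x ∂ν < ∫ x, m ϑ₀ x ∂ν) {Θ : Set E} {R : ℝ} {b : 𝓧 → ℝ}
    (hb : Integrable b ν) (hout : ∀ ϑ ∈ Θ, R < ‖ϑ‖ → ∀ x, m ϑ x ≤ b x)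
    (hbint : ∫ x, b x ∂ν < ∫ x, m ϑ₀ x ∂ν) {θ : ℕ → Ω → E}
    (hθ : ∀ᵐ ω ∂P, ∀ᶠ n : ℕ in atTop, θ n ω ∈ Θ ∧
      ∑ i ∈ Finset.range n, m ϑ₀ (X i ω) ≤ ∑ i ∈ Finset.range n, m (θ n ω) (X i ω)) :
    ∀ᵐ ω ∂P, Tendsto (fun n => θ n ω) atTop (𝓝 ϑ₀) := by
  -- Only countably many radii are used, so that the exceptional null sets can be united.
  suffices h : ∀ k : ℕ, ∀ᵐ ω ∂P, ∀ᶠ n : ℕ in atTop, dist (θ n ω) ϑ₀ < 1 / ((k : ℝ) + 1) by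
    filter_upwards [ae_all_iff.2 h] with ω hω
    rw [Metric.tendsto_nhds]
    intro ε hε
    obtain ⟨k, hk⟩ := exists_nat_one_div_lt hε
    filter_upwards [hω k] with n hn using hn.trans hk
  intro k
  set ε : ℝ := 1 / ((k : ℝ) + 1)
  have hε : 0 < ε := by positivity
  obtain ⟨L, hL, hLm⟩ := hlip R
  have hL' : Integrable (fun x => |L x|) ν := hL.abs
  have hK : IsCompact (Metric.closedBall (0 : E) R \ Metric.ball ϑ₀ ε) :=
    (isCompact_closedBall 0 R).diff Metric.isOpen_ball
  have hr : ∀ ϑ : E, ∃ r : ℝ, 0 < r ∧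
      (ϑ ≠ ϑ₀ → ∫ x, (m ϑ x + r * |L x|) ∂ν < ∫ x, m ϑ₀ x ∂ν) := by
    intro ϑ
    by_cases hϑ : ϑ = ϑ₀
    · exact ⟨1, one_pos, fun h => absurd hϑ h⟩
    have hI : 0 ≤ ∫ x, |L x| ∂ν := integral_nonneg fun x => abs_nonneg _
    have hgap := sub_pos.2 (hid ϑ hϑ)
    -- The radius spends strictly less than the gap in means; the `+ 1` guards against a vanishing
    -- integral of `|L|`.
    refine ⟨(∫ x, m ϑ₀ x ∂ν - ∫ x, m ϑ x ∂ν) / (∫ x, |L x| ∂ν + 1), by positivity, fun _ => ?_⟩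
    rw [integral_add (hint ϑ) (hL'.const_mul _), integral_const_mul]
    have : (∫ x, m ϑ₀ x ∂ν - ∫ x, m ϑ x ∂ν) / (∫ x, |L x| ∂ν + 1) * ∫ x, |L x| ∂ν <
        ∫ x, m ϑ₀ x ∂ν - ∫ x, m ϑ x ∂ν := by
      rw [div_mul_eq_mul_div, div_lt_iff₀ (by positivity)]
      nlinarith
    linarith
  choose r hr0 hr using hr
  obtain ⟨t, htK, ht⟩ := hK.elim_nhds_subcover (fun ϑ => Metric.ball ϑ (r ϑ))
    fun ϑ _ => Metric.ball_mem_nhds ϑ (hr0 ϑ)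
  have hnet : ∀ᵐ ω ∂P, ∀ ϑ ∈ t, ∀ᶠ n : ℕ in atTop,
      ∑ i ∈ Finset.range n, (m ϑ (X i ω) + r ϑ * |L (X i ω)|) <
        ∑ i ∈ Finset.range n, m ϑ₀ (X i ω) := by
    rw [Finset.eventually_all]
    intro ϑ hϑ
    refine eventually_sum_lt_sum hX hindep ((hint ϑ).add (hL'.const_mul _)) (hint ϑ₀)
      (hr ϑ ?_)
    rintro rfl
    exact (htK _ hϑ).2 (Metric.mem_ball_self hε)
  filter_upwards [hθ, hnet, eventually_sum_lt_sum hX hindep hb (hint ϑ₀) hbint] with ω h1 h2 h3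
  filter_upwards [h1, (Finset.eventually_all t).2 h2, h3] with n h1 h2 h3
  by_contra hfar
  rcases lt_or_ge R ‖θ n ω‖ with hR | hR
  · have := Finset.sum_le_sum fun i (_ : i ∈ Finset.range n) => hout _ h1.1 hR (X i ω)
    linarith [h1.2]
  · have hmem : θ n ω ∈ Metric.closedBall (0 : E) R \ Metric.ball ϑ₀ ε :=
      ⟨by simpa using hR, hfar⟩
    obtain ⟨ϑ, hϑ, hball⟩ := Set.mem_iUnion₂.1 (ht hmem)
    have hϑR : ‖ϑ‖ ≤ R := by simpa using (htK ϑ hϑ).1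
    have := Finset.sum_le_sum fun i (_ : i ∈ Finset.range n) =>
      show m (θ n ω) (X i ω) ≤ m ϑ (X i ω) + r ϑ * |L (X i ω)| by
        have h4 := (le_abs_self _).trans (hLm _ _ hR hϑR (X i ω))
        have h5 : ‖θ n ω - ϑ‖ ≤ r ϑ := by
          rw [← dist_eq_norm]
          exact (Metric.mem_ball.1 hball).le
        have h6 : L (X i ω) * ‖θ n ω - ϑ‖ ≤ |L (X i ω)| * r ϑ :=
          mul_le_mul (le_abs_self _) h5 (norm_nonneg _) (abs_nonneg _)
        linarith
    linarith [h1.2, h2 ϑ hϑ]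

variable {E : Type*} [NormedAddCommGroup E] [MeasurableSpace E] [BorelSpace E]

/-- The limit law is tight, and the portmanteau theorem on the closed set `{M + 1 ≤ ‖z‖}` transfers
the tail bound to the sequence. -/
theorem exists_eventually_measure_norm_ge_le [IsProbabilityMeasure P] [ProperSpace E]
    {V : ℕ → Ω → E} {Q : Measure E}
    [IsProbabilityMeasure Q] (hV : TendstoInDistribution V atTop id (fun _ => P) Q)
    {ε : ENNReal} (hε : 0 < ε) :
    ∃ M : ℝ, 0 < M ∧ ∀ᶠ n in atTop, P {ω | M ≤ ‖V n ω‖} < ε := by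
  have h1 := tendsto_measure_norm_gt_of_isTightMeasureSet (isTightMeasureSet_singleton (μ := Q))
  simp only [Set.mem_singleton_iff, iSup_iSup_eq_left] at h1
  obtain ⟨M, hM, hM0⟩ := ((h1.eventually_lt_const hε).and (eventually_gt_atTop 0)).exists
  refine ⟨M + 1, by linarith, ?_⟩
  have hcl : IsClosed {z : E | M + 1 ≤ ‖z‖} := isClosed_le continuous_const continuous_norm
  have h2 := ProbabilityMeasure.limsup_measure_closed_le_of_tendsto hV.tendsto hcl
  simp only [ProbabilityMeasure.coe_mk, Measure.map_id] at h2
  have h3 : Q {z : E | M + 1 ≤ ‖z‖} < ε :=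
    (measure_mono fun z (hz : M + 1 ≤ ‖z‖) => show M < ‖z‖ by linarith).trans_lt hM
  filter_upwards [eventually_lt_of_limsup_lt (h2.trans_lt h3)] with n hn
  rwa [Measure.map_apply_of_aemeasurable (hV.forall_aemeasurable n) hcl.measurableSet] at hn

/-- The rule `o(1) · O_p(1) = o_p(1)`. The quotient `‖Y‖ / (1 + ‖V‖)` tends to zero almost surely,
and off the unlikely event `M ≤ ‖V‖` a large `‖Y‖` makes this quotient at least `η / (1 + M)`. -/
theorem tendstoInMeasure_of_norm_le_mul [IsProbabilityMeasure P] [ProperSpace E]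
    {V Y : ℕ → Ω → E} {e : ℕ → Ω → ℝ}
    {Q : Measure E} [IsProbabilityMeasure Q]
    (hV : TendstoInDistribution V atTop id (fun _ => P) Q) (hY : ∀ n, AEMeasurable (Y n) P)
    (he : ∀ᵐ ω ∂P, Tendsto (fun n => e n ω) atTop (𝓝 0))
    (hYV : ∀ᵐ ω ∂P, ∀ᶠ n in atTop, ‖Y n ω‖ ≤ e n ω * ‖V n ω‖) :
    TendstoInMeasure P Y atTop fun _ => 0 := by
  have hquot : TendstoInMeasure P (fun n ω => ‖Y n ω‖ / (1 + ‖V n ω‖)) atTop fun _ => 0 := by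
    refine tendstoInMeasure_of_tendsto_ae (fun n => AEMeasurable.aestronglyMeasurable
      ((hY n).norm.div ((hV.forall_aemeasurable n).norm.const_add 1))) ?_
    filter_upwards [he, hYV] with ω h1 h2
    refine squeeze_zero' (.of_forall fun n => by positivity) ?_ (by simpa using h1.abs)
    filter_upwards [h2] with n hn
    rw [div_le_iff₀ (by positivity)]
    have := le_abs_self (e n ω)
    nlinarith [norm_nonneg (V n ω), abs_nonneg (e n ω)]
  rw [tendstoInMeasure_iff_norm] at hquot ⊢
  intro η hη
  rw [ENNReal.tendsto_nhds_zero]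
  intro ε hε
  obtain ⟨M, hM0, hM⟩ := exists_eventually_measure_norm_ge_le hV (ENNReal.half_pos hε.ne')
  have h2 := (ENNReal.tendsto_nhds_zero.1 (hquot (η / (1 + M)) (by positivity))) (ε / 2)
    (ENNReal.half_pos hε.ne')
  filter_upwards [hM, h2] with n h3 h4
  calc P {ω | η ≤ ‖Y n ω - 0‖}
      ≤ P ({ω | η / (1 + M) ≤ ‖‖Y n ω‖ / (1 + ‖V n ω‖) - 0‖} ∪ {ω | M ≤ ‖V n ω‖}) := by
        refine measure_mono fun ω hω => ?_
        by_cases hMV : M ≤ ‖V n ω‖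
        · exact Or.inr hMV
        refine Or.inl ?_
        simp only [Set.mem_ofPred_eq, sub_zero] at hω ⊢
        rw [Real.norm_of_nonneg (by positivity)]
        push Not at hMV
        gcongr
    _ ≤ ε / 2 + ε / 2 := (measure_union_le _ _).trans (add_le_add h4 h3.le)
    _ = ε := ENNReal.add_halves ε

/-- Expand the averaged estimating equation at `ϑ₀` and apply `A`, which is minus the inverse of the
mean derivative. With `h` the estimation error and `gbar` the mean score, this gives `‖h - A gbar‖ ≤
e_n ‖h‖`, where `e_n → 0` by the strong law and consistency. Once `e_n < 1/2`, `‖h‖ ≤ 2 ‖A gbar‖`,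
so the error is at most `2 e_n ‖A gbar‖`. No rate for the estimator has to be known beforehand. -/
theorem tendstoInMeasure_asymptotic_linearity [NormedSpace ℝ E] [IsProbabilityMeasure P]
    [FiniteDimensional ℝ E]
    (hX : ∀ i, HasLaw (X i) ν P)
    (hindep : iIndepFun X P) {g : E → 𝓧 → E} {H : 𝓧 → E →L[ℝ] E} {L : 𝓧 → ℝ} {ϑ₀ : E} {δ : ℝ}
    (hδ : 0 < δ) (hH : Integrable H ν) (hL : Integrable L ν)
    (hg : ∀ ϑ, ‖ϑ - ϑ₀‖ ≤ δ → ∀ x, ‖g ϑ x - g ϑ₀ x - H x (ϑ - ϑ₀)‖ ≤ L x * ‖ϑ - ϑ₀‖ ^ 2)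
    {A : E →L[ℝ] E} (hA : A.comp (∫ x, H x ∂ν) = -ContinuousLinearMap.id ℝ E)
    {θ : ℕ → Ω → E} (hθ : ∀ n, AEMeasurable (θ n) P)
    (hcons : ∀ᵐ ω ∂P, Tendsto (fun n => θ n ω) atTop (𝓝 ϑ₀))
    (hscore : ∀ᵐ ω ∂P, ∀ᶠ n : ℕ in atTop, ∑ i ∈ Finset.range n, g (θ n ω) (X i ω) = 0)
    {Q : Measure E} [IsProbabilityMeasure Q]
    (hclt : TendstoInDistribution
      (fun (n : ℕ) ω => A ((√(n : ℝ))⁻¹ • ∑ i ∈ Finset.range n, g ϑ₀ (X i ω))) atTop id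
      (fun _ => P) Q) :
    TendstoInMeasure P (fun (n : ℕ) ω => √(n : ℝ) • (θ n ω - ϑ₀) -
      A ((√(n : ℝ))⁻¹ • ∑ i ∈ Finset.range n, g ϑ₀ (X i ω))) atTop fun _ => 0 := by
  have : ProperSpace E := FiniteDimensional.proper ℝ E
  set J : E →L[ℝ] E := ∫ x, H x ∂ν
  set Hbar : ℕ → Ω → E →L[ℝ] E := fun n ω => (n : ℝ)⁻¹ • ∑ i ∈ Finset.range n, H (X i ω)
  set Lbar : ℕ → Ω → ℝ := fun n ω => (n : ℝ)⁻¹ • ∑ i ∈ Finset.range n, L (X i ω)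
  let e : ℕ → Ω → ℝ := fun n ω => ‖A‖ * (‖Hbar n ω - J‖ + Lbar n ω * ‖θ n ω - ϑ₀‖)
  have he : ∀ᵐ ω ∂P, Tendsto (fun n => e n ω) atTop (𝓝 0) := by
    filter_upwards [strong_law_comp hX hindep hH, strong_law_comp hX hindep hL, hcons]
      with ω h1 h2 h3
    have h4 : Tendsto (fun n => ‖Hbar n ω - J‖) atTop (𝓝 0) := by
      have h := (h1.sub_const J).norm
      rwa [sub_self, norm_zero] at h
    have h5 : Tendsto (fun n => ‖θ n ω - ϑ₀‖) atTop (𝓝 0) := by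
      simpa using (h3.sub_const ϑ₀).norm
    have h := (h4.add (h2.mul h5)).const_mul ‖A‖
    rwa [mul_zero, add_zero, mul_zero] at h
  refine tendstoInMeasure_of_norm_le_mul (e := fun n ω => 2 * e n ω) hclt
    (fun n => (((hθ n).sub_const ϑ₀).const_smul _).sub (hclt.forall_aemeasurable n)) ?_ ?_
  · filter_upwards [he] with ω h
    simpa using h.const_mul 2
  filter_upwards [he, hscore, hcons] with ω h1 h2 h3
  have h3' : ∀ᶠ n in atTop, ‖θ n ω - ϑ₀‖ ≤ δ := by
    filter_upwards [(Metric.tendsto_nhds.1 h3) δ hδ] with n hn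
    rw [← dist_eq_norm]
    exact hn.le
  filter_upwards [h2, h3', h1.eventually_lt_const (show (0 : ℝ) < 1 / 2 by norm_num),
    eventually_gt_atTop 0] with n hs hd he2 hn
  have hn' : (0 : ℝ) < n := by exact_mod_cast hn
  set h : E := θ n ω - ϑ₀ with hh
  set gbar : E := (n : ℝ)⁻¹ • ∑ i ∈ Finset.range n, g ϑ₀ (X i ω) with hgbar
  have hrem : ‖gbar + Hbar n ω h‖ ≤ Lbar n ω * ‖h‖ ^ 2 := by
    have h5 : gbar + Hbar n ω h = -((n : ℝ)⁻¹ • ∑ i ∈ Finset.range n,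
        (g (θ n ω) (X i ω) - g ϑ₀ (X i ω) - H (X i ω) h)) := by
      simp only [Finset.sum_sub_distrib, hs, hgbar, Hbar, smul_apply,
        sum_apply, smul_sub, smul_zero]
      abel
    rw [h5, norm_neg, norm_smul, norm_inv, Real.norm_of_nonneg hn'.le]
    simp only [Lbar, smul_eq_mul]
    rw [mul_assoc, Finset.sum_mul]
    gcongr
    exact (norm_sum_le _ _).trans (Finset.sum_le_sum fun i _ => hg _ hd _)
  have hAJ : A (J h) = -h := by
    have := congrArg (fun T : E →L[ℝ] E => T h) hA
    simpa using this
  have hdiff : ‖h - A gbar‖ ≤ e n ω * ‖h‖ := by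
    have h6 : h - A gbar = A (Hbar n ω h - J h) - A (gbar + Hbar n ω h) := by
      rw [map_sub, map_add, hAJ]
      abel
    rw [h6, ← sub_apply (Hbar n ω) J]
    calc ‖A ((Hbar n ω - J) h) - A (gbar + Hbar n ω h)‖
        ≤ ‖A‖ * (‖Hbar n ω - J‖ * ‖h‖) + ‖A‖ * (Lbar n ω * ‖h‖ ^ 2) := by
          refine (norm_sub_le _ _).trans (add_le_add ?_ ?_)
          · exact (A.le_opNorm _).trans (by gcongr; exact ContinuousLinearMap.le_opNorm _ _)
          · exact (A.le_opNorm _).trans (by gcongr)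
      _ = e n ω * ‖h‖ := by simp only [e]; ring
  have he0 : 0 ≤ e n ω * ‖h‖ := (norm_nonneg _).trans hdiff
  have hle : ‖h‖ ≤ 2 * ‖A gbar‖ := by
    have h7 : ‖h‖ ≤ ‖h - A gbar‖ + ‖A gbar‖ := by
      simpa using norm_add_le (h - A gbar) (A gbar)
    nlinarith [norm_nonneg h]
  have hsq : √(n : ℝ) * (n : ℝ)⁻¹ = (√(n : ℝ))⁻¹ := by
    rw [← div_eq_mul_inv, Real.sqrt_div_self']
    simp
  have hV : A ((√(n : ℝ))⁻¹ • ∑ i ∈ Finset.range n, g ϑ₀ (X i ω)) = √(n : ℝ) • A gbar := by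
    rw [hgbar, map_smul, map_smul, smul_smul, hsq]
  rw [hV, ← smul_sub, norm_smul, norm_smul, Real.norm_of_nonneg (Real.sqrt_nonneg _)]
  -- `L` is not assumed nonnegative, so `e n ω` could be negative; in that case `h`, and with it `A
  -- gbar`, must vanish.
  have h8 : e n ω * ‖h‖ ≤ 2 * e n ω * ‖A gbar‖ := by
    rcases le_or_gt 0 (e n ω) with h0 | h0
    · nlinarith
    · have : ‖h‖ = 0 := by nlinarith [norm_nonneg h]
      have h9 : ‖h - A gbar‖ ≤ 0 := by simpa [this] using hdiff
      have h10 : A gbar = h := (sub_eq_zero.1 (norm_le_zero_iff.1 h9)).symm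
      rw [h10, this]
      simp
  nlinarith [Real.sqrt_nonneg (n : ℝ)]

end MEstimators

end HypWN

namespace HypWN

variable {d : ℕ} {μ₀ : Hyp d} {Φ : EuclideanSpace ℝ (Fin d) ≃ₗ[ℝ] tangentSpace μ₀}

/-! ### Smoothness of the log-density in the chart -/

/-- The log-density at chart coordinates `ϑ`. -/
def chartDensity (μ₀ : Hyp d) (Φ : EuclideanSpace ℝ (Fin d) ≃ₗ[ℝ] tangentSpace μ₀) (ϑ : Param d)
    (x : Hyp d) : ℝ := logDensity (chartInv μ₀ Φ ϑ).1 (chartInv μ₀ Φ ϑ).2 x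

/-- A function of temperate growth representing the log-density on a ball of the chart. -/
structure IsLocalModel (Φ : EuclideanSpace ℝ (Fin d) ≃ₗ[ℝ] tangentSpace μ₀) (R : ℝ)
    (F : Param d × EuclideanSpace ℝ (Fin d) → ℝ) : Prop where
  temperate : F.HasTemperateGrowth
  eq : ∀ ϑ : Param d, ‖ϑ‖ ≤ R → ∀ x : Hyp d, chartDensity μ₀ Φ ϑ x = F (ϑ, spatial x)

theorem exists_isLocalModel (hΦ : ∀ v, tnorm (Φ v) = ‖v‖) (R : ℝ) :
    ∃ F, IsLocalModel Φ R F := by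
  obtain ⟨F, h1, h2⟩ := exists_temperate_logDensity hΦ R
  exact ⟨F, h1, h2⟩

section Growth

variable {V : Type*} [NormedAddCommGroup V] [NormedSpace ℝ V]

theorem continuous_slice {f : Param d × EuclideanSpace ℝ (Fin d) → V} (hf : f.HasTemperateGrowth)
    (ϑ : Param d) : Continuous fun x : Hyp d => f (ϑ, spatial x) :=
  hf.1.continuous.comp (continuous_const.prodMk continuous_spatial)

theorem integrable_slice [FiniteDimensional ℝ V] {f : Param d × EuclideanSpace ℝ (Fin d) → V}
    (hf : f.HasTemperateGrowth) (ϑ : Param d) (μ : Hyp d) (S : SPD d) :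
    Integrable (fun x => f (ϑ, spatial x)) (hwn μ S) := by
  obtain ⟨C, N, -, h⟩ := exists_norm_le_height_pow hf ‖ϑ‖
  exact integrable_of_le_height_pow μ S (continuous_slice hf ϑ).aestronglyMeasurable
    fun x => h ϑ le_rfl (spatial x)

theorem exists_lipschitz_height_pow {f : Param d × EuclideanSpace ℝ (Fin d) → V}
    (hf : f.HasTemperateGrowth) (R : ℝ) :
    ∃ (C : ℝ) (N : ℕ), 0 ≤ C ∧ ∀ ϑ ϑ', ‖ϑ‖ ≤ R → ‖ϑ'‖ ≤ R → ∀ y,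
      ‖f (ϑ, y) - f (ϑ', y)‖ ≤ C * height y ^ N * ‖ϑ - ϑ'‖ := by
  obtain ⟨C, N, hC, h⟩ := exists_norm_le_height_pow (hasTemperateGrowth_partialFst hf) R
  refine ⟨C, N, hC, fun ϑ ϑ' hϑ hϑ' y => ?_⟩
  refine (convex_closedBall (0 : Param d) R).norm_image_sub_le_of_norm_hasFDerivWithin_le
    (f := fun ϑ => f (ϑ, y)) (f' := fun ϑ => partialFst f (ϑ, y))
    (fun ξ _ => (hasFDerivAt_partialFst hf ξ y).hasFDerivWithinAt)
    (fun ξ hξ => h ξ (by simpa using hξ) y) (by simpa using hϑ') (by simpa using hϑ)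

/-- The mean value inequality on the segment, applied after subtracting the linear part, with the
derivative Lipschitz by `exists_lipschitz_height_pow`. -/
theorem exists_taylor_height_pow {f : Param d × EuclideanSpace ℝ (Fin d) → V}
    (hf : f.HasTemperateGrowth) (R : ℝ) :
    ∃ (C : ℝ) (N : ℕ), 0 ≤ C ∧ ∀ ϑ ϑ', ‖ϑ‖ ≤ R → ‖ϑ'‖ ≤ R → ∀ y,
      ‖f (ϑ, y) - f (ϑ', y) - partialFst f (ϑ', y) (ϑ - ϑ')‖ ≤
        C * height y ^ N * ‖ϑ - ϑ'‖ ^ 2 := by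
  obtain ⟨C, N, hC, h⟩ := exists_lipschitz_height_pow (hasTemperateGrowth_partialFst hf) R
  refine ⟨C, N, hC, fun ϑ ϑ' hϑ hϑ' y => ?_⟩
  have hseg : ∀ ξ ∈ segment ℝ ϑ' ϑ, ‖ξ‖ ≤ R ∧ ‖ξ - ϑ'‖ ≤ ‖ϑ - ϑ'‖ := by
    intro ξ hξ
    have h1 := (convex_closedBall (0 : Param d) R).segment_subset
      (by simpa using hϑ') (by simpa using hϑ) hξ
    have h2 := (convex_closedBall ϑ' ‖ϑ - ϑ'‖).segment_subset
      (Metric.mem_closedBall_self (norm_nonneg _)) (by simp [dist_eq_norm]) hξ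
    exact ⟨by simpa using h1, by simpa [dist_eq_norm] using h2⟩
  have h3 := (convex_segment ϑ' ϑ).norm_image_sub_le_of_norm_hasFDerivWithin_le'
    (f := fun ϑ => f (ϑ, y)) (f' := fun ϑ => partialFst f (ϑ, y)) (φ := partialFst f (ϑ', y))
    (C := C * height y ^ N * ‖ϑ - ϑ'‖)
    (fun ξ _ => (hasFDerivAt_partialFst hf ξ y).hasFDerivWithinAt)
    (fun ξ hξ => (h ξ ϑ' (hseg ξ hξ).1 hϑ' y).trans (by
      have := height_pos y
      have := (hseg ξ hξ).2
      gcongr))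
    (left_mem_segment ℝ ϑ' ϑ) (right_mem_segment ℝ ϑ' ϑ)
  rwa [sq, ← mul_assoc]

end Growth

namespace IsLocalModel

variable {R : ℝ} {F : Param d × EuclideanSpace ℝ (Fin d) → ℝ}

theorem hasFDerivAt (hF : IsLocalModel Φ R F) {ϑ : Param d} (hϑ : ‖ϑ‖ < R) (x : Hyp d) :
    HasFDerivAt (fun ϑ => chartDensity μ₀ Φ ϑ x) (partialFst F (ϑ, spatial x)) ϑ := by
  refine (hasFDerivAt_partialFst hF.temperate ϑ (spatial x)).congr_of_eventuallyEq ?_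
  filter_upwards [continuous_norm.continuousAt.eventually_lt_const hϑ] with ξ hξ
  exact hF.eq ξ hξ.le x

theorem score_eq (hF : IsLocalModel Φ R F) {ϑ : Param d} (hϑ : ‖ϑ‖ < R) (x : Hyp d) :
    score μ₀ Φ ϑ x = (InnerProductSpace.toDual ℝ (Param d)).symm (partialFst F (ϑ, spatial x)) := by
  rw [score, gradient]
  congr 1
  exact (hF.hasFDerivAt hϑ x).fderiv

theorem inner_score (hF : IsLocalModel Φ R F) {ϑ : Param d} (hϑ : ‖ϑ‖ < R) (x : Hyp d)
    (v : Param d) : inner ℝ v (score μ₀ Φ ϑ x) = partialFst F (ϑ, spatial x) v := by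
  rw [hF.score_eq hϑ, real_inner_comm, InnerProductSpace.toDual_symm_apply]

end IsLocalModel

/-! ### Differentiation under the integral -/

/-- Nearby parameters keep their covariance in the shell and their location at bounded height, so
`exists_exp_logDensity_le` applies uniformly. The dominating function is a wrapped normal density
times a power of the height, hence has all moments in the height. -/
theorem exists_domination (hd : 1 ≤ d) (hΦ : ∀ v, tnorm (Φ v) = ‖v‖) {lo hi : ℝ} (hlo : 0 < lo)
    (hhi : 0 < hi) {ϑ₀ : Param d} (h₀ : (chartInv μ₀ Φ ϑ₀).2 ∈ interior (shell d lo hi)) :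
    ∃ r, 0 < r ∧ ∃ D : Hyp d → ℝ,
      (∀ N, Integrable (fun x => D x * height (spatial x) ^ N) (hypVolume d)) ∧
      ∀ ϑ ∈ Metric.ball ϑ₀ r, ∀ x, Real.exp (chartDensity μ₀ Φ ϑ x) ≤ D x := by
  have hc := continuous_chartInv (μ₀ := μ₀) hΦ
  have hh : Continuous fun ϑ => height (spatial (chartInv μ₀ Φ ϑ).1) :=
    continuous_height.comp (continuous_spatial.comp (continuous_fst.comp hc))
  have h1 : ∀ᶠ ϑ in 𝓝 ϑ₀, (chartInv μ₀ Φ ϑ).2 ∈ interior (shell d lo hi) :=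
    (continuous_snd.comp hc).continuousAt.eventually (isOpen_interior.mem_nhds h₀)
  have h2 : ∀ᶠ ϑ in 𝓝 ϑ₀, height (spatial (chartInv μ₀ Φ ϑ).1) <
      height (spatial (chartInv μ₀ Φ ϑ₀).1) + 1 :=
    hh.continuousAt.eventually_lt_const (lt_add_one _)
  obtain ⟨r, hr, hball⟩ := Metric.eventually_nhds_iff_ball.1 (h1.and h2)
  obtain ⟨C, hC⟩ := exists_exp_logDensity_le hd hlo hhi
    (height (spatial (chartInv μ₀ Φ ϑ₀).1) + 1)
  refine ⟨r, hr, _, fun N => ?_, fun ϑ hϑ x =>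
    hC _ _ x (interior_subset (hball ϑ hϑ).1) (hball ϑ hϑ).2.le⟩
  have h3 := (integrable_hwn_iff hd (origin d) (scalarSPD d (c := 4 * hi) (by positivity))
    fun x => height (spatial x) ^ (d - 1 + N)).1 (integrable_height_pow _ _ _)
  refine (h3.const_mul C).congr (.of_forall fun x => ?_)
  simp only [smul_eq_mul]
  ring

/-- The derivative of a density-weighted integral, as an integrand. -/
def weightedDeriv {V : Type*} [NormedAddCommGroup V] [NormedSpace ℝ V]
    (F : Param d × EuclideanSpace ℝ (Fin d) → ℝ) (W : Param d × EuclideanSpace ℝ (Fin d) → V)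
    (p : Param d × EuclideanSpace ℝ (Fin d)) : Param d →L[ℝ] V :=
  partialFst W p + (partialFst F p).smulRight (W p)

section WeightedDeriv

variable {V : Type*} [NormedAddCommGroup V] [NormedSpace ℝ V]
  {F : Param d × EuclideanSpace ℝ (Fin d) → ℝ} {W : Param d × EuclideanSpace ℝ (Fin d) → V}

theorem hasTemperateGrowth_weightedDeriv (hF : F.HasTemperateGrowth) (hW : W.HasTemperateGrowth) :
    (weightedDeriv F W).HasTemperateGrowth :=
  (hasTemperateGrowth_partialFst hW).add
    ((ContinuousLinearMap.smulRightL ℝ (Param d) V).bilinear_hasTemperateGrowth (𝕜 := ℝ)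
      (hasTemperateGrowth_partialFst hF) hW)

/-- The weight `W` is general so that the same statement can be used twice: with `W = 1` for the
mean of the score, and with `W` the score for the mean of the Hessian. -/
theorem hasFDerivAt_integral_exp_smul [FiniteDimensional ℝ V] {R r : ℝ} (hF : IsLocalModel Φ R F)
    (hW : W.HasTemperateGrowth) {ϑ₀ : Param d} {D : Hyp d → ℝ}
    (hr : ∀ ϑ ∈ Metric.ball ϑ₀ r, ‖ϑ‖ < R)
    (hD : ∀ N, Integrable (fun x => D x * height (spatial x) ^ N) (hypVolume d))
    (hDm : ∀ ϑ ∈ Metric.ball ϑ₀ r, ∀ x, Real.exp (chartDensity μ₀ Φ ϑ x) ≤ D x)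
    {ϑ : Param d} (hϑ : ϑ ∈ Metric.ball ϑ₀ r) :
    HasFDerivAt (fun ϑ => ∫ x, Real.exp (chartDensity μ₀ Φ ϑ x) • W (ϑ, spatial x) ∂hypVolume d)
      (∫ x, Real.exp (chartDensity μ₀ Φ ϑ x) • weightedDeriv F W (ϑ, spatial x) ∂hypVolume d)
      ϑ := by
  have hW' := hasTemperateGrowth_weightedDeriv hF.temperate hW
  obtain ⟨C, N, hC, hCN⟩ := exists_norm_le_height_pow hW R
  obtain ⟨C', N', hC', hCN'⟩ := exists_norm_le_height_pow hW' R
  have hcont : ∀ ϑ, Continuous fun x => Real.exp (chartDensity μ₀ Φ ϑ x) := fun ϑ =>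
    Real.continuous_exp.comp (continuous_logDensity _ _)
  have hmeas : ∀ ϑ, AEStronglyMeasurable
      (fun x => Real.exp (chartDensity μ₀ Φ ϑ x) • W (ϑ, spatial x)) (hypVolume d) := fun ϑ =>
    ((hcont ϑ).smul (continuous_slice hW ϑ)).aestronglyMeasurable
  refine hasFDerivAt_integral_of_dominated_of_fderiv_le (s := Metric.ball ϑ₀ r)
    (F := fun ϑ x => Real.exp (chartDensity μ₀ Φ ϑ x) • W (ϑ, spatial x))
    (F' := fun ϑ x => Real.exp (chartDensity μ₀ Φ ϑ x) • weightedDeriv F W (ϑ, spatial x))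
    (bound := fun x => C' * (D x * height (spatial x) ^ N')) (Metric.isOpen_ball.mem_nhds hϑ)
    (.of_forall hmeas) ?_ ((hcont ϑ).smul (continuous_slice hW' ϑ)).aestronglyMeasurable
    (.of_forall fun x ξ hξ => ?_) ((hD N').const_mul C') (.of_forall fun x ξ hξ => ?_)
  · refine ((hD N).const_mul C).mono' (hmeas ϑ) (.of_forall fun x => ?_)
    rw [norm_smul, Real.norm_of_nonneg (Real.exp_pos _).le]
    calc _ ≤ D x * (C * height (spatial x) ^ N) :=
          mul_le_mul (hDm ϑ hϑ x) (hCN ϑ (hr ϑ hϑ).le _) (norm_nonneg _)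
            ((Real.exp_pos _).le.trans (hDm ϑ hϑ x))
      _ = _ := by ring
  · rw [norm_smul, Real.norm_of_nonneg (Real.exp_pos _).le]
    calc _ ≤ D x * (C' * height (spatial x) ^ N') :=
          mul_le_mul (hDm ξ hξ x) (hCN' ξ (hr ξ hξ).le _) (norm_nonneg _)
            ((Real.exp_pos _).le.trans (hDm ξ hξ x))
      _ = _ := by ring
  · have h1 := (hF.hasFDerivAt (hr ξ hξ) x).exp.smul (hasFDerivAt_partialFst hW ξ (spatial x))
    refine h1.congr_fderiv ?_
    ext v
    simp [weightedDeriv, smul_smul]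

end WeightedDeriv

/-- The first two Bartlett identities. -/
theorem integral_bartlett (hd : 1 ≤ d) (hΦ : ∀ v, tnorm (Φ v) = ‖v‖) {lo hi : ℝ} (hlo : 0 < lo)
    (hhi : 0 < hi) {ϑ₀ : Param d} (h₀ : (chartInv μ₀ Φ ϑ₀).2 ∈ interior (shell d lo hi))
    {R : ℝ} {F : Param d × EuclideanSpace ℝ (Fin d) → ℝ} (hF : IsLocalModel Φ R F)
    (hR : ‖ϑ₀‖ < R) :
    ∫ x, partialFst F (ϑ₀, spatial x) ∂hwn (chartInv μ₀ Φ ϑ₀).1 (chartInv μ₀ Φ ϑ₀).2 = 0 ∧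
    ∫ x, weightedDeriv F (partialFst F) (ϑ₀, spatial x)
      ∂hwn (chartInv μ₀ Φ ϑ₀).1 (chartInv μ₀ Φ ϑ₀).2 = 0 := by
  obtain ⟨r₁, hr₁, D, hD, hDm⟩ := exists_domination hd hΦ hlo hhi h₀
  set r := min r₁ (R - ‖ϑ₀‖)
  have hr : 0 < r := lt_min hr₁ (by linarith)
  have hrR : ∀ ϑ ∈ Metric.ball ϑ₀ r, ‖ϑ‖ < R := by
    intro ϑ hϑ
    have h1 : ‖ϑ - ϑ₀‖ < R - ‖ϑ₀‖ := by
      rw [← dist_eq_norm]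
      exact hϑ.trans_le (min_le_right _ _)
    have h2 := norm_sub_norm_le ϑ ϑ₀
    linarith
  have hDm' : ∀ ϑ ∈ Metric.ball ϑ₀ r, ∀ x, Real.exp (chartDensity μ₀ Φ ϑ x) ≤ D x :=
    fun ϑ hϑ => hDm ϑ (Metric.ball_subset_ball (min_le_left _ _) hϑ)
  have hone : (fun _ : Param d × EuclideanSpace ℝ (Fin d) => (1 : ℝ)).HasTemperateGrowth := .const 1
  have hw1 : weightedDeriv F (fun _ => (1 : ℝ)) = partialFst F := by
    funext p
    ext v
    simp [weightedDeriv, partialFst]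
  -- The first identity is needed on a whole neighbourhood, because the second comes from
  -- differentiating it once more.
  have hzero1 : ∀ ϑ ∈ Metric.ball ϑ₀ r,
      ∫ x, Real.exp (chartDensity μ₀ Φ ϑ x) • partialFst F (ϑ, spatial x) ∂hypVolume d = 0 := by
    intro ϑ hϑ
    have h1 := hasFDerivAt_integral_exp_smul hF hone hrR hD hDm' hϑ
    rw [hw1] at h1
    refine h1.unique ((hasFDerivAt_const (gaussConst d)⁻¹ ϑ).congr_of_eventuallyEq
      (.of_forall fun ξ => ?_))
    simp only [smul_eq_mul, mul_one]
    exact integral_exp_logDensity hd _ _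
  have h₀r := Metric.mem_ball_self (x := ϑ₀) hr
  constructor
  · rw [integral_hwn hd]
    exact (congrArg _ (hzero1 ϑ₀ h₀r)).trans (smul_zero _)
  · rw [integral_hwn hd]
    have h2 := hasFDerivAt_integral_exp_smul hF (hasTemperateGrowth_partialFst hF.temperate)
      hrR hD hDm' h₀r
    have h3 := h2.unique ((hasFDerivAt_const (0 : Param d →L[ℝ] ℝ) ϑ₀).congr_of_eventuallyEq (by
      filter_upwards [Metric.ball_mem_nhds ϑ₀ hr] with ξ hξ using hzero1 ξ hξ))
    exact (congrArg _ h3).trans (smul_zero _)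

/-! ### The Fisher information -/

/-- The Riesz isomorphism from the dual of a real Hilbert space, as a linear map. -/
def riesz (E : Type*) [NormedAddCommGroup E] [InnerProductSpace ℝ E] [CompleteSpace E] :
    (E →L[ℝ] ℝ) →L[ℝ] E :=
  LinearMap.mkContinuous
    { toFun := fun u => (InnerProductSpace.toDual ℝ E).symm u
      map_add' := fun u v => map_add _ u v
      map_smul' := fun c u => by simp } 1 fun u => by simp

theorem norm_riesz {E : Type*} [NormedAddCommGroup E] [InnerProductSpace ℝ E] [CompleteSpace E]
    (u : E →L[ℝ] ℝ) : ‖riesz E u‖ = ‖u‖ := (InnerProductSpace.toDual ℝ E).symm.norm_map u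

theorem inner_riesz {E : Type*} [NormedAddCommGroup E] [InnerProductSpace ℝ E] [CompleteSpace E]
    (u : E →L[ℝ] ℝ) (v : E) : inner ℝ v (riesz E u) = u v :=
  (real_inner_comm _ _).trans (InnerProductSpace.toDual_symm_apply (x := v) (y := u))

theorem IsLocalModel.score_eq_riesz {R : ℝ} {F : Param d × EuclideanSpace ℝ (Fin d) → ℝ}
    (hF : IsLocalModel Φ R F) {ϑ : Param d} (hϑ : ‖ϑ‖ < R) (x : Hyp d) :
    score μ₀ Φ ϑ x = riesz (Param d) (partialFst F (ϑ, spatial x)) := hF.score_eq hϑ x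

section Fisher

variable {R : ℝ} {F : Param d × EuclideanSpace ℝ (Fin d) → ℝ} {ϑ : Param d}

theorem integrable_inner_score_mul (hF : IsLocalModel Φ R F) (hR : ‖ϑ‖ < R) (v w : Param d)
    (μ : Hyp d) (S : SPD d) :
    Integrable (fun x => inner ℝ v (score μ₀ Φ ϑ x) * inner ℝ w (score μ₀ Φ ϑ x)) (hwn μ S) := by
  simp only [hF.inner_score hR]
  have h1 := hasTemperateGrowth_partialFst hF.temperate
  have h2 : ∀ v, (fun p => partialFst F p v).HasTemperateGrowth := fun v =>
    ((ContinuousLinearMap.apply ℝ ℝ v).hasTemperateGrowth).comp h1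
  exact integrable_slice ((h2 v).mul (h2 w)) ϑ μ S

theorem integral_inner_score_mul (hF : IsLocalModel Φ R F) (hR : ‖ϑ‖ < R) (v w : Param d) :
    ∫ x, inner ℝ v (score μ₀ Φ ϑ x) * inner ℝ w (score μ₀ Φ ϑ x)
      ∂hwn (chartInv μ₀ Φ ϑ).1 (chartInv μ₀ Φ ϑ).2 =
      v.ofLp ⬝ᵥ (fisherInfo μ₀ Φ ϑ *ᵥ w.ofLp) := by
  have h1 : ∀ x, inner ℝ v (score μ₀ Φ ϑ x) * inner ℝ w (score μ₀ Φ ϑ x) =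
      ∑ i, ∑ j, v i * w j * (score μ₀ Φ ϑ x i * score μ₀ Φ ϑ x j) := by
    intro x
    simp only [PiLp.inner_apply, Finset.sum_mul_sum]
    refine Finset.sum_congr rfl fun i _ => Finset.sum_congr rfl fun j _ => ?_
    simp
    ring
  have hcoord : ∀ (i) (x : Hyp d), score μ₀ Φ ϑ x i =
      inner ℝ (EuclideanSpace.single i (1 : ℝ)) (score μ₀ Φ ϑ x) := by
    intro i x
    rw [EuclideanSpace.inner_single_left]
    simp
  have h2 : ∀ i j, Integrable (fun x => v i * w j * (score μ₀ Φ ϑ x i * score μ₀ Φ ϑ x j))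
      (hwn (chartInv μ₀ Φ ϑ).1 (chartInv μ₀ Φ ϑ).2) := by
    intro i j
    simp only [hcoord]
    exact (integrable_inner_score_mul hF hR _ _ _ _).const_mul _
  simp only [h1]
  rw [integral_finsetSum _ fun i _ => integrable_finsetSum _ fun j _ => h2 i j]
  simp only [dotProduct, Matrix.mulVec, Finset.mul_sum]
  refine Finset.sum_congr rfl fun i _ => ?_
  rw [integral_finsetSum _ fun j _ => h2 i j]
  refine Finset.sum_congr rfl fun j _ => ?_
  rw [integral_const_mul, fisherInfo, Matrix.of_apply]
  ring

end Fisher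

end HypWN

namespace HypWN

variable {d : ℕ} {μ₀ : Hyp d} {Φ : EuclideanSpace ℝ (Fin d) ≃ₗ[ℝ] tangentSpace μ₀}

/-! ### Behaviour of the log-density far away from the true parameter -/

theorem hdist_le_log_height (μ x : Hyp d) :
    hdist μ x ≤ Real.log (4 * height (spatial μ)) + Real.log (height (spatial x)) := by
  have hu := height_pos (spatial μ)
  have hy := height_pos (spatial x)
  have h1 := one_le_coshDist (spatial μ) (spatial x)
  have h2 : coshDist (spatial μ) (spatial x) ≤ 2 * (height (spatial μ) * height (spatial x)) := by
    have h3 := neg_le_of_abs_le (abs_real_inner_le_norm (spatial μ) (spatial x))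
    have h4 := mul_le_mul (norm_le_height (spatial μ)) (norm_le_height (spatial x))
      (norm_nonneg _) hu.le
    rw [coshDist]
    linarith
  rw [hdist, neg_lorentz, ← Real.log_mul (by positivity) hy.ne']
  refine (arcosh_le_log_two_mul h1).trans (Real.log_le_log (by linarith) (by linarith))

/-- The location block of the coordinates has norm equal to the distance from `μ₀`, and the
covariance block is bounded on the shell. A far parameter thus has a far location. -/
theorem exists_norm_le_hdist_add (hΦ : ∀ v, tnorm (Φ v) = ‖v‖) {lo hi : ℝ} (hlo : 0 < lo) :
    ∃ K, ∀ ϑ : Param d, (chartInv μ₀ Φ ϑ).2 ∈ shell d lo hi →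
      ‖ϑ‖ ≤ hdist μ₀ (chartInv μ₀ Φ ϑ).1 + K := by
  obtain ⟨C, hC⟩ := exists_vech_log_le (d := d) (hi := hi) hlo
  refine ⟨√(∑ _p : LowerIdx d, C ^ 2), fun ϑ hϑ => ?_⟩
  have h1 := norm_locPart_chart hΦ (chartInv μ₀ Φ ϑ)
  have h2 : ∀ p : LowerIdx d, |ϑ (Sum.inr p)| ≤ C := by
    intro p
    have h3 : chart μ₀ Φ (chartInv μ₀ Φ ϑ) (Sum.inr p) = ϑ (Sum.inr p) := by rw [chart_chartInv]
    rw [← h3]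
    exact hC _ hϑ p
  rw [chart_chartInv] at h1
  have hS : 0 ≤ ∑ _p : LowerIdx d, C ^ 2 := Finset.sum_nonneg fun _ _ => sq_nonneg C
  have h4 : ‖ϑ‖ ^ 2 ≤ hdist μ₀ (chartInv μ₀ Φ ϑ).1 ^ 2 + √(∑ _p : LowerIdx d, C ^ 2) ^ 2 := by
    rw [← h1, Real.sq_sqrt hS, EuclideanSpace.real_norm_sq_eq, EuclideanSpace.real_norm_sq_eq,
      Fintype.sum_sum_type]
    refine add_le_add (le_of_eq rfl) (Finset.sum_le_sum fun p _ => ?_)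
    exact sq_le_sq' (neg_le_of_abs_le (h2 p)) (le_of_abs_le (h2 p))
  have h5 := hdist_nonneg μ₀ (chartInv μ₀ Φ ϑ).1
  have h6 := Real.sqrt_nonneg (∑ _p : LowerIdx d, C ^ 2)
  refine abs_le_of_sq_le_sq' (by nlinarith) (by linarith) |>.2

/-- A distant location forces the distance to every observation to be large, except for a correction
of order `log² (2 height x)` that does not depend on the parameter and is integrable. The
log-density is pushed down uniformly by `s² / (4 hi)`. -/
theorem exists_outer_bound (hd : 1 ≤ d) (hΦ : ∀ v, tnorm (Φ v) = ‖v‖) {lo hi : ℝ} (hlo : 0 < lo)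
    (hhi : 0 < hi) (μ : Hyp d) (S : SPD d) (c : ℝ) :
    ∃ (R : ℝ) (b : Hyp d → ℝ), Integrable b (hwn μ S) ∧
      (∀ ϑ ∈ {ϑ | (chartInv μ₀ Φ ϑ).2 ∈ shell d lo hi}, R < ‖ϑ‖ → ∀ x,
        chartDensity μ₀ Φ ϑ x ≤ b x) ∧ ∫ x, b x ∂hwn μ S < c := by
  obtain ⟨K, hK⟩ := exists_norm_le_hdist_add (μ₀ := μ₀) (hi := hi) hΦ hlo
  have hlog : Integrable (fun x => Real.log (2 * height (spatial x)) ^ 2) (hwn μ S) := by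
    have hc : Continuous fun x : Hyp d => Real.log (2 * height (spatial x)) ^ 2 :=
      ((continuous_const.mul (continuous_height.comp continuous_spatial)).log fun x =>
        (mul_pos two_pos (height_pos _)).ne').pow 2
    refine integrable_of_le_height_pow (C := 4) (N := 2) μ S hc.aestronglyMeasurable fun x => ?_
    have h1 := one_le_height (spatial x)
    have h2 : 0 ≤ Real.log (2 * height (spatial x)) := Real.log_nonneg (by linarith)
    have h3 := Real.log_le_self (x := 2 * height (spatial x)) (by linarith)
    rw [Real.norm_of_nonneg (sq_nonneg _)]
    nlinarith
  set A := Real.log (4 * height (spatial μ₀)) + K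
  set c₁ := -(1 / 2) * Real.log (lo ^ d)
  set M := ∫ x, Real.log (2 * height (spatial x)) ^ 2 ∂hwn μ S
  -- Chosen so that `s² / (4 hi)` exceeds `c₁ + M / (2 hi) - c`, which puts the mean of the envelope
  -- below `c`.
  set s := √(4 * hi * (|c₁ + M / (2 * hi) - c| + 1))
  have hs : s ^ 2 / (4 * hi) = |c₁ + M / (2 * hi) - c| + 1 := by
    rw [Real.sq_sqrt (by positivity)]
    field_simp
  refine ⟨A + s,
    fun x => (c₁ - s ^ 2 / (4 * hi)) + Real.log (2 * height (spatial x)) ^ 2 / (2 * hi),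
    (integrable_const _).add (hlog.div_const _), fun ϑ hϑ hR x => ?_, ?_⟩
  · have h1 := hK ϑ hϑ
    have h2 := hdist_le_log_height μ₀ (chartInv μ₀ Φ ϑ).1
    have h3 := sq_le_hdist_sq (chartInv μ₀ Φ ϑ).1 x
    have h4 := logDensity_le hd hlo hhi hϑ (chartInv μ₀ Φ ϑ).1 x
    have h5 : s ^ 2 ≤ Real.log (height (spatial (chartInv μ₀ Φ ϑ).1)) ^ 2 :=
      pow_le_pow_left₀ (Real.sqrt_nonneg _) (by linarith) 2
    have h6 : (s ^ 2 / 2 - Real.log (2 * height (spatial x)) ^ 2) / (2 * hi) ≤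
        hdist (chartInv μ₀ Φ ϑ).1 x ^ 2 / (2 * hi) := by
      gcongr
      linarith
    have h7 : (s ^ 2 / 2 - Real.log (2 * height (spatial x)) ^ 2) / (2 * hi) =
        s ^ 2 / (4 * hi) - Real.log (2 * height (spatial x)) ^ 2 / (2 * hi) := by
      field_simp
      ring
    rw [chartDensity]
    refine h4.trans ?_
    change c₁ - _ ≤ c₁ - _ + _
    linarith
  · rw [integral_add (integrable_const _) (hlog.div_const _), integral_div, integral_const,
      probReal_univ, one_smul, hs]
    linarith [le_abs_self (c₁ + M / (2 * hi) - c)]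

/-! ### Moments of the score -/

section Moments

variable {R : ℝ} {F : Param d × EuclideanSpace ℝ (Fin d) → ℝ} {ϑ : Param d}

theorem inner_toEuclideanCLM {ι : Type*} [Fintype ι] [DecidableEq ι] {M : Matrix ι ι ℝ}
    (hM : M.IsHermitian) (v w : EuclideanSpace ℝ ι) :
    inner ℝ v (Matrix.toEuclideanCLM (𝕜 := ℝ) M w) =
      inner ℝ (Matrix.toEuclideanCLM (𝕜 := ℝ) M v) w := by
  have hT : Mᵀ = M := by simpa [Matrix.IsHermitian] using hM
  simp only [EuclideanSpace.inner_eq_star_dotProduct, Matrix.ofLp_toEuclideanCLM, star_trivial]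
  rw [dotProduct_comm, Matrix.dotProduct_mulVec, ← Matrix.mulVec_transpose, hT, dotProduct_comm]

theorem hasTemperateGrowth_clm_comp {D E G H : Type*} [NormedAddCommGroup D] [NormedSpace ℝ D]
    [NormedAddCommGroup E] [NormedSpace ℝ E] [NormedAddCommGroup G] [NormedSpace ℝ G]
    [NormedAddCommGroup H] [NormedSpace ℝ H] (T : G →L[ℝ] H) {f : D → E →L[ℝ] G}
    (hf : f.HasTemperateGrowth) : (fun p => T.comp (f p)).HasTemperateGrowth :=
  ((ContinuousLinearMap.compL ℝ E G H T).hasTemperateGrowth).comp hf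

theorem hasTemperateGrowth_hessian (hF : F.HasTemperateGrowth) :
    (fun p => (riesz (Param d)).comp (partialFst (partialFst F) p)).HasTemperateGrowth :=
  hasTemperateGrowth_clm_comp (riesz (Param d))
    (hasTemperateGrowth_partialFst (hasTemperateGrowth_partialFst hF))

theorem fisherInfo_isHermitian (ϑ : Param d) : (fisherInfo μ₀ Φ ϑ).IsHermitian := by
  ext i j
  simp [fisherInfo, Matrix.conjTranspose_apply, mul_comm]

/-- The second Bartlett identity tested on a pair of vectors: the integrand splits into a Hessian
entry and a product of score components, and the latter integrates to an entry of the Fisher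
information. The Riesz map turns the bilinear Hessian into an operator. -/
theorem integral_hessian_apply (hF : IsLocalModel Φ R F) (hR : ‖ϑ‖ < R)
    (hB : ∫ x, weightedDeriv F (partialFst F) (ϑ, spatial x)
      ∂hwn (chartInv μ₀ Φ ϑ).1 (chartInv μ₀ Φ ϑ).2 = 0) (v : Param d) :
    (∫ x, (riesz (Param d)).comp (partialFst (partialFst F) (ϑ, spatial x))
      ∂hwn (chartInv μ₀ Φ ϑ).1 (chartInv μ₀ Φ ϑ).2) v =
      -Matrix.toEuclideanCLM (𝕜 := ℝ) (fisherInfo μ₀ Φ ϑ) v := by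
  have h1 := hasTemperateGrowth_partialFst hF.temperate
  have h2 := hasTemperateGrowth_partialFst h1
  have h3 := hasTemperateGrowth_hessian hF.temperate
  have hi := integrable_slice h3 ϑ (chartInv μ₀ Φ ϑ).1 (chartInv μ₀ Φ ϑ).2
  have hi2 := integrable_slice h2 ϑ (chartInv μ₀ Φ ϑ).1 (chartInv μ₀ Φ ϑ).2
  have hiw := integrable_slice (hasTemperateGrowth_weightedDeriv hF.temperate h1) ϑ
    (chartInv μ₀ Φ ϑ).1 (chartInv μ₀ Φ ϑ).2
  set T : Param d →L[ℝ] Param d :=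
    ∫ x, (riesz (Param d)).comp (partialFst (partialFst F) (ϑ, spatial x))
      ∂hwn (chartInv μ₀ Φ ϑ).1 (chartInv μ₀ Φ ϑ).2
  refine ext_inner_left ℝ fun w => ?_
  let ev : (Param d →L[ℝ] Param d →L[ℝ] ℝ) →L[ℝ] ℝ :=
    (ContinuousLinearMap.apply ℝ ℝ w).comp (ContinuousLinearMap.apply ℝ (Param d →L[ℝ] ℝ) v)
  let ev' : (Param d →L[ℝ] Param d) →L[ℝ] ℝ :=
    (innerSL ℝ w).comp (ContinuousLinearMap.apply ℝ (Param d) v)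
  have h4 := ev.integral_comp_comm hiw
  have h5 := ev'.integral_comp_comm hi
  rw [hB, map_zero] at h4
  change _ = inner ℝ w (T v) at h5
  have h6 : ∀ x, ev' ((riesz (Param d)).comp (partialFst (partialFst F) (ϑ, spatial x))) =
      ev (partialFst (partialFst F) (ϑ, spatial x)) := fun x => inner_riesz _ w
  have h7 : ∀ x, ev (weightedDeriv F (partialFst F) (ϑ, spatial x)) =
      ev (partialFst (partialFst F) (ϑ, spatial x)) +
        inner ℝ v (score μ₀ Φ ϑ x) * inner ℝ w (score μ₀ Φ ϑ x) := by
    intro x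
    rw [hF.inner_score hR, hF.inner_score hR]
    rfl
  simp only [h7] at h4
  rw [integral_add (ev.integrable_comp hi2) (integrable_inner_score_mul hF hR v w _ _),
    integral_inner_score_mul hF hR] at h4
  simp only [h6] at h5
  rw [← h5, inner_neg_right]
  have h8 : inner ℝ w (Matrix.toEuclideanCLM (𝕜 := ℝ) (fisherInfo μ₀ Φ ϑ) v) =
      v.ofLp ⬝ᵥ (fisherInfo μ₀ Φ ϑ *ᵥ w.ofLp) := by
    rw [inner_toEuclideanCLM (fisherInfo_isHermitian ϑ), EuclideanSpace.inner_eq_star_dotProduct]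
    simp
  linarith

end Moments

/-! ### The central limit theorem for the score and consistency of the estimator -/

section Main

variable {Ω : Type*} [MeasurableSpace Ω] {P : Measure Ω} {X : ℕ → Ω → Hyp d}
  {ϑ₀ : Param d}

/-- The inverse information is applied to each summand first. These vectors are centred by the first
Bartlett identity, and their covariance `I⁻¹ I I⁻¹` is `I⁻¹`. -/
theorem tendstoInDistribution_score [IsProbabilityMeasure P] (hd : 1 ≤ d)
    (hΦ : ∀ v, tnorm (Φ v) = ‖v‖) {lo hi : ℝ}
    (hlo : 0 < lo) (hhi : 0 < hi) (h₀ : (chartInv μ₀ Φ ϑ₀).2 ∈ interior (shell d lo hi))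
    (hI : (fisherInfo μ₀ Φ ϑ₀).PosDef)
    (hX : ∀ i, HasLaw (X i) (hwn (chartInv μ₀ Φ ϑ₀).1 (chartInv μ₀ Φ ϑ₀).2) P)
    (hindep : iIndepFun X P) :
    TendstoInDistribution
      (fun (n : ℕ) ω => Matrix.toEuclideanCLM (𝕜 := ℝ) (fisherInfo μ₀ Φ ϑ₀)⁻¹
        ((√(n : ℝ))⁻¹ • ∑ i ∈ Finset.range n, score μ₀ Φ ϑ₀ (X i ω)))
      atTop id (fun _ => P) (multivariateGaussian 0 (fisherInfo μ₀ Φ ϑ₀)⁻¹) := by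
  obtain ⟨F, hF⟩ := exists_isLocalModel hΦ (‖ϑ₀‖ + 1)
  have hR : ‖ϑ₀‖ < ‖ϑ₀‖ + 1 := lt_add_one _
  have h1 := hasTemperateGrowth_partialFst hF.temperate
  set A : Param d →L[ℝ] Param d := Matrix.toEuclideanCLM (𝕜 := ℝ) (fisherInfo μ₀ Φ ϑ₀)⁻¹ with hA
  have hAsymm : ∀ v w : Param d, inner ℝ v (A w) = inner ℝ (A v) w :=
    inner_toEuclideanCLM hI.inv.isHermitian
  have hT : (fun p => A (riesz (Param d) (partialFst F p))).HasTemperateGrowth :=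
    ((A.comp (riesz (Param d))).hasTemperateGrowth).comp h1
  have hscore : ∀ x, A (score μ₀ Φ ϑ₀ x) =
      A (riesz (Param d) (partialFst F (ϑ₀, spatial x))) := fun x => by
    rw [hF.score_eq_riesz hR]
  have hcont : Continuous fun x => A (score μ₀ Φ ϑ₀ x) := by
    simp only [hscore]
    exact continuous_slice hT ϑ₀
  have hLp : MemLp (fun x => A (score μ₀ Φ ϑ₀ x)) 2
      (hwn (chartInv μ₀ Φ ϑ₀).1 (chartInv μ₀ Φ ϑ₀).2) := by
    rw [memLp_two_iff_integrable_sq_norm hcont.aestronglyMeasurable]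
    obtain ⟨C, N, hC, h⟩ := exists_norm_le_height_pow hT ‖ϑ₀‖
    refine integrable_of_le_height_pow (C := C ^ 2) (N := N * 2) _ _
      (hcont.norm.pow 2).aestronglyMeasurable fun x => ?_
    rw [norm_pow, norm_norm, hscore, pow_mul, ← mul_pow]
    exact pow_le_pow_left₀ (norm_nonneg _) (h ϑ₀ le_rfl _) 2
  have hZ := tendstoInDistribution_inv_sqrt_smul_sum (P := P)
    (Z := fun i ω => A (score μ₀ Φ ϑ₀ (X i ω))) hI.inv.posSemidef
    (((hX 0).map_eq ▸ hLp).comp_of_map (hX 0).aemeasurable)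
    (hindep.comp (fun _ x => A (score μ₀ Φ ϑ₀ x)) fun _ => hcont.measurable)
    (fun i => (⟨(hX i).aemeasurable, (hX 0).aemeasurable,
      by rw [(hX i).map_eq, (hX 0).map_eq]⟩ : IdentDistrib (X i) (X 0) P P).comp hcont.measurable)
    (fun t => ?_) (fun t => ?_)
  · convert hZ using 3 with n ω
    rw [map_smul, map_sum]
  · have h2 := (integral_bartlett hd hΦ hlo hhi h₀ hF hR).1
    have h3 := (ContinuousLinearMap.apply ℝ ℝ (A t)).integral_comp_comm
      (integrable_slice h1 ϑ₀ (chartInv μ₀ Φ ϑ₀).1 (chartInv μ₀ Φ ϑ₀).2)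
    rw [h2, map_zero] at h3
    refine ((hX 0).integral_comp (f := fun x => inner ℝ t (A (score μ₀ Φ ϑ₀ x)))
      (continuous_const.inner hcont).aestronglyMeasurable).trans (.trans ?_ h3)
    refine integral_congr_ae (.of_forall fun x => ?_)
    exact (hAsymm _ _).trans (hF.inner_score hR x _)
  · have h2 := integral_inner_score_mul hF hR (A t) (A t)
    refine ((hX 0).integral_comp (f := fun x => inner ℝ t (A (score μ₀ Φ ϑ₀ x)) ^ 2)
      ((continuous_const.inner hcont).pow 2).aestronglyMeasurable).trans ?_
    simp only [hAsymm, sq]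
    rw [h2, hA, Matrix.ofLp_toEuclideanCLM, Matrix.mulVec_mulVec,
      Matrix.mul_nonsing_inv _ hI.det_pos.ne'.isUnit, Matrix.one_mulVec, dotProduct_comm]

theorem ae_tendsto_chart (hd : 1 ≤ d) (hΦ : ∀ v, tnorm (Φ v) = ‖v‖) {lo hi : ℝ} (hlo : 0 < lo)
    (hhi : 0 < hi) (h₀ : (chartInv μ₀ Φ ϑ₀).2 ∈ shell d lo hi)
    (hX : ∀ i, HasLaw (X i) (hwn (chartInv μ₀ Φ ϑ₀).1 (chartInv μ₀ Φ ϑ₀).2) P)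
    (hindep : iIndepFun X P) {θhat : ℕ → Ω → Hyp d × SPD d}
    (hmle : ∀ n, 1 ≤ n → ∀ᵐ ω ∂P, IsShellMLE lo hi n (fun i => X i ω) (θhat n ω)) :
    ∀ᵐ ω ∂P, Tendsto (fun n => chart μ₀ Φ (θhat n ω)) atTop (𝓝 ϑ₀) := by
  have hint : ∀ ϑ, Integrable (chartDensity μ₀ Φ ϑ)
      (hwn (chartInv μ₀ Φ ϑ₀).1 (chartInv μ₀ Φ ϑ₀).2) := by
    intro ϑ
    obtain ⟨F, hF⟩ := exists_isLocalModel hΦ ‖ϑ‖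
    refine (integrable_slice hF.temperate ϑ _ _).congr (.of_forall fun x => ?_)
    exact (hF.eq ϑ le_rfl x).symm
  obtain ⟨R, b, hb, hout, hbint⟩ := exists_outer_bound hd hΦ hlo hhi (chartInv μ₀ Φ ϑ₀).1
    (chartInv μ₀ Φ ϑ₀).2 (∫ x, chartDensity μ₀ Φ ϑ₀ x
      ∂hwn (chartInv μ₀ Φ ϑ₀).1 (chartInv μ₀ Φ ϑ₀).2)
  refine ae_tendsto_of_identifiable hX hindep hint (fun R => ?_) (fun ϑ hϑ => ?_) hb hout hbint ?_
  · obtain ⟨F, hF⟩ := exists_isLocalModel hΦ R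
    obtain ⟨C, N, -, h⟩ := exists_lipschitz_height_pow hF.temperate R
    refine ⟨fun x => C * height (spatial x) ^ N, (integrable_height_pow _ _ N).const_mul C,
      fun ϑ ϑ' hϑ hϑ' x => ?_⟩
    rw [hF.eq ϑ hϑ, hF.eq ϑ' hϑ']
    exact h ϑ ϑ' hϑ hϑ' _
  · refine integral_logDensity_lt hd (fun h => hϑ ?_) (hint ϑ) (hint ϑ₀)
    rw [← chart_chartInv (μ₀ := μ₀) (Φ := Φ) ϑ, ← chart_chartInv (μ₀ := μ₀) (Φ := Φ) ϑ₀]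
    exact congrArg (chart μ₀ Φ) h
  · have h := ae_all_iff.2 fun n => ae_all_iff.2 (hmle n)
    filter_upwards [h] with ω hω
    filter_upwards [eventually_ge_atTop 1] with n hn
    have hm := hω n hn
    refine ⟨?_, ?_⟩
    · rw [chartInv_chart]
      exact hm.1
    · simp only [chartDensity, chartInv_chart]
      exact hm.2 (chartInv μ₀ Φ ϑ₀) h₀

/-- By convergence to an interior parameter, the maximizer eventually lies in the open set of
coordinates whose covariance is interior to the shell. There it is an unconstrained local maximum,
so the gradient vanishes. -/
theorem eventually_sum_score_eq_zero (hΦ : ∀ v, tnorm (Φ v) = ‖v‖) {lo hi : ℝ}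
    (h₀ : (chartInv μ₀ Φ ϑ₀).2 ∈ interior (shell d lo hi)) {x : ℕ → Hyp d}
    {θ : ℕ → Hyp d × SPD d} (hmle : ∀ n, 1 ≤ n → IsShellMLE lo hi n x (θ n))
    (hlim : Tendsto (fun n => chart μ₀ Φ (θ n)) atTop (𝓝 ϑ₀)) :
    ∀ᶠ n in atTop, ∑ i ∈ Finset.range n, score μ₀ Φ (chart μ₀ Φ (θ n)) (x i) = 0 := by
  obtain ⟨F, hF⟩ := exists_isLocalModel hΦ (‖ϑ₀‖ + 1)
  have hopen : IsOpen {ϑ : Param d | (chartInv μ₀ Φ ϑ).2 ∈ interior (shell d lo hi)} :=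
    isOpen_interior.preimage (continuous_snd.comp (continuous_chartInv hΦ))
  have h1 : ∀ᶠ ϑ in 𝓝 ϑ₀, ‖ϑ‖ < ‖ϑ₀‖ + 1 :=
    continuous_norm.continuousAt.eventually_lt_const (lt_add_one _)
  filter_upwards [hlim.eventually (hopen.mem_nhds h₀), hlim.eventually h1, eventually_ge_atTop 1]
    with n h2 h3 hn
  have hmax : IsLocalMax (fun ϑ => ∑ i ∈ Finset.range n, chartDensity μ₀ Φ ϑ (x i))
      (chart μ₀ Φ (θ n)) := by
    filter_upwards [hopen.mem_nhds h2] with ϑ hϑ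
    have h4 := (hmle n hn).2 (chartInv μ₀ Φ ϑ) (interior_subset hϑ)
    simp only [chartDensity, chartInv_chart]
    exact h4
  have hder := HasFDerivAt.fun_sum fun i (_ : i ∈ Finset.range n) => hF.hasFDerivAt h3 (x i)
  have h5 := congrArg (riesz (Param d)) (hmax.hasFDerivAt_eq_zero hder)
  rw [map_sum, map_zero] at h5
  simpa only [hF.score_eq_riesz h3] using h5

theorem tendstoInMeasure_chart [IsProbabilityMeasure P] (hd : 1 ≤ d)
    (hΦ : ∀ v, tnorm (Φ v) = ‖v‖) {lo hi : ℝ}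
    (hlo : 0 < lo) (hhi : 0 < hi) (h₀ : (chartInv μ₀ Φ ϑ₀).2 ∈ interior (shell d lo hi))
    (hI : (fisherInfo μ₀ Φ ϑ₀).PosDef)
    (hX : ∀ i, HasLaw (X i) (hwn (chartInv μ₀ Φ ϑ₀).1 (chartInv μ₀ Φ ϑ₀).2) P)
    (hindep : iIndepFun X P) {θhat : ℕ → Ω → Hyp d × SPD d} (hmeas : ∀ n, Measurable (θhat n))
    (hmle : ∀ n, 1 ≤ n → ∀ᵐ ω ∂P, IsShellMLE lo hi n (fun i => X i ω) (θhat n ω)) :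
    TendstoInMeasure P
      (fun (n : ℕ) ω => √(n : ℝ) • (chart μ₀ Φ (θhat n ω) - ϑ₀)
        - Matrix.toEuclideanCLM (𝕜 := ℝ) (fisherInfo μ₀ Φ ϑ₀)⁻¹
            ((√(n : ℝ))⁻¹ • ∑ i ∈ Finset.range n, score μ₀ Φ ϑ₀ (X i ω)))
      atTop (fun _ => 0) := by
  -- The expansion is used on the closed unit ball around `ϑ₀`, which must lie strictly inside the
  -- region where the model represents the log-density.
  obtain ⟨F, hF⟩ := exists_isLocalModel hΦ (‖ϑ₀‖ + 2)
  have hR : ‖ϑ₀‖ < ‖ϑ₀‖ + 2 := lt_add_of_pos_right _ two_pos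
  have h1 := hasTemperateGrowth_partialFst hF.temperate
  obtain ⟨C, N, -, hT⟩ := exists_taylor_height_pow h1 (‖ϑ₀‖ + 2)
  have hcons := ae_tendsto_chart hd hΦ hlo hhi (interior_subset h₀) hX hindep hmle
  refine tendstoInMeasure_asymptotic_linearity hX hindep
    (H := fun x => (riesz (Param d)).comp (partialFst (partialFst F) (ϑ₀, spatial x)))
    (L := fun x => C * height (spatial x) ^ N) one_pos
    (integrable_slice (hasTemperateGrowth_hessian hF.temperate) ϑ₀ _ _)
    ((integrable_height_pow _ _ N).const_mul C) (fun ϑ hϑ x => ?_) ?_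
    (fun n => ((measurable_chart hΦ).comp (hmeas n)).aemeasurable) hcons ?_
    (tendstoInDistribution_score hd hΦ hlo hhi h₀ hI hX hindep)
  · have h2 : ‖ϑ‖ < ‖ϑ₀‖ + 2 := by
      have := norm_sub_norm_le ϑ ϑ₀
      linarith
    rw [hF.score_eq_riesz h2, hF.score_eq_riesz hR, ContinuousLinearMap.comp_apply, ← map_sub,
      ← map_sub, norm_riesz]
    exact hT ϑ ϑ₀ h2.le hR.le _
  · ext1 v
    rw [ContinuousLinearMap.comp_apply, integral_hessian_apply hF hR
      (integral_bartlett hd hΦ hlo hhi h₀ hF hR).2, map_neg, ← mul_apply_eq_comp,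
      ← map_mul, Matrix.nonsing_inv_mul _ hI.det_pos.ne'.isUnit, map_one]
    rfl
  · have h := ae_all_iff.2 fun n => ae_all_iff.2 (hmle n)
    filter_upwards [h, hcons] with ω hω hlim
    exact eventually_sum_score_eq_zero hΦ h₀ hω hlim

end Main

end HypWN

end

/-! ### The asymptotic linear representation and the limit law. -/

open HypWN
theorem mainTheorem2 {d : ℕ} (hd : 2 ≤ d) {lo hi : ℝ} (hlo : 0 < lo) (hlohi : lo < hi)
    (μ₀ : Hyp d) (S₀ : SPD d) (hS₀ : S₀ ∈ interior (shell d lo hi))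
    (Φ : EuclideanSpace ℝ (Fin d) ≃ₗ[ℝ] tangentSpace μ₀) (hΦ : ∀ v, tnorm (Φ v) = ‖v‖)
    (ϑ₀ : Param d) (hϑ₀ : ϑ₀ = chart μ₀ Φ (μ₀, S₀))
    (hI : (fisherInfo μ₀ Φ ϑ₀).PosDef)
    {Ω : Type*} [MeasurableSpace Ω] (P : Measure Ω) [IsProbabilityMeasure P]
    (X : ℕ → Ω → Hyp d) (hX : ∀ i, HasLaw (X i) (hwn μ₀ S₀) P) (hindep : iIndepFun X P)
    (θhat : ℕ → Ω → Hyp d × SPD d) (hmeas : ∀ n, Measurable (θhat n))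
    (hmle : ∀ n, 1 ≤ n → ∀ᵐ ω ∂P, IsShellMLE lo hi n (fun i => X i ω) (θhat n ω)) :
    TendstoInMeasure P
      (fun (n : ℕ) ω => √(n : ℝ) • (chart μ₀ Φ (θhat n ω) - ϑ₀)
        - Matrix.toEuclideanCLM (𝕜 := ℝ) (fisherInfo μ₀ Φ ϑ₀)⁻¹
            ((√(n : ℝ))⁻¹ • ∑ i ∈ Finset.range n, score μ₀ Φ ϑ₀ (X i ω)))
      atTop (fun _ => 0) ∧
    TendstoInDistribution
      (fun (n : ℕ) ω => √(n : ℝ) • (chart μ₀ Φ (θhat n ω) - ϑ₀))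
      atTop id (fun _ => P) (multivariateGaussian 0 (fisherInfo μ₀ Φ ϑ₀)⁻¹) := by
  have hd1 : 1 ≤ d := by omega
  have hhi : 0 < hi := hlo.trans hlohi
  have hc : chartInv μ₀ Φ ϑ₀ = (μ₀, S₀) := by rw [hϑ₀, chartInv_chart]
  have h₀ : (chartInv μ₀ Φ ϑ₀).2 ∈ interior (shell d lo hi) := by rwa [hc]
  have hX' : ∀ i, HasLaw (X i) (hwn (chartInv μ₀ Φ ϑ₀).1 (chartInv μ₀ Φ ϑ₀).2) P := by rwa [hc]
  have hlin := tendstoInMeasure_chart hd1 hΦ hlo hhi h₀ hI hX' hindep hmeas hmle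
  -- Slutsky's lemma: the scaled error differs from the normalized score by a term vanishing in
  -- probability.
  refine ⟨hlin, tendstoInDistribution_of_tendstoInMeasure_sub _ _
    (tendstoInDistribution_score hd1 hΦ hlo hhi h₀ hI hX' hindep) hlin fun n => ?_⟩
  exact AEMeasurable.fun_const_smul
    (((measurable_chart hΦ).comp (hmeas n)).aemeasurable.sub_const ϑ₀) _
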